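/- Let $\Bbbk$ be an algebraically closed field; all categories and functors are additive and $\Bbbk$-linear. **Bilax-unital 2-categories.** A 2-semicategory has objects, hom categories $\mathscr C(\mathtt i,\mathtt j)$ and an associative bilinear horizontal composition $(G,F)\mapsto GF$ (associative strictly, or up to coherent natural isomorphism), but no units are required. A lax unit at $\mathtt i$ is a 1-morphism $I_{\mathtt i}\in\mathscr C(\mathtt i,\mathtt i)$ with natural 2-morphisms $l_F:I_{\mathtt i}F\to F$, $r_G:GI_{\mathtt i}\to G$ such that $\mathrm{id}_G\,l_F=r_G\,\mathrm{id}_F$, $l_{FH}=l_F\,\mathrm{id}_H$, $r_{KG}=\mathrm{id}_K\,r_G$; an oplax unit $I'_{\mathtt i}$ with $l'_F:F\to I'_{\mathtt i}F$, $r'_G:G\to GI'_{\mathtt i}$ is defined dually. A bilax-unital 2-category is a 2-semicategory with a lax unit and an oplax unit chosen at each object. An adjoint pair $(F,G)$, $F:\mathtt i\to\mathtt j$, $G:\mathtt j\to\mathtt i$, consists of $\alpha:I'_{\mathtt i}\to GF$ and $\beta:FG\to I_{\mathtt j}$ with $l_F\circ(\beta F)\circ(F\alpha)\circ r'_F=\mathrm{id}_F$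 and $r_G\circ(G\beta)\circ(\alpha G)\circ l'_G=\mathrm{id}_G$. A $\Bbbk$-linear category is finitary if it is additive and idempotent split, has finite-dimensional morphism spaces and finitely many indecomposable objects up to isomorphism; $\mathscr C$ is finitary if it has finitely many objects, finitary hom categories and indecomposable lax and oplax units. A finitary $\mathscr C$ is *weakly fiax* if there is an equivalence $(-)^\star$ from $\mathscr C$ to $\mathscr C$ with reversed 1- and 2-morphisms, the identity on objects, with $I_{\mathtt i}^\star=I'_{\mathtt i}$, $(l_F)^\star=r'_{F^\star}$, $(r_G)^\star=l'_{G^\star}$ (up to coherent isomorphism), together with adjoint pairs $(F,F^\star)$, with adjunction 2-morphisms $\alpha_F,\beta_F$, such that $\gamma^\star=r_{F^\star}\circ(F^\star\beta_G)\circ(F^\star\gamma G^\star)\circ(\alpha_FG^\star)\circ l'_{G^\star}$ for all $\gamma:F\to G$; it is *fiax* if moreover $(-)^{\star\star}\cong\mathrm{Id}$. **Bilax 2-representations.** A bilax 2-representation $\mathbf M$ of $\mathscr C$ consists of categories $\mathbf M(\mathtt i)$, functors $\mathbf M(F):\mathbf M(\mathtt i)\to\mathbf M(\mathtt j)$ for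 $F\in\mathscr C(\mathtt i,\mathtt j)$, functorial in $F$ and compatible with horizontal composition (strictly or up to coherent isomorphism), and natural transformations $u_{\mathtt i}:\mathbf M(I_{\mathtt i})\to\mathrm{id}$, $u'_{\mathtt i}:\mathrm{id}\to\mathbf M(I'_{\mathtt i})$ with $u\,\mathrm{id}_{\mathbf M(F)}=\mathbf M(l_F)$, $\mathrm{id}_{\mathbf M(G)}u=\mathbf M(r_G)$, $u'\,\mathrm{id}_{\mathbf M(F)}=\mathbf M(l'_F)$, $\mathrm{id}_{\mathbf M(G)}u'=\mathbf M(r'_G)$. It is finitary if all $\mathbf M(\mathtt i)$ are. $\mathbf M$ and $\mathbf N$ are equivalent, $\mathbf M\simeq\mathbf N$, if there are equivalences $\Phi_{\mathtt i}:\mathbf M(\mathtt i)\to\mathbf N(\mathtt i)$ and natural isomorphisms $\mathbf N(F)\Phi_{\mathtt i}\cong\Phi_{\mathtt j}\mathbf M(F)$, natural in $F$ and compatible with horizontal composition and with $u,u'$. Let $\mathscr C\mathbf M(\mathtt j)$ be the additive idempotent split closure of $\{\mathbf M(F)X\mid F\in\mathscr C(\mathtt m,\mathtt j),\ X\in\mathbf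 M(\mathtt m)\}$ in $\mathbf M(\mathtt j)$. **Coalgebras.** Let $\underline{\mathscr C}$ be the injective abelianization of $\mathscr C$: its 1-morphisms are finite tuples $(f_s:X\to Y_s)_s$ of 2-morphisms of $\mathscr C$, its 2-morphisms to $(f'_t:X'\to Y'_t)_t$ are homotopy classes of tuples $(g:X\to X',\,h_{s,t}:Y_s\to Y'_t)$ with $f'_tg=\sum_sh_{s,t}f_s$, the null-homotopic ones being those with $g=\sum_sq_sf_s$ for some $q_s:Y_s\to X'$; horizontal composition is $(f_s)\circ(f'_t)=(\mathrm{id}_Xf'_t,\ f_s\,\mathrm{id}_{X'})$, and the (op)lax units are those of $\mathscr C$, which embeds by $X\mapsto(X;\ )$. A coalgebra at $\mathtt i$ is a 1-morphism $C\in\underline{\mathscr C}(\mathtt i,\mathtt i)$ with a coassociative $\Delta:C\to CC$ and $\varepsilon:C\to I'_{\mathtt i}$ such that $(\varepsilon C)\Delta=l'_C$ and $(C\varepsilon)\Delta=r'_C$. A right $C$-comodule in $\underline{\mathscr C}(\mathtt i,\mathtt j)$ is a 1-morphism $M$ with a coassociative $\rho:M\to MC$ such that $(M\varepsilon)\rho=r'_M$.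 These form a bilax 2-representation $\mathrm{comod}_{\underline{\mathscr C}}\text{-}C$ of $\underline{\mathscr C}$ under left composition, with $u=l$ and $u'=l'$. Two coalgebras are *Morita–Takeuchi equivalent* if their bilax 2-representations $\mathrm{comod}_{\underline{\mathscr C}}$ of $\underline{\mathscr C}$ are equivalent. If $\mathscr C$ is weakly fiax, then the injective objects of the categories $(\mathrm{comod}_{\underline{\mathscr C}}\text{-}C)(\mathtt j)$ form a bilax 2-representation $\mathrm{inj}_{\underline{\mathscr C}}\text{-}C$ of $\mathscr C$. Let $\mathscr CC$ be the bilax 2-representation of $\mathscr C$ for which $\mathscr CC(\mathtt j)$ is the additive idempotent split closure of $\{FC\mid F\in\mathscr C(\mathtt i,\mathtt j)\}$ in $(\mathrm{comod}_{\underline{\mathscr C}}\text{-}C)(\mathtt j)$. Write $I=I_{\mathtt i}$, $I'=I'_{\mathtt i}\cong I^\star$, with adjunction 2-morphisms $\alpha:I'\to I'I$ and $\beta:II'\to I$. Then $ICI'$ is a coalgebra with comultiplication $$ICI'\xrightarrow{I\Delta I'}ICCI'\xrightarrow{ICl'_{CI'}}ICI'CI'\xrightarrow{IC\alpha CI'}ICI'ICI'$$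 and counit $$ICI'\xrightarrow{I\varepsilon I'}II'I'\xrightarrow{sI'}II'\xrightarrow{\beta}I\xrightarrow{l'_I}I'I\xrightarrow{r_{I'}}I',\qquad s=l_I\circ(\beta I)\circ(I\alpha):II'\to I.$$ **Proposition.** Let $\mathscr C$ be a weakly fiax 2-category (for instance, a fiax 2-category), $\mathtt i$ an object of $\mathscr C$ and $C$ a coalgebra 1-morphism in $\underline{\mathscr C}(\mathtt i,\mathtt i)$. Then the following are equivalent: 1. $\mathrm{inj}_{\underline{\mathscr C}}\text{-}C\simeq\mathscr CC$ as bilax 2-representations of $\mathscr C$; 2. $C$ is Morita–Takeuchi equivalent to $I_{\mathtt i}CI'_{\mathtt i}$; 3. $\mathrm{inj}_{\underline{\mathscr C}}\text{-}C$ is finitary and $\mathscr C\,\mathrm{inj}_{\underline{\mathscr C}}\text{-}C=\mathrm{inj}_{\underline{\mathscr C}}\text{-}C$. A coalgebra satisfying these conditions is called finitary. -/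

import Mathlib

set_option linter.checkUnivs false

open CategoryTheory CategoryTheory.Limits

universe w v u

/-- A `k`-linear 2-semicategory: hom categories that are `k`-linear, and a bilinear horizontal
composition `(G, F) ↦ G ⊚ F` (first `F`, then `G`) that is associative up to coherent natural
isomorphism.  The strictly associative case is the one where all associators are identities. -/
structure TwoSemicategory (k : Type*) [Field k] (B : Type w) where
  Hom : B → B → Type u
  homCategory : ∀ a b, Category.{v} (Hom a b)
  homPreadditive : ∀ a b, Preadditive (Hom a b)
  homLinear : ∀ a b, Linear k (Hom a b)
  hcomp : ∀ {a b c : B}, Hom b c → Hom a b → Hom a c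
  whiskerLeft : ∀ {a b c : B} (G : Hom b c) {F F' : Hom a b}, (F ⟶ F') → (hcomp G F ⟶ hcomp G F')
  whiskerRight : ∀ {a b c : B} {G G' : Hom b c}, (G ⟶ G') → ∀ F : Hom a b, hcomp G F ⟶ hcomp G' F
  associator : ∀ {a b c d : B} (K : Hom c d) (G : Hom b c) (F : Hom a b),
    hcomp (hcomp K G) F ≅ hcomp K (hcomp G F)
  whiskerLeft_id : ∀ {a b c : B} (G : Hom b c) (F : Hom a b), whiskerLeft G (𝟙 F) = 𝟙 (hcomp G F)
  whiskerLeft_comp : ∀ {a b c : B} (G : Hom b c) {F F' F'' : Hom a b} (f : F ⟶ F') (g : F' ⟶ F''),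
    whiskerLeft G (f ≫ g) = whiskerLeft G f ≫ whiskerLeft G g
  id_whiskerRight : ∀ {a b c : B} (G : Hom b c) (F : Hom a b),
    whiskerRight (𝟙 G) F = 𝟙 (hcomp G F)
  comp_whiskerRight : ∀ {a b c : B} {G G' G'' : Hom b c} (f : G ⟶ G') (g : G' ⟶ G'') (F : Hom a b),
    whiskerRight (f ≫ g) F = whiskerRight f F ≫ whiskerRight g F
  whisker_exchange : ∀ {a b c : B} {G G' : Hom b c} {F F' : Hom a b} (g : G ⟶ G') (f : F ⟶ F'),
    whiskerLeft G f ≫ whiskerRight g F' = whiskerRight g F ≫ whiskerLeft G' f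
  whiskerLeft_add : ∀ {a b c : B} (G : Hom b c) {F F' : Hom a b} (f f' : F ⟶ F'),
    whiskerLeft G (f + f') = whiskerLeft G f + whiskerLeft G f'
  whiskerLeft_smul : ∀ {a b c : B} (G : Hom b c) {F F' : Hom a b} (t : k) (f : F ⟶ F'),
    whiskerLeft G (t • f) = t • whiskerLeft G f
  add_whiskerRight : ∀ {a b c : B} {G G' : Hom b c} (g g' : G ⟶ G') (F : Hom a b),
    whiskerRight (g + g') F = whiskerRight g F + whiskerRight g' F
  smul_whiskerRight : ∀ {a b c : B} {G G' : Hom b c} (t : k) (g : G ⟶ G') (F : Hom a b),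
    whiskerRight (t • g) F = t • whiskerRight g F
  associator_naturality_left : ∀ {a b c d : B} {K K' : Hom c d} (f : K ⟶ K') (G : Hom b c)
    (F : Hom a b), whiskerRight (whiskerRight f G) F ≫ (associator K' G F).hom =
      (associator K G F).hom ≫ whiskerRight f (hcomp G F)
  associator_naturality_middle : ∀ {a b c d : B} (K : Hom c d) {G G' : Hom b c} (f : G ⟶ G')
    (F : Hom a b), whiskerRight (whiskerLeft K f) F ≫ (associator K G' F).hom =
      (associator K G F).hom ≫ whiskerLeft K (whiskerRight f F)
  associator_naturality_right : ∀ {a b c d : B} (K : Hom c d) (G : Hom b c) {F F' : Hom a b}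
    (f : F ⟶ F'), whiskerLeft (hcomp K G) f ≫ (associator K G F').hom =
      (associator K G F).hom ≫ whiskerLeft K (whiskerLeft G f)
  pentagon : ∀ {a b c d e : B} (L : Hom d e) (K : Hom c d) (G : Hom b c) (F : Hom a b),
    whiskerRight (associator L K G).hom F ≫ (associator L (hcomp K G) F).hom ≫
        whiskerLeft L (associator K G F).hom =
      (associator (hcomp L K) G F).hom ≫ (associator L K (hcomp G F)).hom

attribute [instance] TwoSemicategory.homCategory TwoSemicategory.homPreadditive
  TwoSemicategory.homLinear

notation:81 G:82 " ⊚ " F:81 => TwoSemicategory.hcomp _ G F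
notation:81 G:82 " ◁ " f:81 => TwoSemicategory.whiskerLeft _ G f
notation:81 f:81 " ▷ " F:82 => TwoSemicategory.whiskerRight _ f F

namespace TwoSemicategory

variable {k : Type*} [Field k] {B : Type w} (S : TwoSemicategory.{w, v, u} k B)

variable {S}

attribute [simp] whiskerLeft_id id_whiskerRight whiskerLeft_comp comp_whiskerRight whiskerLeft_add
  whiskerLeft_smul add_whiskerRight smul_whiskerRight

section
variable {a b c d e : B}

/-- Whiskering an isomorphism. -/
@[simps]
def whiskerLeftIso (G : S.Hom b c) {F F' : S.Hom a b} (f : F ≅ F') : G ⊚ F ≅ G ⊚ F' where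
  hom := G ◁ f.hom
  inv := G ◁ f.inv
  hom_inv_id := by rw [← S.whiskerLeft_comp]; simp
  inv_hom_id := by rw [← S.whiskerLeft_comp]; simp

@[simps]
def whiskerRightIso {G G' : S.Hom b c} (f : G ≅ G') (F : S.Hom a b) : G ⊚ F ≅ G' ⊚ F where
  hom := f.hom ▷ F
  inv := f.inv ▷ F
  hom_inv_id := by rw [← S.comp_whiskerRight]; simp
  inv_hom_id := by rw [← S.comp_whiskerRight]; simp

theorem whiskerLeft_zero (G : S.Hom b c) (F F' : S.Hom a b) : G ◁ (0 : F ⟶ F') = 0 := by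
  have h := S.whiskerLeft_smul G (0 : k) (0 : F ⟶ F')
  simpa using h

theorem zero_whiskerRight (G G' : S.Hom b c) (F : S.Hom a b) : (0 : G ⟶ G') ▷ F = 0 := by
  have h := S.smul_whiskerRight (0 : k) (0 : G ⟶ G') F
  simpa using h


@[simp]
theorem whiskerLeft_hom_inv (G : S.Hom b c) {F F' : S.Hom a b} (f : F ≅ F') :
    G ◁ f.hom ≫ G ◁ f.inv = 𝟙 _ := (whiskerLeftIso G f).hom_inv_id

@[simp]
theorem whiskerLeft_inv_hom (G : S.Hom b c) {F F' : S.Hom a b} (f : F ≅ F') :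
    G ◁ f.inv ≫ G ◁ f.hom = 𝟙 _ := (whiskerLeftIso G f).inv_hom_id

@[simp]
theorem hom_inv_whiskerRight {G G' : S.Hom b c} (f : G ≅ G') (F : S.Hom a b) :
    f.hom ▷ F ≫ f.inv ▷ F = 𝟙 _ := (whiskerRightIso f F).hom_inv_id

@[simp]
theorem inv_hom_whiskerRight {G G' : S.Hom b c} (f : G ≅ G') (F : S.Hom a b) :
    f.inv ▷ F ≫ f.hom ▷ F = 𝟙 _ := (whiskerRightIso f F).inv_hom_id

theorem pentagon_inv (L : S.Hom d e) (K : S.Hom c d) (G : S.Hom b c) (F : S.Hom a b) :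
    L ◁ (S.associator K G F).inv ≫ (S.associator L (K ⊚ G) F).inv ≫
        (S.associator L K G).inv ▷ F =
      (S.associator L K (G ⊚ F)).inv ≫ (S.associator (L ⊚ K) G F).inv := by
  have h : whiskerRightIso (S.associator L K G) F ≪≫ S.associator L (K ⊚ G) F ≪≫
      whiskerLeftIso L (S.associator K G F) =
      S.associator (L ⊚ K) G F ≪≫ S.associator L K (G ⊚ F) :=
    Iso.ext (by simpa using S.pentagon L K G F)
  simpa using congrArg Iso.inv h

theorem pentagon_hom_inv (L : S.Hom d e) (K : S.Hom c d) (G : S.Hom b c) (F : S.Hom a b) :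
    (S.associator L (K ⊚ G) F).hom ≫ L ◁ (S.associator K G F).hom ≫
        (S.associator L K (G ⊚ F)).inv =
      (S.associator L K G).inv ▷ F ≫ (S.associator (L ⊚ K) G F).hom := by
  have p := S.pentagon L K G F
  have q := inv_hom_whiskerRight (S.associator L K G) F
  rw [← Category.id_comp ((S.associator L (K ⊚ G) F).hom ≫ _), ← q]
  simp only [Category.assoc]
  rw [reassoc_of% p]
  simp

theorem comp_whiskerLeft (K : S.Hom c d) (G : S.Hom b c) {F F' : S.Hom a b} (f : F ⟶ F') :
    (K ⊚ G) ◁ f = (S.associator K G F).hom ≫ K ◁ G ◁ f ≫ (S.associator K G F').inv := by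
  rw [← Category.assoc, ← S.associator_naturality_right]; simp

theorem whiskerRight_comp {K K' : S.Hom c d} (f : K ⟶ K') (G : S.Hom b c) (F : S.Hom a b) :
    f ▷ (G ⊚ F) = (S.associator K G F).inv ≫ f ▷ G ▷ F ≫ (S.associator K' G F).hom := by
  rw [S.associator_naturality_left]; simp

theorem whisker_assoc (K : S.Hom c d) {G G' : S.Hom b c} (f : G ⟶ G') (F : S.Hom a b) :
    (K ◁ f) ▷ F = (S.associator K G F).hom ≫ K ◁ f ▷ F ≫ (S.associator K G' F).inv := by
  rw [← Category.assoc, ← S.associator_naturality_middle]; simp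

end
end TwoSemicategory

/-- A lax unit at `i`: a 1-morphism with natural left and right unitors `I ⊚ F ⟶ F` and
`G ⊚ I ⟶ G`, compatible with each other and with horizontal composition. -/
structure LaxUnit {k : Type*} [Field k] {B : Type w} (S : TwoSemicategory.{w, v, u} k B)
    (i : B) where
  I : S.Hom i i
  l : ∀ {j : B} (F : S.Hom j i), I ⊚ F ⟶ F
  r : ∀ {j : B} (G : S.Hom i j), G ⊚ I ⟶ G
  l_naturality : ∀ {j : B} {F F' : S.Hom j i} (f : F ⟶ F'), I ◁ f ≫ l F' = l F ≫ f
  r_naturality : ∀ {j : B} {G G' : S.Hom i j} (g : G ⟶ G'), g ▷ I ≫ r G' = r G ≫ g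
  l_r : ∀ {j m : B} (G : S.Hom i m) (F : S.Hom j i),
    (S.associator G I F).hom ≫ G ◁ l F = r G ▷ F
  l_comp : ∀ {j m : B} (F : S.Hom j i) (H : S.Hom m j),
    (S.associator I F H).hom ≫ l (F ⊚ H) = l F ▷ H
  r_comp : ∀ {j m : B} (K : S.Hom j m) (G : S.Hom i j),
    (S.associator K G I).hom ≫ K ◁ r G = r (K ⊚ G)

/-- An oplax unit at `i`, the dual notion. -/
structure OplaxUnit {k : Type*} [Field k] {B : Type w} (S : TwoSemicategory.{w, v, u} k B)
    (i : B) where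
  I : S.Hom i i
  l : ∀ {j : B} (F : S.Hom j i), F ⟶ I ⊚ F
  r : ∀ {j : B} (G : S.Hom i j), G ⟶ G ⊚ I
  l_naturality : ∀ {j : B} {F F' : S.Hom j i} (f : F ⟶ F'), f ≫ l F' = l F ≫ I ◁ f
  r_naturality : ∀ {j : B} {G G' : S.Hom i j} (g : G ⟶ G'), g ≫ r G' = r G ≫ g ▷ I
  l_r : ∀ {j m : B} (G : S.Hom i m) (F : S.Hom j i),
    r G ▷ F ≫ (S.associator G I F).hom = G ◁ l F
  l_comp : ∀ {j m : B} (F : S.Hom j i) (H : S.Hom m j),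
    l F ▷ H ≫ (S.associator I F H).hom = l (F ⊚ H)
  r_comp : ∀ {j m : B} (K : S.Hom j m) (G : S.Hom i j),
    r (K ⊚ G) ≫ (S.associator K G I).hom = K ◁ r G

/-- A bilax-unital 2-category: a 2-semicategory with a chosen lax unit and a chosen oplax unit at
every object. -/
structure BilaxTwoCategory (k : Type*) [Field k] (B : Type w)
    extends TwoSemicategory.{w, v, u} k B where
  lax : ∀ i : B, LaxUnit toTwoSemicategory i
  oplax : ∀ i : B, OplaxUnit toTwoSemicategory i

namespace BilaxTwoCategory

variable {k : Type*} [Field k] {B : Type w} (𝒞 : BilaxTwoCategory.{w, v, u} k B)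

/-- The unit transformation `X ⟶ G ⊚ F ⊚ X` induced by `α : I' ⟶ G ⊚ F`. -/
def unitAt {i j a : B} {F : 𝒞.Hom i j} {G : 𝒞.Hom j i} (α : (𝒞.oplax i).I ⟶ G ⊚ F)
    (X : 𝒞.Hom a i) : X ⟶ G ⊚ F ⊚ X :=
  (𝒞.oplax i).l X ≫ α ▷ X ≫ (𝒞.associator G F X).hom

/-- The counit transformation `F ⊚ G ⊚ Y ⟶ Y` induced by `β : F ⊚ G ⟶ I`. -/
def counitAt {i j a : B} {F : 𝒞.Hom i j} {G : 𝒞.Hom j i} (β : F ⊚ G ⟶ (𝒞.lax j).I)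
    (Y : 𝒞.Hom a j) : F ⊚ G ⊚ Y ⟶ Y :=
  (𝒞.associator F G Y).inv ≫ β ▷ Y ≫ (𝒞.lax j).l Y

/-- An adjoint pair `(F, G)` of 1-morphisms in a bilax-unital 2-category. -/
structure AdjointPair {i j : B} (F : 𝒞.Hom i j) (G : 𝒞.Hom j i) where
  α : (𝒞.oplax i).I ⟶ G ⊚ F
  β : F ⊚ G ⟶ (𝒞.lax j).I
  left_triangle : (𝒞.oplax i).r F ≫ F ◁ α ≫ (𝒞.associator F G F).inv ≫ β ▷ F ≫ (𝒞.lax j).l F = 𝟙 F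
  right_triangle :
    (𝒞.oplax i).l G ≫ α ▷ G ≫ (𝒞.associator G F G).hom ≫ G ◁ β ≫ (𝒞.lax j).r G = 𝟙 G

/-- A coalgebra 1-morphism at `i`. -/
structure Coalgebra (i : B) where
  X : 𝒞.Hom i i
  Δ : X ⟶ X ⊚ X
  ε : X ⟶ (𝒞.oplax i).I
  coassoc : Δ ≫ Δ ▷ X ≫ (𝒞.associator X X X).hom = Δ ≫ X ◁ Δ
  counit_left : Δ ≫ ε ▷ X = (𝒞.oplax i).l X
  counit_right : Δ ≫ X ◁ ε = (𝒞.oplax i).r X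

section
variable {𝒞} {i j a b : B} {F : 𝒞.Hom i j} {G : 𝒞.Hom j i}

theorem unitAt_naturality (α : (𝒞.oplax i).I ⟶ G ⊚ F) {X Y : 𝒞.Hom a i} (f : X ⟶ Y) :
    f ≫ 𝒞.unitAt α Y = 𝒞.unitAt α X ≫ G ◁ F ◁ f := by
  simp only [unitAt, Category.assoc]
  rw [← 𝒞.associator_naturality_right, reassoc_of% (𝒞.oplax i).l_naturality,
    reassoc_of% 𝒞.whisker_exchange]

theorem counitAt_naturality (β : F ⊚ G ⟶ (𝒞.lax j).I) {X Y : 𝒞.Hom a j} (f : X ⟶ Y) :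
    F ◁ G ◁ f ≫ 𝒞.counitAt β Y = 𝒞.counitAt β X ≫ f := by
  simp only [counitAt, Category.assoc]
  rw [← (𝒞.lax j).l_naturality, ← reassoc_of% 𝒞.whisker_exchange,
    TwoSemicategory.comp_whiskerLeft]
  simp

theorem unitAt_comp (α : (𝒞.oplax i).I ⟶ G ⊚ F) (X : 𝒞.Hom a i) (Y : 𝒞.Hom b a) :
    𝒞.unitAt α (X ⊚ Y) = 𝒞.unitAt α X ▷ Y ≫ (𝒞.associator _ _ _).hom ≫
      G ◁ (𝒞.associator _ _ _).hom := by
  simp only [unitAt, TwoSemicategory.comp_whiskerRight, Category.assoc,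
    TwoSemicategory.pentagon, ← (𝒞.oplax i).l_comp]
  rw [← reassoc_of% 𝒞.associator_naturality_left]

theorem counitAt_comp (β : F ⊚ G ⟶ (𝒞.lax j).I) (X : 𝒞.Hom a j) (Y : 𝒞.Hom b a) :
    (𝒞.associator _ _ _).hom ≫ F ◁ (𝒞.associator _ _ _).hom ≫ 𝒞.counitAt β (X ⊚ Y) =
      𝒞.counitAt β X ▷ Y := by
  simp only [counitAt, TwoSemicategory.comp_whiskerRight, ← (𝒞.lax j).l_comp]
  rw [reassoc_of% TwoSemicategory.pentagon_hom_inv, reassoc_of% 𝒞.associator_naturality_left]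

theorem AdjointPair.unitAt_counitAt (P : 𝒞.AdjointPair F G) (X : 𝒞.Hom a i) :
    F ◁ 𝒞.unitAt P.α X ≫ 𝒞.counitAt P.β (F ⊚ X) = 𝟙 _ := by
  have h := congrArg (fun t => t ▷ X) P.left_triangle
  simp only [TwoSemicategory.comp_whiskerRight, TwoSemicategory.id_whiskerRight,
    TwoSemicategory.whisker_assoc, Category.assoc, ← (𝒞.lax j).l_comp] at h
  rw [reassoc_of% 𝒞.associator_naturality_left, reassoc_of% (𝒞.oplax i).l_r,
    ← reassoc_of% TwoSemicategory.pentagon_hom_inv] at h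
  simpa [unitAt, counitAt] using h

/-- The retraction `F ⊚ I' ⊚ Z ⟶ F ⊚ Z` of the map induced by the oplax unitor. -/
def AdjointPair.retr (P : 𝒞.AdjointPair F G) (Z : 𝒞.Hom a i) :
    F ⊚ (𝒞.oplax i).I ⊚ Z ⟶ F ⊚ Z :=
  F ◁ (P.α ▷ Z ≫ (𝒞.associator G F Z).hom) ≫ 𝒞.counitAt P.β (F ⊚ Z)

theorem AdjointPair.l_retr (P : 𝒞.AdjointPair F G) (Z : 𝒞.Hom a i) :
    F ◁ (𝒞.oplax i).l Z ≫ P.retr Z = 𝟙 _ := by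
  rw [retr, ← Category.assoc, ← 𝒞.whiskerLeft_comp, ← P.unitAt_counitAt Z]
  rfl

theorem AdjointPair.retr_naturality (P : 𝒞.AdjointPair F G) {Z W : 𝒞.Hom a i} (f : Z ⟶ W) :
    F ◁ (𝒞.oplax i).I ◁ f ≫ P.retr W = P.retr Z ≫ F ◁ f := by
  simp only [retr, Category.assoc, TwoSemicategory.whiskerLeft_comp]
  rw [← counitAt_naturality]
  simp only [← 𝒞.whiskerLeft_comp, ← Category.assoc]
  congr 2
  rw [𝒞.whisker_exchange, Category.assoc, Category.assoc, 𝒞.associator_naturality_right]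

theorem AdjointPair.retr_comp (P : 𝒞.AdjointPair F G) (Z : 𝒞.Hom a i) (Y : 𝒞.Hom b a) :
    P.retr Z ▷ Y ≫ (𝒞.associator F Z Y).hom = (𝒞.associator _ _ _).hom ≫
      F ◁ (𝒞.associator _ _ _).hom ≫ P.retr (Z ⊚ Y) := by
  simp only [retr, 𝒞.comp_whiskerRight, Category.assoc]
  rw [← counitAt_comp, Category.assoc, Category.assoc, ← counitAt_naturality,
    reassoc_of% 𝒞.associator_naturality_middle]
  rw [← reassoc_of% 𝒞.whiskerLeft_comp, ← reassoc_of% 𝒞.whiskerLeft_comp,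
    ← reassoc_of% 𝒞.whiskerLeft_comp]
  congr 3
  rw [𝒞.comp_whiskerRight, Category.assoc, Category.assoc, 𝒞.pentagon, reassoc_of% 𝒞.associator_naturality_left]

/-- The reassociation isomorphism `(F ⊚ C ⊚ G) ⊚ X ≅ F ⊚ C ⊚ G ⊚ X`. -/
def assoc₄ {p q r s t : B} (F : 𝒞.Hom s t) (C : 𝒞.Hom r s) (G : 𝒞.Hom q r) (X : 𝒞.Hom p q) :
    (F ⊚ C ⊚ G) ⊚ X ≅ F ⊚ C ⊚ G ⊚ X :=
  𝒞.associator F (C ⊚ G) X ≪≫ TwoSemicategory.whiskerLeftIso F (𝒞.associator C G X)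

theorem assoc₄_naturality {p q r s t : B} (F : 𝒞.Hom s t) (C : 𝒞.Hom r s) (G : 𝒞.Hom q r)
    {X Y : 𝒞.Hom p q} (f : X ⟶ Y) :
    (F ⊚ C ⊚ G) ◁ f ≫ (assoc₄ F C G Y).hom = (assoc₄ F C G X).hom ≫ F ◁ C ◁ G ◁ f := by
  simp only [assoc₄, Iso.trans_hom, TwoSemicategory.whiskerLeftIso_hom, Category.assoc]
  rw [reassoc_of% 𝒞.associator_naturality_right]
  simp only [← 𝒞.whiskerLeft_comp, 𝒞.associator_naturality_right]

theorem assoc₄_inv_naturality {p q r s t : B} (F : 𝒞.Hom s t) (C : 𝒞.Hom r s) (G : 𝒞.Hom q r)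
    {X Y : 𝒞.Hom p q} (f : X ⟶ Y) :
    (assoc₄ F C G X).inv ≫ (F ⊚ C ⊚ G) ◁ f = F ◁ C ◁ G ◁ f ≫ (assoc₄ F C G Y).inv := by
  rw [Iso.inv_comp_eq, ← Category.assoc, Iso.eq_comp_inv, assoc₄_naturality]

theorem assoc₄_comp {o p q r s t : B} (F : 𝒞.Hom s t) (C : 𝒞.Hom r s) (G : 𝒞.Hom q r)
    (X : 𝒞.Hom p q) (Y : 𝒞.Hom o p) :
    (assoc₄ F C G X).hom ▷ Y ≫ (𝒞.associator F (C ⊚ G ⊚ X) Y).hom ≫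
      F ◁ ((𝒞.associator C (G ⊚ X) Y).hom ≫ C ◁ (𝒞.associator G X Y).hom) =
    (𝒞.associator (F ⊚ C ⊚ G) X Y).hom ≫ (assoc₄ F C G (X ⊚ Y)).hom := by
  simp only [assoc₄, Iso.trans_hom, TwoSemicategory.whiskerLeftIso_hom, Category.assoc,
    TwoSemicategory.comp_whiskerRight]
  rw [reassoc_of% 𝒞.associator_naturality_middle, ← 𝒞.whiskerLeft_comp, 𝒞.pentagon,
    𝒞.whiskerLeft_comp, reassoc_of% 𝒞.pentagon]

namespace Coalgebra

variable (C : 𝒞.Coalgebra i)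

/-- `C ⊚ X ⟶ C ⊚ C ⊚ X ⟶ C ⊚ G ⊚ F ⊚ C ⊚ X`: comultiply, then insert `α : I' ⟶ G ⊚ F`. -/
def cut (α : (𝒞.oplax i).I ⟶ G ⊚ F) (X : 𝒞.Hom a i) : C.X ⊚ X ⟶ C.X ⊚ G ⊚ F ⊚ C.X ⊚ X :=
  C.Δ ▷ X ≫ (𝒞.associator C.X C.X X).hom ≫ C.X ◁ 𝒞.unitAt α (C.X ⊚ X)

theorem cut_naturality (α : (𝒞.oplax i).I ⟶ G ⊚ F) {X Y : 𝒞.Hom a i} (f : X ⟶ Y) :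
    C.X ◁ f ≫ C.cut α Y = C.cut α X ≫ C.X ◁ G ◁ F ◁ C.X ◁ f := by
  simp only [cut, Category.assoc]
  rw [reassoc_of% 𝒞.whisker_exchange, reassoc_of% 𝒞.associator_naturality_right]
  simp only [← 𝒞.whiskerLeft_comp, unitAt_naturality]

theorem cut_comp (α : (𝒞.oplax i).I ⟶ G ⊚ F) (X : 𝒞.Hom a i) (Y : 𝒞.Hom b a) :
    C.cut α X ▷ Y ≫ (𝒞.associator _ _ _).hom ≫ C.X ◁ ((𝒞.associator _ _ _).hom ≫
        G ◁ ((𝒞.associator _ _ _).hom ≫ F ◁ (𝒞.associator _ _ _).hom)) =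
      (𝒞.associator _ _ _).hom ≫ C.cut α (X ⊚ Y) := by
  simp only [cut, Category.assoc, TwoSemicategory.comp_whiskerRight]
  rw [← reassoc_of% 𝒞.associator_naturality_left, reassoc_of% 𝒞.associator_naturality_middle,
    ← 𝒞.whiskerLeft_comp, ← reassoc_of% 𝒞.pentagon, ← 𝒞.whiskerLeft_comp]
  congr 4
  rw [unitAt_naturality, unitAt_comp α (C.X ⊚ X) Y]
  simp only [Category.assoc, 𝒞.whiskerLeft_comp]

theorem coassoc_at (X : 𝒞.Hom a i) :
    C.Δ ▷ X ≫ (𝒞.associator _ _ _).hom ≫ C.Δ ▷ (C.X ⊚ X) ≫ (𝒞.associator _ _ _).hom =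
      C.Δ ▷ X ≫ (𝒞.associator _ _ _).hom ≫ C.X ◁ (C.Δ ▷ X ≫ (𝒞.associator _ _ _).hom) := by
  have h := congrArg (fun t => t ▷ X ≫ (𝒞.associator _ _ _).hom ≫ C.X ◁ (𝒞.associator _ _ _).hom)
    C.coassoc
  simp only [TwoSemicategory.comp_whiskerRight, Category.assoc] at h
  rw [𝒞.pentagon, reassoc_of% 𝒞.associator_naturality_left,
    reassoc_of% 𝒞.associator_naturality_middle, ← 𝒞.whiskerLeft_comp] at h
  exact h

theorem cut_cut (α : (𝒞.oplax i).I ⟶ G ⊚ F) (X : 𝒞.Hom a i) :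
    C.cut α X ≫ C.cut α (G ⊚ F ⊚ C.X ⊚ X) = C.cut α X ≫ C.X ◁ G ◁ F ◁ C.cut α X := by
  have h : C.Δ ▷ X ≫ (𝒞.associator _ _ _).hom ≫ C.cut α (C.X ⊚ X) =
      C.Δ ▷ X ≫ (𝒞.associator _ _ _).hom ≫ C.X ◁ (C.Δ ▷ X ≫ (𝒞.associator _ _ _).hom) ≫
        C.X ◁ 𝒞.unitAt α (C.X ⊚ C.X ⊚ X) := by
    rw [cut, ← reassoc_of% C.coassoc_at X]
  have e : C.cut α X ≫ C.cut α (G ⊚ F ⊚ C.X ⊚ X) =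
      C.Δ ▷ X ≫ (𝒞.associator _ _ _).hom ≫ C.cut α (C.X ⊚ X) ≫
        C.X ◁ G ◁ F ◁ C.X ◁ 𝒞.unitAt α (C.X ⊚ X) := by
    rw [← cut_naturality, cut, Category.assoc, Category.assoc]
  rw [e, reassoc_of% h]
  simp only [cut, Category.assoc, ← 𝒞.whiskerLeft_comp]
  simp only [← unitAt_naturality, Category.assoc]

theorem counit_left_at (X : 𝒞.Hom a i) :
    C.Δ ▷ X ≫ (𝒞.associator _ _ _).hom ≫ C.ε ▷ (C.X ⊚ X) = (𝒞.oplax i).l (C.X ⊚ X) := by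
  rw [← 𝒞.associator_naturality_left, ← Category.assoc, ← 𝒞.comp_whiskerRight, C.counit_left,
    (𝒞.oplax i).l_comp]

theorem counit_right_at (X : 𝒞.Hom a i) :
    C.Δ ▷ X ≫ (𝒞.associator _ _ _).hom ≫ C.X ◁ C.ε ▷ X = C.X ◁ (𝒞.oplax i).l X := by
  rw [← 𝒞.associator_naturality_middle, ← Category.assoc, ← 𝒞.comp_whiskerRight, C.counit_right,
    (𝒞.oplax i).l_r]

/-- The comultiplication of `F ⊚ C ⊚ G` for an adjoint pair `(F, G)`. -/
def conjΔ (P : 𝒞.AdjointPair F G) : F ⊚ C.X ⊚ G ⟶ (F ⊚ C.X ⊚ G) ⊚ (F ⊚ C.X ⊚ G) :=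
  F ◁ C.cut P.α G ≫ (assoc₄ F C.X G (F ⊚ C.X ⊚ G)).inv

/-- The counit of `F ⊚ C ⊚ G` for an adjoint pair `(F, G)`: the composite
`F C G ⟶ F I' G ⟶ F G ⟶ I ⟶ I' I ⟶ I'`. -/
def conjε (P : 𝒞.AdjointPair F G) : F ⊚ C.X ⊚ G ⟶ (𝒞.oplax j).I :=
  F ◁ C.ε ▷ G ≫ P.retr G ≫ P.β ≫ (𝒞.oplax j).l (𝒞.lax j).I ≫ (𝒞.lax j).r (𝒞.oplax j).I

theorem conjΔ_whiskerRight (P : 𝒞.AdjointPair F G) (X : 𝒞.Hom a j) :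
    C.conjΔ P ▷ X ≫ (𝒞.associator _ _ _).hom ≫ (assoc₄ F C.X G ((F ⊚ C.X ⊚ G) ⊚ X)).hom ≫
      F ◁ C.X ◁ G ◁ (assoc₄ F C.X G X).hom =
    (assoc₄ F C.X G X).hom ≫ F ◁ C.cut P.α (G ⊚ X) := by
  rw [← reassoc_of% assoc₄_comp, conjΔ, 𝒞.comp_whiskerRight, Category.assoc,
    reassoc_of% TwoSemicategory.inv_hom_whiskerRight, reassoc_of% 𝒞.associator_naturality_middle,
    ← 𝒞.whiskerLeft_comp, ← 𝒞.whiskerLeft_comp, assoc₄, Iso.trans_hom, Category.assoc,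
    TwoSemicategory.whiskerLeftIso_hom, ← 𝒞.whiskerLeft_comp, cut_comp, 𝒞.whiskerLeft_comp, Category.assoc]

/-- For an adjoint pair `(F, G)` with `F : i ⟶ j` and a coalgebra `C` at `i`, the coalgebra
`F ⊚ C ⊚ G` at `j`. -/
def conj (P : 𝒞.AdjointPair F G) : 𝒞.Coalgebra j where
  X := F ⊚ C.X ⊚ G
  Δ := C.conjΔ P
  ε := C.conjε P
  coassoc := by
    have h := C.conjΔ_whiskerRight P (F ⊚ C.X ⊚ G)
    rw [← cancel_mono (assoc₄ F C.X G ((F ⊚ C.X ⊚ G) ⊚ F ⊚ C.X ⊚ G)).hom,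
      ← cancel_mono (TwoSemicategory.whiskerLeftIso F (TwoSemicategory.whiskerLeftIso C.X
        (TwoSemicategory.whiskerLeftIso G (assoc₄ F C.X G (F ⊚ C.X ⊚ G))))).hom]
    simp only [Category.assoc, TwoSemicategory.whiskerLeftIso_hom]
    rw [h, reassoc_of% assoc₄_naturality, conjΔ, Category.assoc, Iso.inv_hom_id_assoc,
      Category.assoc, Iso.inv_hom_id_assoc]
    simp only [← 𝒞.whiskerLeft_comp, Category.assoc, Iso.inv_hom_id, Category.comp_id, cut_cut]
  counit_left := by
    have e : C.conjε P ▷ (F ⊚ C.X ⊚ G) = (assoc₄ F C.X G (F ⊚ C.X ⊚ G)).hom ≫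
        F ◁ C.ε ▷ (G ⊚ F ⊚ C.X ⊚ G) ≫ P.retr _ ≫ 𝒞.counitAt P.β _ ≫ (𝒞.oplax j).l _ := by
      simp only [conjε, 𝒞.comp_whiskerRight]
      rw [← (𝒞.lax j).l_r, reassoc_of% (𝒞.oplax j).l_comp, ← (𝒞.oplax j).l_naturality,
        (Iso.eq_comp_inv _).2 (P.retr_comp G (F ⊚ C.X ⊚ G)), counitAt, assoc₄, Iso.trans_hom,
        TwoSemicategory.whiskerLeftIso_hom]
      simp only [Category.assoc]
      rw [reassoc_of% 𝒞.associator_naturality_middle, ← reassoc_of% 𝒞.whiskerLeft_comp,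
        ← reassoc_of% 𝒞.whiskerLeft_comp, 𝒞.associator_naturality_left]
    have h : C.cut P.α G ≫ C.ε ▷ (G ⊚ F ⊚ C.X ⊚ G) =
        (𝒞.oplax i).l (C.X ⊚ G) ≫ (𝒞.oplax i).I ◁ 𝒞.unitAt P.α (C.X ⊚ G) := by
      rw [cut, Category.assoc, Category.assoc, 𝒞.whisker_exchange,
        reassoc_of% C.counit_left_at]
    rw [e, conjΔ, Category.assoc, Iso.inv_hom_id_assoc, ← reassoc_of% 𝒞.whiskerLeft_comp, h,
      𝒞.whiskerLeft_comp, Category.assoc, reassoc_of% P.retr_naturality, reassoc_of% P.l_retr,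
      reassoc_of% P.unitAt_counitAt]
  counit_right := by
    rw [conjΔ, Category.assoc, assoc₄_inv_naturality, ← Category.assoc, Iso.comp_inv_eq,
      ← 𝒞.whiskerLeft_comp]
    have e : (𝒞.oplax j).r (F ⊚ C.X ⊚ G) ≫ (assoc₄ F C.X G (𝒞.oplax j).I).hom =
        F ◁ C.X ◁ (𝒞.oplax j).r G := by
      rw [assoc₄, Iso.trans_hom, reassoc_of% (𝒞.oplax j).r_comp,
        TwoSemicategory.whiskerLeftIso_hom, ← 𝒞.whiskerLeft_comp, (𝒞.oplax j).r_comp]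
    rw [e, cut]
    congr 1
    have t : 𝒞.unitAt P.α G ≫ G ◁ P.β ≫ G ◁ (𝒞.oplax j).l (𝒞.lax j).I ≫
        G ◁ (𝒞.lax j).r (𝒞.oplax j).I = (𝒞.oplax j).r G := by
      have := P.right_triangle
      rw [← (𝒞.oplax j).l_r, Category.assoc, (𝒞.lax j).r_comp, (𝒞.lax j).r_naturality, unitAt]
      simp only [Category.assoc]
      rw [reassoc_of% this]
    simp only [Category.assoc, ← 𝒞.whiskerLeft_comp, conjε]
    rw [𝒞.whiskerLeft_comp G, ← reassoc_of% unitAt_naturality]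
    rw [𝒞.whiskerLeft_comp C.X, reassoc_of% C.counit_right_at, ← 𝒞.whiskerLeft_comp]
    congr 1
    rw [reassoc_of% unitAt_naturality]
    simp only [← 𝒞.whiskerLeft_comp]
    rw [reassoc_of% P.l_retr]
    simp only [𝒞.whiskerLeft_comp]
    exact t

end Coalgebra

end
end BilaxTwoCategory

/-- An object of the injective abelianization of `A`: a finite tuple of morphisms `X ⟶ Yᵢ`
(to be thought of as the intersection of their kernels).  The field `k` is recorded because the hom
spaces are quotients of `k`-modules. -/
structure Abel (k : Type*) (A : Type u) [Category.{v} A] where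
  obj : A
  maps : List (Σ Y : A, obj ⟶ Y)

namespace Abel

section
variable {k : Type*} [Field k] {A : Type u} [Category.{v} A] [Preadditive A] [Linear k A]

/-- The morphisms `g : X ⟶ Z` of the form `g = ∑ᵢ fᵢ ≫ qᵢ`. -/
def ideal (X : Abel k A) (Z : A) : Submodule k (X.obj ⟶ Z) :=
  Submodule.span k {g | ∃ p ∈ X.maps, ∃ q : p.1 ⟶ Z, g = p.2 ≫ q}

/-- The morphisms `g : X ⟶ X'` that can be completed by some `hᵢⱼ : Yᵢ ⟶ Y'ⱼ` to a tuple with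
`g ≫ f'ⱼ = ∑ᵢ fᵢ ≫ hᵢⱼ`. -/
def homSub (X X' : Abel k A) : Submodule k (X.obj ⟶ X'.obj) where
  carrier := {g | ∀ p ∈ X'.maps, g ≫ p.2 ∈ X.ideal p.1}
  add_mem' := fun hf hg p hp => by
    rw [Preadditive.add_comp]; exact Submodule.add_mem _ (hf p hp) (hg p hp)
  zero_mem' := fun p _ => by rw [zero_comp]; exact Submodule.zero_mem _
  smul_mem' := fun t g hg p hp => by
    rw [Linear.smul_comp]; exact Submodule.smul_mem _ _ (hg p hp)

/-- Homotopy classes of tuples `(g, hᵢⱼ)`.  As a tuple is null-homotopic if and only if `g` lies in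
the ideal generated by the `fᵢ`, with no condition on the `hᵢⱼ`, the class is recorded by `g`. -/
def homIdeal (X X' : Abel k A) : Submodule k (homSub X X') :=
  (X.ideal X'.obj).comap (homSub X X').subtype

theorem comp_mem_ideal {X : Abel k A} {Z W : A} {g : X.obj ⟶ Z} (hg : g ∈ X.ideal Z) (t : Z ⟶ W) :
    g ≫ t ∈ X.ideal W := by
  refine Submodule.span_induction (p := fun g _ => g ≫ t ∈ X.ideal W) ?_ ?_ ?_ ?_ hg
  · rintro _ ⟨p, hp, q, rfl⟩
    exact Submodule.subset_span ⟨p, hp, q ≫ t, by simp⟩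
  · simp
  · intro x y _ _ hx hy
    rw [Preadditive.add_comp]; exact Submodule.add_mem _ hx hy
  · intro a x _ hx
    rw [Linear.smul_comp]; exact Submodule.smul_mem _ _ hx

theorem mem_ideal {X : Abel k A} {Z : A} (p : Σ Y : A, X.obj ⟶ Y) (hp : p ∈ X.maps) (q : p.1 ⟶ Z) :
    p.2 ≫ q ∈ X.ideal Z :=
  Submodule.subset_span ⟨p, hp, q, rfl⟩

theorem mem_ideal_of_eq {X : Abel k A} {Z : A} {g g' : X.obj ⟶ Z} (h : g = g')
    (hg : g' ∈ X.ideal Z) : g ∈ X.ideal Z := h ▸ hg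

theorem proj_mem {X : Abel k A} (p : Σ Y : A, X.obj ⟶ Y) (hp : p ∈ X.maps) :
    p.2 ∈ X.ideal p.1 :=
  mem_ideal_of_eq (Category.comp_id p.2).symm (mem_ideal p hp (𝟙 _))

theorem mem_comp_ideal {X X' : Abel k A} {Z : A} {g : X.obj ⟶ X'.obj} (hg : g ∈ homSub X X')
    {t : X'.obj ⟶ Z} (ht : t ∈ X'.ideal Z) : g ≫ t ∈ X.ideal Z := by
  refine Submodule.span_induction (p := fun t _ => g ≫ t ∈ X.ideal Z) ?_ ?_ ?_ ?_ ht
  · rintro _ ⟨p, hp, q, rfl⟩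
    rw [← Category.assoc]
    exact comp_mem_ideal (hg p hp) q
  · simp
  · intro x y _ _ hx hy
    rw [Preadditive.comp_add]; exact Submodule.add_mem _ hx hy
  · intro a x _ hx
    rw [Linear.comp_smul]; exact Submodule.smul_mem _ _ hx

theorem id_mem (X : Abel k A) : 𝟙 X.obj ∈ homSub X X := fun p hp => by
  rw [Category.id_comp, ← Category.comp_id p.2]; exact mem_ideal p hp _

theorem comp_mem {X Y Z : Abel k A} {f : X.obj ⟶ Y.obj} {g : Y.obj ⟶ Z.obj}
    (hf : f ∈ homSub X Y) (hg : g ∈ homSub Y Z) : f ≫ g ∈ homSub X Z := fun p hp => by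
  rw [Category.assoc]; exact mem_comp_ideal hf (hg p hp)


instance : Category (Abel k A) where
  Hom X Y := homSub X Y ⧸ homIdeal X Y
  id X := Submodule.Quotient.mk ⟨𝟙 X.obj, id_mem X⟩
  comp {X Y Z} f g := Quotient.liftOn₂' f g
    (fun a b => Submodule.Quotient.mk ⟨a.1 ≫ b.1, comp_mem a.2 b.2⟩) (by
      intro a b a' b' ha hb
      rw [Submodule.quotientRel_def] at ha hb
      rw [Submodule.Quotient.eq]
      have h : a.1 ≫ b.1 - a'.1 ≫ b'.1 = (a.1 - a'.1) ≫ b.1 + a'.1 ≫ (b.1 - b'.1) := by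
        simp
      change a.1 ≫ b.1 - a'.1 ≫ b'.1 ∈ X.ideal Z.obj
      rw [h]
      exact Submodule.add_mem _ (comp_mem_ideal ha b.1) (mem_comp_ideal a'.2 hb))
  id_comp := by
    rintro X Y ⟨f⟩
    exact congrArg Submodule.Quotient.mk (Subtype.ext (Category.id_comp f.1))
  comp_id := by
    rintro X Y ⟨f⟩
    exact congrArg Submodule.Quotient.mk (Subtype.ext (Category.comp_id f.1))
  assoc := by
    rintro X Y Z W ⟨f⟩ ⟨g⟩ ⟨h⟩
    exact congrArg Submodule.Quotient.mk (Subtype.ext (Category.assoc f.1 g.1 h.1))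

/-- The class of a morphism `g`. -/
def homMk {X Y : Abel k A} (g : X.obj ⟶ Y.obj) (hg : g ∈ homSub X Y) : X ⟶ Y :=
  Submodule.Quotient.mk (p := homIdeal X Y) ⟨g, hg⟩

theorem homMk_surj {X Y : Abel k A} (f : X ⟶ Y) : ∃ g hg, homMk (X := X) (Y := Y) g hg = f := by
  obtain ⟨⟨g, hg⟩, rfl⟩ := Submodule.Quotient.mk_surjective _ f
  exact ⟨g, hg, rfl⟩

theorem homMk_congr {X Y : Abel k A} {g g' : X.obj ⟶ Y.obj} (h : g = g') (hg : g ∈ homSub X Y)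
    (hg' : g' ∈ homSub X Y) : homMk g hg = homMk g' hg' := by
  subst h; rfl

theorem homMk_comp {X Y Z : Abel k A} (f : X.obj ⟶ Y.obj) (hf : f ∈ homSub X Y)
    (g : Y.obj ⟶ Z.obj) (hg : g ∈ homSub Y Z) :
    homMk f hf ≫ homMk g hg = homMk (f ≫ g) (comp_mem hf hg) := rfl

theorem homMk_id (X : Abel k A) : homMk (𝟙 X.obj) (id_mem X) = 𝟙 X := rfl

instance : Preadditive (Abel k A) where
  homGroup X Y := inferInstanceAs (AddCommGroup (homSub X Y ⧸ homIdeal X Y))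
  add_comp := by
    rintro X Y Z ⟨f⟩ ⟨f'⟩ ⟨g⟩
    exact congrArg Submodule.Quotient.mk (Subtype.ext (Preadditive.add_comp _ _ _ f.1 f'.1 g.1))
  comp_add := by
    rintro X Y Z ⟨f⟩ ⟨g⟩ ⟨g'⟩
    exact congrArg Submodule.Quotient.mk (Subtype.ext (Preadditive.comp_add _ _ _ f.1 g.1 g'.1))

instance : Linear k (Abel k A) where
  homModule X Y := inferInstanceAs (Module k (homSub X Y ⧸ homIdeal X Y))
  smul_comp := by
    rintro X Y Z t ⟨f⟩ ⟨g⟩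
    exact congrArg Submodule.Quotient.mk (Subtype.ext (Linear.smul_comp _ _ _ t f.1 g.1))
  comp_smul := by
    rintro X Y Z ⟨f⟩ t ⟨g⟩
    exact congrArg Submodule.Quotient.mk (Subtype.ext (Linear.comp_smul _ _ _ f.1 t g.1))

/-- An isomorphism of `A` compatible with the defining tuples. -/
@[simps]
def isoMk {X Y : Abel k A} (e : X.obj ≅ Y.obj) (h : e.hom ∈ homSub X Y) (h' : e.inv ∈ homSub Y X) :
    X ≅ Y where
  hom := homMk e.hom h
  inv := homMk e.inv h'
  hom_inv_id := by rw [homMk_comp, ← homMk_id]; exact homMk_congr e.hom_inv_id _ _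
  inv_hom_id := by rw [homMk_comp, ← homMk_id]; exact homMk_congr e.inv_hom_id _ _

/-- The map on hom spaces of the abelianizations induced by a linear map on hom spaces. -/
def mapHom {A' : Type*} [Category A'] [Preadditive A'] [Linear k A'] {X X' : Abel k A}
    {Y Y' : Abel k A'} (φ : (X.obj ⟶ X'.obj) →ₗ[k] (Y.obj ⟶ Y'.obj))
    (h : ∀ g ∈ homSub X X', φ g ∈ homSub Y Y')
    (h' : ∀ g ∈ X.ideal X'.obj, φ g ∈ Y.ideal Y'.obj) : (X ⟶ X') →ₗ[k] (Y ⟶ Y') :=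
  Submodule.mapQ (homIdeal X X') (homIdeal Y Y') (φ.restrict h) (fun g hg => h' g.1 hg)

theorem mapHom_homMk {A' : Type*} [Category A'] [Preadditive A'] [Linear k A'] {X X' : Abel k A}
    {Y Y' : Abel k A'} (φ : (X.obj ⟶ X'.obj) →ₗ[k] (Y.obj ⟶ Y'.obj))
    (h : ∀ g ∈ homSub X X', φ g ∈ homSub Y Y')
    (h' : ∀ g ∈ X.ideal X'.obj, φ g ∈ Y.ideal Y'.obj) (g : X.obj ⟶ X'.obj) (hg : g ∈ homSub X X') :
    mapHom φ h h' (homMk g hg) = homMk (φ g) (h g hg) := rfl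

variable (k) in
/-- The embedding of `A` into its injective abelianization. -/
def emb (X : A) : Abel k A := ⟨X, []⟩

theorem mem_emb {X : Abel k A} {Y : A} (g : X.obj ⟶ (emb k Y).obj) : g ∈ homSub X (emb k Y) :=
  fun _ hp => absurd hp (List.not_mem_nil)

variable (k) in
/-- The embedding of `A` into its injective abelianization, on morphisms. -/
def embMap {X Y : A} (f : X ⟶ Y) : emb k X ⟶ emb k Y := homMk (X := emb k X) (Y := emb k Y) f (mem_emb (X := emb k X) f)

variable (k) in
theorem embMap_id (X : A) : embMap k (𝟙 X) = 𝟙 (emb k X) := rfl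

variable (k) in
theorem embMap_comp {X Y Z : A} (f : X ⟶ Y) (g : Y ⟶ Z) :
    embMap k (f ≫ g) = embMap k f ≫ embMap k g := rfl

variable (k) in
theorem embMap_add {X Y : A} (f g : X ⟶ Y) : embMap k (f + g) = embMap k f + embMap k g := rfl

theorem embMap_smul {X Y : A} (t : k) (f : X ⟶ Y) : embMap k (t • f) = t • embMap k f := rfl

end

end Abel

/-! Horizontal composition on the injective abelianization. -/

namespace TwoSemicategory

section
variable {k : Type*} [Field k] {B : Type w} (S : TwoSemicategory.{w, v, u} k B)

/-- `(X; fᵢ) ⊚ (X'; f'ⱼ) = (X ⊚ X'; X ◁ f'ⱼ, fᵢ ▷ X')`. -/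
def abelComp {a b c : B} (G : Abel k (S.Hom b c)) (F : Abel k (S.Hom a b)) :
    Abel k (S.Hom a c) where
  obj := G.obj ⊚ F.obj
  maps := F.maps.map (fun p => ⟨G.obj ⊚ p.1, G.obj ◁ p.2⟩) ++
    G.maps.map (fun p => ⟨p.1 ⊚ F.obj, p.2 ▷ F.obj⟩)

variable {S} {a b c d : B}

theorem mem_abelComp_iff {G : Abel k (S.Hom b c)} {F : Abel k (S.Hom a b)}
    {X : Abel k (S.Hom a c)} {g : X.obj ⟶ G.obj ⊚ F.obj} :
    g ∈ Abel.homSub X (S.abelComp G F) ↔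
      (∀ p ∈ F.maps, g ≫ G.obj ◁ p.2 ∈ X.ideal (G.obj ⊚ p.1)) ∧
      (∀ p ∈ G.maps, g ≫ p.2 ▷ F.obj ∈ X.ideal (p.1 ⊚ F.obj)) := by
  constructor
  · intro h
    exact ⟨fun p hp => h ⟨G.obj ⊚ p.1, G.obj ◁ p.2⟩
        (List.mem_append_left _ (List.mem_map.2 ⟨p, hp, rfl⟩)),
      fun p hp => h ⟨p.1 ⊚ F.obj, p.2 ▷ F.obj⟩
        (List.mem_append_right _ (List.mem_map.2 ⟨p, hp, rfl⟩))⟩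
  · rintro ⟨h₁, h₂⟩ q hq
    rcases List.mem_append.1 hq with hq | hq
    · obtain ⟨p, hp, rfl⟩ := List.mem_map.1 hq
      exact h₁ p hp
    · obtain ⟨p, hp, rfl⟩ := List.mem_map.1 hq
      exact h₂ p hp

theorem whiskerLeft_mem_ideal (G : Abel k (S.Hom b c)) {F : Abel k (S.Hom a b)} {Z : S.Hom a b}
    {f : F.obj ⟶ Z} (hf : f ∈ F.ideal Z) : G.obj ◁ f ∈ (S.abelComp G F).ideal (G.obj ⊚ Z) := by
  refine Submodule.span_induction
    (p := fun f _ => G.obj ◁ f ∈ (S.abelComp G F).ideal (G.obj ⊚ Z)) ?_ ?_ ?_ ?_ hf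
  · rintro _ ⟨p, hp, q, rfl⟩
    rw [whiskerLeft_comp]
    exact Abel.mem_ideal (X := S.abelComp G F) ⟨G.obj ⊚ p.1, G.obj ◁ p.2⟩
      (List.mem_append_left _ (List.mem_map.2 ⟨p, hp, rfl⟩)) _
  · rw [whiskerLeft_zero]; exact Submodule.zero_mem _
  · intro x y _ _ hx hy
    rw [whiskerLeft_add]; exact Submodule.add_mem _ hx hy
  · intro t x _ hx
    rw [whiskerLeft_smul]; exact Submodule.smul_mem _ _ hx

theorem whiskerRight_mem_ideal {G : Abel k (S.Hom b c)} (F : Abel k (S.Hom a b)) {Z : S.Hom b c}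
    {g : G.obj ⟶ Z} (hg : g ∈ G.ideal Z) : g ▷ F.obj ∈ (S.abelComp G F).ideal (Z ⊚ F.obj) := by
  refine Submodule.span_induction
    (p := fun g _ => g ▷ F.obj ∈ (S.abelComp G F).ideal (Z ⊚ F.obj)) ?_ ?_ ?_ ?_ hg
  · rintro _ ⟨p, hp, q, rfl⟩
    rw [comp_whiskerRight]
    exact Abel.mem_ideal (X := S.abelComp G F) ⟨p.1 ⊚ F.obj, p.2 ▷ F.obj⟩
      (List.mem_append_right _ (List.mem_map.2 ⟨p, hp, rfl⟩)) _
  · rw [zero_whiskerRight]; exact Submodule.zero_mem _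
  · intro x y _ _ hx hy
    rw [add_whiskerRight]; exact Submodule.add_mem _ hx hy
  · intro t x _ hx
    rw [smul_whiskerRight]; exact Submodule.smul_mem _ _ hx

theorem whiskerLeft_mem (G : Abel k (S.Hom b c)) {F F' : Abel k (S.Hom a b)}
    {f : F.obj ⟶ F'.obj} (hf : f ∈ Abel.homSub F F') :
    G.obj ◁ f ∈ Abel.homSub (S.abelComp G F) (S.abelComp G F') :=
  mem_abelComp_iff.2 ⟨
    fun p hp => Abel.mem_ideal_of_eq (S.whiskerLeft_comp G.obj f p.2).symm
      (whiskerLeft_mem_ideal G (hf p hp)),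
    fun p hp => Abel.mem_ideal_of_eq (S.whisker_exchange p.2 f)
      (Abel.comp_mem_ideal (whiskerRight_mem_ideal F (Abel.proj_mem p hp)) _)⟩

theorem whiskerRight_mem {G G' : Abel k (S.Hom b c)} {g : G.obj ⟶ G'.obj}
    (hg : g ∈ Abel.homSub G G') (F : Abel k (S.Hom a b)) :
    g ▷ F.obj ∈ Abel.homSub (S.abelComp G F) (S.abelComp G' F) :=
  mem_abelComp_iff.2 ⟨
    fun p hp => Abel.mem_ideal_of_eq (S.whisker_exchange g p.2).symm
      (Abel.comp_mem_ideal (whiskerLeft_mem_ideal G (Abel.proj_mem p hp)) _),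
    fun p hp => Abel.mem_ideal_of_eq (S.comp_whiskerRight g p.2 F.obj).symm
      (whiskerRight_mem_ideal F (hg p hp))⟩

theorem associator_mem (K : Abel k (S.Hom c d)) (G : Abel k (S.Hom b c))
    (F : Abel k (S.Hom a b)) : (S.associator K.obj G.obj F.obj).hom ∈
      Abel.homSub (S.abelComp (S.abelComp K G) F) (S.abelComp K (S.abelComp G F)) := by
  refine mem_abelComp_iff.2 ⟨fun p hp => ?_, fun p hp => ?_⟩
  · rcases List.mem_append.1 hp with hp | hp
    · obtain ⟨q, hq, rfl⟩ := List.mem_map.1 hp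
      exact Abel.mem_ideal_of_eq (S.associator_naturality_right K.obj G.obj q.2).symm
        (Abel.comp_mem_ideal (whiskerLeft_mem_ideal (S.abelComp K G) (Abel.proj_mem q hq)) _)
    · obtain ⟨q, hq, rfl⟩ := List.mem_map.1 hp
      exact Abel.mem_ideal_of_eq (S.associator_naturality_middle K.obj q.2 F.obj).symm
        (Abel.comp_mem_ideal (whiskerRight_mem_ideal (G := S.abelComp K G) F
          (whiskerLeft_mem_ideal K (Abel.proj_mem q hq))) _)
  · exact Abel.mem_ideal_of_eq (S.associator_naturality_left p.2 G.obj F.obj).symm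
      (Abel.comp_mem_ideal (whiskerRight_mem_ideal (G := S.abelComp K G) F
        (whiskerRight_mem_ideal G (Abel.proj_mem p hp))) _)

theorem associator_inv_mem (K : Abel k (S.Hom c d)) (G : Abel k (S.Hom b c))
    (F : Abel k (S.Hom a b)) : (S.associator K.obj G.obj F.obj).inv ∈
      Abel.homSub (S.abelComp K (S.abelComp G F)) (S.abelComp (S.abelComp K G) F) := by
  refine mem_abelComp_iff.2 ⟨fun p hp => ?_, fun p hp => ?_⟩
  · have h : (S.associator K.obj G.obj F.obj).inv ≫ (K.obj ⊚ G.obj) ◁ p.2 =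
        K.obj ◁ G.obj ◁ p.2 ≫ (S.associator K.obj G.obj p.1).inv := by
      rw [comp_whiskerLeft]; simp
    exact Abel.mem_ideal_of_eq h (Abel.comp_mem_ideal
      (whiskerLeft_mem_ideal (F := S.abelComp G F) K
        (whiskerLeft_mem_ideal G (Abel.proj_mem p hp))) _)
  · rcases List.mem_append.1 hp with hp | hp
    · obtain ⟨q, hq, rfl⟩ := List.mem_map.1 hp
      have h : (S.associator K.obj G.obj F.obj).inv ≫ (K.obj ◁ q.2) ▷ F.obj =
          K.obj ◁ q.2 ▷ F.obj ≫ (S.associator K.obj q.1 F.obj).inv := by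
        rw [whisker_assoc]; simp
      exact Abel.mem_ideal_of_eq h (Abel.comp_mem_ideal
        (whiskerLeft_mem_ideal (F := S.abelComp G F) K
          (whiskerRight_mem_ideal F (Abel.proj_mem q hq))) _)
    · obtain ⟨q, hq, rfl⟩ := List.mem_map.1 hp
      have h : (S.associator K.obj G.obj F.obj).inv ≫ q.2 ▷ G.obj ▷ F.obj =
          q.2 ▷ (G.obj ⊚ F.obj) ≫ (S.associator q.1 G.obj F.obj).inv := by
        rw [whiskerRight_comp]; simp
      exact Abel.mem_ideal_of_eq h (Abel.comp_mem_ideal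
        (whiskerRight_mem_ideal (S.abelComp G F) (Abel.proj_mem q hq)) _)

variable (S)

/-- `F ↦ G ⊚ F` on morphisms, as a linear map. -/
def whiskerLeftₗ (G : S.Hom b c) (F F' : S.Hom a b) : (F ⟶ F') →ₗ[k] (G ⊚ F ⟶ G ⊚ F') where
  toFun f := G ◁ f
  map_add' := S.whiskerLeft_add G
  map_smul' := S.whiskerLeft_smul G

/-- `G ↦ G ⊚ F` on morphisms, as a linear map. -/
def whiskerRightₗ (G G' : S.Hom b c) (F : S.Hom a b) : (G ⟶ G') →ₗ[k] (G ⊚ F ⟶ G' ⊚ F) where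
  toFun g := g ▷ F
  map_add' g g' := S.add_whiskerRight g g' F
  map_smul' t g := S.smul_whiskerRight t g F

/-- The injective abelianization of a 2-semicategory. -/
def abel : TwoSemicategory.{w, v, max u v} k B where
  Hom a b := Abel k (S.Hom a b)
  homCategory _ _ := inferInstance
  homPreadditive _ _ := inferInstance
  homLinear _ _ := inferInstance
  hcomp G F := S.abelComp G F
  whiskerLeft {a b c} G F F' := Abel.mapHom (S.whiskerLeftₗ G.obj F.obj F'.obj)
    (Y := S.abelComp G F) (Y' := S.abelComp G F') (fun _ h => whiskerLeft_mem G h)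
    (fun _ h => whiskerLeft_mem_ideal G h)
  whiskerRight {a b c} G G' g F := Abel.mapHom (S.whiskerRightₗ G.obj G'.obj F.obj)
    (Y := S.abelComp G F) (Y' := S.abelComp G' F) (fun _ h => whiskerRight_mem h F)
    (fun _ h => whiskerRight_mem_ideal F h) g
  associator K G F := Abel.isoMk (X := S.abelComp (S.abelComp K G) F)
    (Y := S.abelComp K (S.abelComp G F)) (S.associator K.obj G.obj F.obj)
    (associator_mem K G F) (associator_inv_mem K G F)
  whiskerLeft_id G F := Abel.homMk_congr (S.whiskerLeft_id G.obj F.obj) _ _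
  whiskerLeft_comp {a b c} G F F' F'' f g := by
    obtain ⟨f, hf, rfl⟩ := Abel.homMk_surj f
    obtain ⟨g, hg, rfl⟩ := Abel.homMk_surj g
    exact Abel.homMk_congr (S.whiskerLeft_comp G.obj f g) _ _
  id_whiskerRight G F := Abel.homMk_congr (S.id_whiskerRight G.obj F.obj) _ _
  comp_whiskerRight {a b c} G G' G'' f g F := by
    obtain ⟨f, hf, rfl⟩ := Abel.homMk_surj f
    obtain ⟨g, hg, rfl⟩ := Abel.homMk_surj g
    exact Abel.homMk_congr (S.comp_whiskerRight f g F.obj) _ _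
  whisker_exchange {a b c} G G' F F' g f := by
    obtain ⟨f, hf, rfl⟩ := Abel.homMk_surj f
    obtain ⟨g, hg, rfl⟩ := Abel.homMk_surj g
    exact Abel.homMk_congr (S.whisker_exchange g f) _ _
  whiskerLeft_add {a b c} G F F' f f' := map_add _ _ _
  whiskerLeft_smul {a b c} G F F' t f := map_smul _ _ _
  add_whiskerRight {a b c} G G' g g' F := map_add _ _ _
  smul_whiskerRight {a b c} G G' t g F := map_smul _ _ _
  associator_naturality_left {a b c d} K K' f G F := by
    obtain ⟨f, hf, rfl⟩ := Abel.homMk_surj f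
    exact Abel.homMk_congr (S.associator_naturality_left f G.obj F.obj) _ _
  associator_naturality_middle {a b c d} K G G' f F := by
    obtain ⟨f, hf, rfl⟩ := Abel.homMk_surj f
    exact Abel.homMk_congr (S.associator_naturality_middle K.obj f F.obj) _ _
  associator_naturality_right {a b c d} K G F F' f := by
    obtain ⟨f, hf, rfl⟩ := Abel.homMk_surj f
    exact Abel.homMk_congr (S.associator_naturality_right K.obj G.obj f) _ _
  pentagon L K G F := Abel.homMk_congr (S.pentagon L.obj K.obj G.obj F.obj) _ _

end

end TwoSemicategory

namespace BilaxTwoCategory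

section
variable {k : Type*} [Field k] {B : Type w} (𝒞 : BilaxTwoCategory.{w, v, u} k B)

variable {𝒞} {i j : B}

theorem lax_l_mem (F : Abel k (𝒞.Hom j i)) : (𝒞.lax i).l F.obj ∈
    Abel.homSub (𝒞.abelComp (Abel.emb k (𝒞.lax i).I) F) F := fun p hp => by
  change (𝒞.lax i).l F.obj ≫ p.2 ∈ _
  rw [← (𝒞.lax i).l_naturality]
  exact Abel.comp_mem_ideal (TwoSemicategory.whiskerLeft_mem_ideal
    (Abel.emb k (𝒞.lax i).I) (Abel.proj_mem p hp)) _

theorem lax_r_mem (G : Abel k (𝒞.Hom i j)) : (𝒞.lax i).r G.obj ∈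
    Abel.homSub (𝒞.abelComp G (Abel.emb k (𝒞.lax i).I)) G := fun p hp => by
  change (𝒞.lax i).r G.obj ≫ p.2 ∈ _
  rw [← (𝒞.lax i).r_naturality]
  exact Abel.comp_mem_ideal (TwoSemicategory.whiskerRight_mem_ideal
    (Abel.emb k (𝒞.lax i).I) (Abel.proj_mem p hp)) _

theorem oplax_l_mem (F : Abel k (𝒞.Hom j i)) : (𝒞.oplax i).l F.obj ∈
    Abel.homSub F (𝒞.abelComp (Abel.emb k (𝒞.oplax i).I) F) := by
  refine TwoSemicategory.mem_abelComp_iff.2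
    ⟨fun p hp => ?_, fun p hp => absurd hp List.not_mem_nil⟩
  change (𝒞.oplax i).l F.obj ≫ (𝒞.oplax i).I ◁ p.2 ∈ _
  rw [← (𝒞.oplax i).l_naturality]
  exact Abel.comp_mem_ideal (Abel.proj_mem p hp) _

theorem oplax_r_mem (G : Abel k (𝒞.Hom i j)) : (𝒞.oplax i).r G.obj ∈
    Abel.homSub G (𝒞.abelComp G (Abel.emb k (𝒞.oplax i).I)) := by
  refine TwoSemicategory.mem_abelComp_iff.2
    ⟨fun p hp => absurd hp List.not_mem_nil, fun p hp => ?_⟩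
  change (𝒞.oplax i).r G.obj ≫ p.2 ▷ (𝒞.oplax i).I ∈ _
  rw [← (𝒞.oplax i).r_naturality]
  exact Abel.comp_mem_ideal (Abel.proj_mem p hp) _

variable (𝒞)

/-- The injective abelianization of a bilax-unital 2-category, with the images of the (op)lax units
of the given one as (op)lax units. -/
def abel : BilaxTwoCategory.{w, v, max u v} k B where
  toTwoSemicategory := 𝒞.toTwoSemicategory.abel
  lax i :=
    { I := Abel.emb k (𝒞.lax i).I
      l := fun F => Abel.homMk ((𝒞.lax i).l (Abel.obj F)) (lax_l_mem F)
      r := fun G => Abel.homMk ((𝒞.lax i).r (Abel.obj G)) (lax_r_mem G)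
      l_naturality := fun f => by
        obtain ⟨f, hf, rfl⟩ := Abel.homMk_surj f
        exact Abel.homMk_congr ((𝒞.lax i).l_naturality f) _ _
      r_naturality := fun f => by
        obtain ⟨f, hf, rfl⟩ := Abel.homMk_surj f
        exact Abel.homMk_congr ((𝒞.lax i).r_naturality f) _ _
      l_r := fun G F => Abel.homMk_congr ((𝒞.lax i).l_r G.obj F.obj) _ _
      l_comp := fun F H => Abel.homMk_congr ((𝒞.lax i).l_comp F.obj H.obj) _ _
      r_comp := fun K G => Abel.homMk_congr ((𝒞.lax i).r_comp K.obj G.obj) _ _ }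
  oplax i :=
    { I := Abel.emb k (𝒞.oplax i).I
      l := fun F => Abel.homMk ((𝒞.oplax i).l (Abel.obj F)) (oplax_l_mem F)
      r := fun G => Abel.homMk ((𝒞.oplax i).r (Abel.obj G)) (oplax_r_mem G)
      l_naturality := fun f => by
        obtain ⟨f, hf, rfl⟩ := Abel.homMk_surj f
        exact Abel.homMk_congr ((𝒞.oplax i).l_naturality f) _ _
      r_naturality := fun f => by
        obtain ⟨f, hf, rfl⟩ := Abel.homMk_surj f
        exact Abel.homMk_congr ((𝒞.oplax i).r_naturality f) _ _
      l_r := fun G F => Abel.homMk_congr ((𝒞.oplax i).l_r G.obj F.obj) _ _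
      l_comp := fun F H => Abel.homMk_congr ((𝒞.oplax i).l_comp F.obj H.obj) _ _
      r_comp := fun K G => Abel.homMk_congr ((𝒞.oplax i).r_comp K.obj G.obj) _ _ }

variable {𝒞}

/-- The image in the injective abelianization of a 1-morphism. -/
def ι {i j : B} (F : 𝒞.Hom i j) : 𝒞.abel.Hom i j := Abel.emb k F

/-- The image in the injective abelianization of a 2-morphism. -/
def ι₂ {i j : B} {F F' : 𝒞.Hom i j} (f : F ⟶ F') : ι F ⟶ ι F' := Abel.embMap k f

/-- The image of an adjoint pair is an adjoint pair. -/
def AdjointPair.ι {i j : B} {F : 𝒞.Hom i j} {G : 𝒞.Hom j i} (P : 𝒞.AdjointPair F G) :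
    𝒞.abel.AdjointPair (ι F) (ι G) where
  α := ι₂ P.α
  β := ι₂ P.β
  left_triangle := congrArg ι₂ P.left_triangle
  right_triangle := congrArg ι₂ P.right_triangle

end

end BilaxTwoCategory

/-! Bilax 2-representations. -/

universe v₁ u₁ v₂ u₂ v₃ u₃

/-- A bilax 2-representation of a bilax-unital 2-category `𝒞`: `k`-linear categories `M i`, an
action of the 1- and 2-morphisms of `𝒞` by additive `k`-linear functors and natural
transformations that is compatible with horizontal composition (up to the coherent natural
isomorphisms `μ`), and natural transformations `u : M I ⟶ id` and `u' : id ⟶ M I'` that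
induce the images of the lax and oplax unitors. -/
structure BilaxRep {k : Type*} [Field k] {B : Type w} (𝒞 : BilaxTwoCategory.{w, v, u} k B) where
  Obj : B → Type u₁
  category : ∀ i, Category.{v₁} (Obj i)
  preadditive : ∀ i, Preadditive (Obj i)
  linear : ∀ i, Linear k (Obj i)
  act : ∀ {i j : B}, 𝒞.Hom i j → (Obj i ⥤ Obj j)
  act₂ : ∀ {i j : B} {F F' : 𝒞.Hom i j}, (F ⟶ F') → (act F ⟶ act F')
  act_additive : ∀ {i j : B} (F : 𝒞.Hom i j), (act F).Additive
  act_linear : ∀ {i j : B} (F : 𝒞.Hom i j), (act F).Linear k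
  act₂_id : ∀ {i j : B} (F : 𝒞.Hom i j), act₂ (𝟙 F) = 𝟙 (act F)
  act₂_comp : ∀ {i j : B} {F F' F'' : 𝒞.Hom i j} (f : F ⟶ F') (g : F' ⟶ F''),
    act₂ (f ≫ g) = act₂ f ≫ act₂ g
  act₂_add : ∀ {i j : B} {F F' : 𝒞.Hom i j} (f g : F ⟶ F') (X : Obj i),
    (act₂ (f + g)).app X = (act₂ f).app X + (act₂ g).app X
  act₂_smul : ∀ {i j : B} {F F' : 𝒞.Hom i j} (t : k) (f : F ⟶ F') (X : Obj i),
    (act₂ (t • f)).app X = t • (act₂ f).app X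
  μ : ∀ {i j m : B} (G : 𝒞.Hom j m) (F : 𝒞.Hom i j), act (G ⊚ F) ≅ act F ⋙ act G
  μ_naturality_left : ∀ {i j m : B} {G G' : 𝒞.Hom j m} (g : G ⟶ G') (F : 𝒞.Hom i j) (X : Obj i),
    (act₂ (g ▷ F)).app X ≫ (μ G' F).hom.app X =
      (μ G F).hom.app X ≫ (act₂ g).app ((act F).obj X)
  μ_naturality_right : ∀ {i j m : B} (G : 𝒞.Hom j m) {F F' : 𝒞.Hom i j} (f : F ⟶ F') (X : Obj i),
    (act₂ (G ◁ f)).app X ≫ (μ G F').hom.app X =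
      (μ G F).hom.app X ≫ (act G).map ((act₂ f).app X)
  μ_assoc : ∀ {i j m n : B} (K : 𝒞.Hom m n) (G : 𝒞.Hom j m) (F : 𝒞.Hom i j) (X : Obj i),
    (act₂ (𝒞.associator K G F).hom).app X ≫ (μ K (G ⊚ F)).hom.app X ≫
        (act K).map ((μ G F).hom.app X) =
      (μ (K ⊚ G) F).hom.app X ≫ (μ K G).hom.app ((act F).obj X)
  u : ∀ i : B, act (𝒞.lax i).I ⟶ 𝟭 (Obj i)
  u' : ∀ i : B, 𝟭 (Obj i) ⟶ act (𝒞.oplax i).I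
  u_left : ∀ {i j : B} (F : 𝒞.Hom i j) (X : Obj i),
    (μ (𝒞.lax j).I F).hom.app X ≫ (u j).app ((act F).obj X) = (act₂ ((𝒞.lax j).l F)).app X
  u_right : ∀ {i j : B} (G : 𝒞.Hom i j) (X : Obj i),
    (μ G (𝒞.lax i).I).hom.app X ≫ (act G).map ((u i).app X) = (act₂ ((𝒞.lax i).r G)).app X
  u'_left : ∀ {i j : B} (F : 𝒞.Hom i j) (X : Obj i),
    (act₂ ((𝒞.oplax j).l F)).app X ≫ (μ (𝒞.oplax j).I F).hom.app X = (u' j).app ((act F).obj X)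
  u'_right : ∀ {i j : B} (G : 𝒞.Hom i j) (X : Obj i),
    (act₂ ((𝒞.oplax i).r G)).app X ≫ (μ G (𝒞.oplax i).I).hom.app X = (act G).map ((u' i).app X)

attribute [instance] BilaxRep.category BilaxRep.preadditive BilaxRep.linear
  BilaxRep.act_additive BilaxRep.act_linear

namespace BilaxRep

section
variable {k : Type*} [Field k] {B : Type w} {𝒞 : BilaxTwoCategory.{w, v, u} k B}

/-- A bilax 2-natural transformation: additive `k`-linear functors `Φ i : M i ⥤ N i` commuting with
the action up to natural isomorphisms that are compatible with horizontal composition and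
with `u` and `u'`. -/
structure BilaxTrans (M : BilaxRep.{w, v, u, v₁, u₁} 𝒞) (N : BilaxRep.{w, v, u, v₂, u₂} 𝒞) where
  Φ : ∀ i : B, M.Obj i ⥤ N.Obj i
  additive : ∀ i, (Φ i).Additive
  linear : ∀ i, (Φ i).Linear k
  φ : ∀ {i j : B} (F : 𝒞.Hom i j), Φ i ⋙ N.act F ≅ M.act F ⋙ Φ j
  φ_naturality : ∀ {i j : B} {F F' : 𝒞.Hom i j} (f : F ⟶ F') (X : M.Obj i),
    (N.act₂ f).app ((Φ i).obj X) ≫ (φ F').hom.app X =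
      (φ F).hom.app X ≫ (Φ j).map ((M.act₂ f).app X)
  φ_comp : ∀ {i j m : B} (G : 𝒞.Hom j m) (F : 𝒞.Hom i j) (X : M.Obj i),
    (φ (G ⊚ F)).hom.app X ≫ (Φ m).map ((M.μ G F).hom.app X) =
      (N.μ G F).hom.app ((Φ i).obj X) ≫ (N.act G).map ((φ F).hom.app X) ≫
        (φ G).hom.app ((M.act F).obj X)
  φ_u : ∀ (i : B) (X : M.Obj i), (φ (𝒞.lax i).I).hom.app X ≫ (Φ i).map ((M.u i).app X) =
    (N.u i).app ((Φ i).obj X)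
  φ_u' : ∀ (i : B) (X : M.Obj i), (N.u' i).app ((Φ i).obj X) ≫ (φ (𝒞.oplax i).I).hom.app X =
    (Φ i).map ((M.u' i).app X)

/-- Equivalence of bilax 2-representations. -/
def Equivalent (M : BilaxRep.{w, v, u, v₁, u₁} 𝒞) (N : BilaxRep.{w, v, u, v₂, u₂} 𝒞) : Prop :=
  ∃ T : BilaxTrans M N, ∀ i, (T.Φ i).IsEquivalence

/-- The full subrepresentation on objects satisfying a property stable under the action. -/
def sub (M : BilaxRep.{w, v, u, v₁, u₁} 𝒞) (P : ∀ i, ObjectProperty (M.Obj i))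
    (hP : ∀ {i j : B} (F : 𝒞.Hom i j) (X : M.Obj i), P i X → P j ((M.act F).obj X)) :
    BilaxRep.{w, v, u, v₁, u₁} 𝒞 where
  Obj i := (P i).FullSubcategory
  category _ := inferInstance
  preadditive _ := inferInstance
  linear _ := inferInstance
  act F := (P _).lift ((P _).ι ⋙ M.act F) (fun X => hP F X.obj X.property)
  act₂ f := { app := fun X => ObjectProperty.homMk ((M.act₂ f).app X.obj)
              naturality := fun X Y g => by
                ext; exact (M.act₂ f).naturality g.hom }
  act_additive F := { map_add := by intros; ext; exact (M.act F).map_add }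
  act_linear F := { map_smul := by intros; ext; exact (M.act F).map_smul _ _ }
  act₂_id F := by ext X; exact congrArg (fun t => t.app X.obj) (M.act₂_id F)
  act₂_comp f g := by ext X; exact congrArg (fun t => t.app X.obj) (M.act₂_comp f g)
  act₂_add f g X := by ext; exact M.act₂_add f g X.obj
  act₂_smul t f X := by ext; exact M.act₂_smul t f X.obj
  μ G F := NatIso.ofComponents (fun X => (P _).isoMk ((M.μ G F).app X.obj))
    (fun g => by ext; exact (M.μ G F).hom.naturality g.hom)
  μ_naturality_left g F X := by ext; exact M.μ_naturality_left g F X.obj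
  μ_naturality_right G _ _ f X := by ext; exact M.μ_naturality_right G f X.obj
  μ_assoc K G F X := by ext; exact M.μ_assoc K G F X.obj
  u i := { app := fun X => ObjectProperty.homMk ((M.u i).app X.obj)
           naturality := fun X Y g => by ext; exact (M.u i).naturality g.hom }
  u' i := { app := fun X => ObjectProperty.homMk ((M.u' i).app X.obj)
            naturality := fun X Y g => by ext; exact (M.u' i).naturality g.hom }
  u_left F X := by ext; exact M.u_left F X.obj
  u_right G X := by ext; exact M.u_right G X.obj
  u'_left F X := by ext; exact M.u'_left F X.obj
  u'_right G X := by ext; exact M.u'_right G X.obj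

/-- The restriction of a bilax 2-representation of the injective abelianization of `𝒞` to `𝒞`. -/
def restrict (M : BilaxRep.{w, v, max u v, v₁, u₁} 𝒞.abel) : BilaxRep.{w, v, u, v₁, u₁} 𝒞 where
  Obj := M.Obj
  category := M.category
  preadditive := M.preadditive
  linear := M.linear
  act F := M.act (BilaxTwoCategory.ι F)
  act₂ f := M.act₂ (BilaxTwoCategory.ι₂ f)
  act_additive _ := inferInstance
  act_linear _ := inferInstance
  act₂_id F := M.act₂_id (BilaxTwoCategory.ι F)
  act₂_comp f g := M.act₂_comp (BilaxTwoCategory.ι₂ f) (BilaxTwoCategory.ι₂ g)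
  act₂_add f g X := M.act₂_add (BilaxTwoCategory.ι₂ f) (BilaxTwoCategory.ι₂ g) X
  act₂_smul t f X := M.act₂_smul t (BilaxTwoCategory.ι₂ f) X
  μ G F := M.μ (BilaxTwoCategory.ι G) (BilaxTwoCategory.ι F)
  μ_naturality_left g F X := M.μ_naturality_left (BilaxTwoCategory.ι₂ g) (BilaxTwoCategory.ι F) X
  μ_naturality_right G _ _ f X :=
    M.μ_naturality_right (BilaxTwoCategory.ι G) (BilaxTwoCategory.ι₂ f) X
  μ_assoc K G F X :=
    M.μ_assoc (BilaxTwoCategory.ι K) (BilaxTwoCategory.ι G) (BilaxTwoCategory.ι F) X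
  u := M.u
  u' := M.u'
  u_left F X := M.u_left (BilaxTwoCategory.ι F) X
  u_right G X := M.u_right (BilaxTwoCategory.ι G) X
  u'_left F X := M.u'_left (BilaxTwoCategory.ι F) X
  u'_right G X := M.u'_right (BilaxTwoCategory.ι G) X

theorem act₂_comp_app (M : BilaxRep.{w, v, u, v₁, u₁} 𝒞) {i j : B} {F F' F'' : 𝒞.Hom i j}
    (f : F ⟶ F') (g : F' ⟶ F'') (X : M.Obj i) :
    (M.act₂ (f ≫ g)).app X = (M.act₂ f).app X ≫ (M.act₂ g).app X := by
  rw [M.act₂_comp, NatTrans.comp_app]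

theorem act₂_id_app (M : BilaxRep.{w, v, u, v₁, u₁} 𝒞) {i j : B} (F : 𝒞.Hom i j) (X : M.Obj i) :
    (M.act₂ (𝟙 F)).app X = 𝟙 _ := by
  rw [M.act₂_id, NatTrans.id_app]

theorem left_triangle (M : BilaxRep.{w, v, u, v₁, u₁} 𝒞) {i j : B} {F : 𝒞.Hom i j}
    {G : 𝒞.Hom j i} (P : 𝒞.AdjointPair F G) (X : M.Obj i) :
    (M.act F).map ((M.u' i).app X ≫ (M.act₂ P.α).app X ≫ (M.μ G F).hom.app X) ≫
      (M.μ F G).inv.app ((M.act F).obj X) ≫ (M.act₂ P.β).app ((M.act F).obj X) ≫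
        (M.u j).app ((M.act F).obj X) = 𝟙 _ := by
  have h := congrArg (fun t => (M.act₂ t).app X) P.left_triangle
  simp only [act₂_comp_app, act₂_id_app] at h
  have e : (M.act₂ (𝒞.associator F G F).inv).app X ≫ (M.μ (F ⊚ G) F).hom.app X ≫
      (M.μ F G).hom.app ((M.act F).obj X) =
        (M.μ F (G ⊚ F)).hom.app X ≫ (M.act F).map ((M.μ G F).hom.app X) := by
    rw [← M.μ_assoc, ← Category.assoc, ← act₂_comp_app, Iso.inv_hom_id, act₂_id_app,
      Category.id_comp]
  rw [Functor.map_comp, Functor.map_comp, ← M.u'_right, Category.assoc, Category.assoc,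
    Category.assoc, ← reassoc_of% M.μ_naturality_right, ← reassoc_of% e, Iso.hom_inv_id_app_assoc,
    ← reassoc_of% M.μ_naturality_left, M.u_left]
  exact h

theorem right_triangle (M : BilaxRep.{w, v, u, v₁, u₁} 𝒞) {i j : B} {F : 𝒞.Hom i j}
    {G : 𝒞.Hom j i} (P : 𝒞.AdjointPair F G) (Y : M.Obj j) :
    ((M.u' i).app ((M.act G).obj Y) ≫ (M.act₂ P.α).app ((M.act G).obj Y) ≫
        (M.μ G F).hom.app ((M.act G).obj Y)) ≫
      (M.act G).map ((M.μ F G).inv.app Y ≫ (M.act₂ P.β).app Y ≫ (M.u j).app Y) = 𝟙 _ := by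
  have h := congrArg (fun t => (M.act₂ t).app Y) P.right_triangle
  simp only [act₂_comp_app, act₂_id_app] at h
  have e := M.μ_assoc G F G Y
  rw [Functor.map_comp, Functor.map_comp, ← M.u'_left, Category.assoc, Category.assoc,
    Category.assoc, ← reassoc_of% M.μ_naturality_left, ← reassoc_of% e, ← Functor.map_comp_assoc,
    Iso.hom_inv_id_app, CategoryTheory.Functor.map_id, Category.id_comp, ← reassoc_of% M.μ_naturality_right,
    M.u_right]
  exact h

/-- An adjoint pair of 1-morphisms acts by adjoint functors. -/
def adjunction (M : BilaxRep.{w, v, u, v₁, u₁} 𝒞) {i j : B} {F : 𝒞.Hom i j} {G : 𝒞.Hom j i}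
    (P : 𝒞.AdjointPair F G) : M.act F ⊣ M.act G :=
  Adjunction.mkOfUnitCounit
    { unit := M.u' i ≫ M.act₂ P.α ≫ (M.μ G F).hom
      counit := (M.μ F G).inv ≫ M.act₂ P.β ≫ M.u j
      left_triangle := by
        ext X
        simpa using M.left_triangle P X
      right_triangle := by
        ext X
        simpa using M.right_triangle P X }

end

end BilaxRep

/-! Weakly fiax 2-categories. -/

/-- `X` is an indecomposable object of a category with biproducts: it is non-zero and not the biproduct of
two non-zero objects. -/
def IsIndecomposableObj {A : Type*} [Category A] [Preadditive A] (X : A) : Prop :=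
  ∃ _ : HasBinaryBiproducts A, Indecomposable X

/-- A finitary `k`-linear category: additive, idempotent split, with finite-dimensional morphism
spaces and finitely many isomorphism classes of indecomposable objects. -/
structure IsFinitaryCategory (k : Type*) [Field k] (A : Type*) [Category A] [Preadditive A]
    [Linear k A] : Prop where
  hasFiniteBiproducts : HasFiniteBiproducts A
  isIdempotentComplete : IsIdempotentComplete A
  finiteDimensional : ∀ X Y : A, FiniteDimensional k (X ⟶ Y)
  finite_indecomposables : ∃ (n : ℕ) (X : Fin n → A), ∀ Y : A,
    IsIndecomposableObj Y → ∃ t, Nonempty (Y ≅ X t)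

namespace BilaxTwoCategory

section
variable {k : Type*} [Field k] {B : Type w} (𝒞 : BilaxTwoCategory.{w, v, u} k B)

/-- A finitary bilax-unital 2-category. -/
structure IsFinitary : Prop where
  finite_objects : Finite B
  hom_finitary : ∀ i j : B, IsFinitaryCategory k (𝒞.Hom i j)
  lax_indecomposable : ∀ i : B, IsIndecomposableObj (𝒞.lax i).I
  oplax_indecomposable : ∀ i : B, IsIndecomposableObj (𝒞.oplax i).I

variable {𝒞} in
/-- Replacing the right adjoint by an isomorphic 1-morphism. -/
def AdjointPair.ofIso {i j : B} {F : 𝒞.Hom i j} {G G' : 𝒞.Hom j i} (P : 𝒞.AdjointPair F G)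
    (e : G ≅ G') : 𝒞.AdjointPair F G' where
  α := P.α ≫ e.hom ▷ F
  β := F ◁ e.inv ≫ P.β
  left_triangle := by
    have h := P.left_triangle
    have e' : F ◁ e.hom ▷ F ≫ F ◁ e.inv ▷ F = 𝟙 _ := by
      rw [← 𝒞.whiskerLeft_comp, TwoSemicategory.hom_inv_whiskerRight, 𝒞.whiskerLeft_id]
    simp only [𝒞.whiskerLeft_comp, 𝒞.comp_whiskerRight, TwoSemicategory.whisker_assoc,
      Category.assoc, Iso.inv_hom_id_assoc]
    rw [reassoc_of% e']
    exact h
  right_triangle := by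
    have h := P.right_triangle
    have h' : 𝒞.unitAt P.α G ≫ G ◁ P.β ≫ (𝒞.lax j).r G = 𝟙 G := by simpa [unitAt] using h
    simp only [𝒞.whiskerLeft_comp, 𝒞.comp_whiskerRight, Category.assoc]
    rw [reassoc_of% 𝒞.associator_naturality_left, ← reassoc_of% 𝒞.whisker_exchange,
      ← reassoc_of% 𝒞.whisker_exchange, (𝒞.lax j).r_naturality]
    have n := unitAt_naturality P.α e.inv
    simp only [unitAt, Category.assoc] at n h'
    rw [← reassoc_of% n, reassoc_of% h', e.inv_hom_id]

/-- The structure of a weakly fiax 2-category on a bilax-unital 2-category: an equivalence `⋆` from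
`𝒞` to the 2-category with reversed 1- and 2-morphisms, identical on objects, which sends lax units
and their unitors to oplax units and their unitors, together with adjunctions `(F, F⋆)` that
determine the values of `⋆` on 2-morphisms. -/
structure WeaklyFiax where
  star : ∀ i j : B, (𝒞.Hom i j)ᵒᵖ ⥤ 𝒞.Hom j i
  star_isEquivalence : ∀ i j, (star i j).IsEquivalence
  starComp : ∀ {i j m : B} (G : 𝒞.Hom j m) (F : 𝒞.Hom i j),
    (star i m).obj (.op (G ⊚ F)) ≅ (star i j).obj (.op F) ⊚ (star j m).obj (.op G)
  starComp_naturality_left : ∀ {i j m : B} {G G' : 𝒞.Hom j m} (g : G ⟶ G') (F : 𝒞.Hom i j),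
    (star i m).map (g ▷ F).op ≫ (starComp G F).hom =
      (starComp G' F).hom ≫ (star i j).obj (.op F) ◁ (star j m).map g.op
  starComp_naturality_right : ∀ {i j m : B} (G : 𝒞.Hom j m) {F F' : 𝒞.Hom i j} (f : F ⟶ F'),
    (star i m).map (G ◁ f).op ≫ (starComp G F).hom =
      (starComp G F').hom ≫ (star i j).map f.op ▷ (star j m).obj (.op G)
  starComp_assoc : ∀ {i j m n : B} (K : 𝒞.Hom m n) (G : 𝒞.Hom j m) (F : 𝒞.Hom i j),
    (star i n).map (𝒞.associator K G F).hom.op ≫ (starComp (K ⊚ G) F).hom ≫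
        (star i j).obj (.op F) ◁ (starComp K G).hom =
      (starComp K (G ⊚ F)).hom ≫ (starComp G F).hom ▷ (star m n).obj (.op K) ≫
        (𝒞.associator _ _ _).hom
  starUnit : ∀ i : B, (star i i).obj (.op (𝒞.lax i).I) ≅ (𝒞.oplax i).I
  star_l : ∀ {i j : B} (F : 𝒞.Hom j i),
    (star j i).map ((𝒞.lax i).l F).op ≫ (starComp (𝒞.lax i).I F).hom ≫
      (star j i).obj (.op F) ◁ (starUnit i).hom = (𝒞.oplax i).r ((star j i).obj (.op F))
  star_r : ∀ {i j : B} (G : 𝒞.Hom i j),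
    (star i j).map ((𝒞.lax i).r G).op ≫ (starComp G (𝒞.lax i).I).hom ≫
      (starUnit i).hom ▷ (star i j).obj (.op G) = (𝒞.oplax i).l ((star i j).obj (.op G))
  adj : ∀ {i j : B} (F : 𝒞.Hom i j), 𝒞.AdjointPair F ((star i j).obj (.op F))
  star_map : ∀ {i j : B} {F G : 𝒞.Hom j i} (γ : F ⟶ G),
    (star j i).map γ.op = (𝒞.oplax j).l ((star j i).obj (.op G)) ≫
      (adj F).α ▷ (star j i).obj (.op G) ≫
      ((star j i).obj (.op F) ◁ γ) ▷ (star j i).obj (.op G) ≫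
      (𝒞.associator _ _ _).hom ≫ (star j i).obj (.op F) ◁ (adj G).β ≫
      (𝒞.lax i).r ((star j i).obj (.op F))

variable {𝒞}

/-- The adjoint pair `(I, I')` given by `I⋆ ≅ I'`. -/
def WeaklyFiax.unitPair (S : 𝒞.WeaklyFiax) (i : B) :
    𝒞.AdjointPair (𝒞.lax i).I (𝒞.oplax i).I :=
  (S.adj (𝒞.lax i).I).ofIso (S.starUnit i)

theorem WeaklyFiax.exists_left (S : 𝒞.WeaklyFiax) {i j : B} (F : 𝒞.Hom i j) :
    ∃ G : 𝒞.Hom j i, Nonempty (𝒞.AdjointPair G F) := by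
  have := S.star_isEquivalence j i
  exact ⟨((S.star j i).objPreimage F).unop,
    ⟨(S.adj _).ofIso ((S.star j i).objObjPreimageIso F)⟩⟩

end

/-! Comodules. -/

section
variable {k : Type*} [Field k] {B : Type w} {𝒟 : BilaxTwoCategory.{w, v, u} k B} {i : B}

/-- A right comodule 1-morphism `i ⟶ j` over a coalgebra at `i`. -/
structure Comod (C : 𝒟.Coalgebra i) (j : B) where
  X : 𝒟.Hom i j
  ρ : X ⟶ X ⊚ C.X
  coassoc : ρ ≫ ρ ▷ C.X ≫ (𝒟.associator X C.X C.X).hom = ρ ≫ X ◁ C.Δ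
  counit : ρ ≫ X ◁ C.ε = (𝒟.oplax i).r X

namespace Comod

variable {C : 𝒟.Coalgebra i} {j m : B}

/-- The comodule homomorphisms. -/
def homSub (M N : Comod C j) : Submodule k (M.X ⟶ N.X) where
  carrier := {f | f ≫ N.ρ = M.ρ ≫ f ▷ C.X}
  add_mem' := fun {f g} hf hg => by
    change (f + g) ≫ N.ρ = M.ρ ≫ (f + g) ▷ C.X
    rw [Preadditive.add_comp, hf, hg, 𝒟.add_whiskerRight, Preadditive.comp_add]
  zero_mem' := by
    change 0 ≫ N.ρ = M.ρ ≫ 0 ▷ C.X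
    rw [zero_comp, TwoSemicategory.zero_whiskerRight, comp_zero]
  smul_mem' := fun t f hf => by
    change (t • f) ≫ N.ρ = M.ρ ≫ (t • f) ▷ C.X
    rw [Linear.smul_comp, hf, 𝒟.smul_whiskerRight, Linear.comp_smul]

instance : Category (Comod C j) where
  Hom M N := homSub M N
  id M := ⟨𝟙 M.X, by
    change 𝟙 _ ≫ M.ρ = M.ρ ≫ 𝟙 _ ▷ C.X
    rw [𝒟.id_whiskerRight, Category.id_comp, Category.comp_id]⟩
  comp {M N P} f g := ⟨f.1 ≫ g.1, by
    change (f.1 ≫ g.1) ≫ P.ρ = M.ρ ≫ (f.1 ≫ g.1) ▷ C.X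
    have hf : f.1 ≫ N.ρ = M.ρ ≫ f.1 ▷ C.X := f.2
    have hg : g.1 ≫ P.ρ = N.ρ ≫ g.1 ▷ C.X := g.2
    rw [𝒟.comp_whiskerRight, Category.assoc, hg, reassoc_of% hf]⟩
  id_comp f := Subtype.ext (Category.id_comp f.1)
  comp_id f := Subtype.ext (Category.comp_id f.1)
  assoc f g h := Subtype.ext (Category.assoc f.1 g.1 h.1)

instance : Preadditive (Comod C j) where
  homGroup M N := inferInstanceAs (AddCommGroup (homSub M N))
  add_comp _ _ _ f f' g := Subtype.ext (Preadditive.add_comp _ _ _ f.1 f'.1 g.1)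
  comp_add _ _ _ f g g' := Subtype.ext (Preadditive.comp_add _ _ _ f.1 g.1 g'.1)

instance : Linear k (Comod C j) where
  homModule M N := inferInstanceAs (Module k (homSub M N))
  smul_comp _ _ _ t f g := Subtype.ext (Linear.smul_comp _ _ _ t f.1 g.1)
  comp_smul _ _ _ f t g := Subtype.ext (Linear.comp_smul _ _ _ f.1 t g.1)

/-- A homomorphism of comodules from its underlying 2-morphism. -/
def homMk {M N : Comod C j} (f : M.X ⟶ N.X) (h : f ≫ N.ρ = M.ρ ≫ f ▷ C.X) : M ⟶ N := ⟨f, h⟩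

/-- An isomorphism of comodules from its underlying 2-isomorphism. -/
def isoMk {M N : Comod C j} (e : M.X ≅ N.X) (h : e.hom ≫ N.ρ = M.ρ ≫ e.hom ▷ C.X) : M ≅ N where
  hom := homMk e.hom h
  inv := homMk e.inv (by
    rw [Iso.inv_comp_eq, reassoc_of% h, TwoSemicategory.hom_inv_whiskerRight, Category.comp_id])
  hom_inv_id := Subtype.ext e.hom_inv_id
  inv_hom_id := Subtype.ext e.inv_hom_id

/-- The comodule `F ⊚ M`. -/
def actObj (F : 𝒟.Hom j m) (M : Comod C j) : Comod C m where
  X := F ⊚ M.X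
  ρ := F ◁ M.ρ ≫ (𝒟.associator F M.X C.X).inv
  coassoc := by
    simp only [𝒟.comp_whiskerRight, TwoSemicategory.whisker_assoc, Category.assoc,
      Iso.inv_hom_id_assoc]
    rw [← TwoSemicategory.pentagon_hom_inv, Iso.inv_hom_id_assoc,
      TwoSemicategory.comp_whiskerLeft, Iso.inv_hom_id_assoc]
    simp only [← reassoc_of% 𝒟.whiskerLeft_comp, M.coassoc]
  counit := by
    rw [TwoSemicategory.comp_whiskerLeft, Category.assoc, Iso.inv_hom_id_assoc,
      ← reassoc_of% 𝒟.whiskerLeft_comp, M.counit, Iso.comp_inv_eq, (𝒟.oplax i).r_comp]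

/-- The functor `M ↦ F ⊚ M`. -/
def actFunctor (F : 𝒟.Hom j m) : Comod C j ⥤ Comod C m where
  obj M := actObj F M
  map {M N} f := homMk (M := actObj F M) (N := actObj F N) (F ◁ f.1) (by
    have h : f.1 ≫ N.ρ = M.ρ ≫ f.1 ▷ C.X := f.2
    simp only [actObj, Category.assoc, TwoSemicategory.whisker_assoc, Iso.inv_hom_id_assoc]
    rw [← reassoc_of% 𝒟.whiskerLeft_comp, h, 𝒟.whiskerLeft_comp, Category.assoc])
  map_id M := Subtype.ext (𝒟.whiskerLeft_id F M.X)
  map_comp f g := Subtype.ext (𝒟.whiskerLeft_comp F f.1 g.1)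

end Comod

/-- The coalgebra as a right comodule over itself. -/
def Coalgebra.regular (C : 𝒟.Coalgebra i) : Comod C i := ⟨C.X, C.Δ, C.coassoc, C.counit_right⟩

/-- The bilax 2-representation `comod-C`, with `u` and `u'` given by the left unitors. -/
def comodRep (C : 𝒟.Coalgebra i) : BilaxRep.{w, v, u, v, max u v} 𝒟 where
  Obj j := Comod C j
  category _ := inferInstance
  preadditive _ := inferInstance
  linear _ := inferInstance
  act F := Comod.actFunctor F
  act₂ {j m} F F' f :=
    { app := fun M => Comod.homMk (M := Comod.actObj F M) (N := Comod.actObj F' M) (f ▷ M.X) (by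
        have h : (𝒟.associator F M.X C.X).inv ≫ f ▷ M.X ▷ C.X =
            f ▷ (M.X ⊚ C.X) ≫ (𝒟.associator F' M.X C.X).inv := by
          rw [Iso.inv_comp_eq, TwoSemicategory.whiskerRight_comp]
          simp
        simp only [Comod.actObj, Category.assoc]
        rw [h, reassoc_of% 𝒟.whisker_exchange])
      naturality := fun M N g => Subtype.ext (𝒟.whisker_exchange f g.1) }
  act_additive F := { map_add := Subtype.ext (𝒟.whiskerLeft_add F _ _) }
  act_linear F := { map_smul := fun _ _ => Subtype.ext (𝒟.whiskerLeft_smul F _ _) }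
  act₂_id F := NatTrans.ext (funext fun M => Subtype.ext (𝒟.id_whiskerRight F M.X))
  act₂_comp f g := NatTrans.ext (funext fun M => Subtype.ext (𝒟.comp_whiskerRight f g M.X))
  act₂_add f g M := Subtype.ext (𝒟.add_whiskerRight f g M.X)
  act₂_smul t f M := Subtype.ext (𝒟.smul_whiskerRight t f M.X)
  μ G F := NatIso.ofComponents
    (fun M => Comod.isoMk (M := Comod.actObj (G ⊚ F) M) (N := Comod.actObj G (Comod.actObj F M))
      (𝒟.associator G F M.X) (by
        simp only [Comod.actObj, TwoSemicategory.comp_whiskerLeft, 𝒟.whiskerLeft_comp,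
          Category.assoc]
        rw [← reassoc_of% TwoSemicategory.pentagon_inv,
          TwoSemicategory.inv_hom_whiskerRight, Category.comp_id]))
    (fun {M N} f => Subtype.ext (𝒟.associator_naturality_right G F f.1))
  μ_naturality_left g F M := Subtype.ext (𝒟.associator_naturality_left g F M.X)
  μ_naturality_right G _ _ f M := Subtype.ext (𝒟.associator_naturality_middle G f M.X)
  μ_assoc K G F M := Subtype.ext (𝒟.pentagon K G F M.X)
  u j :=
    { app := fun M => Comod.homMk (M := Comod.actObj (𝒟.lax j).I M) (N := M) ((𝒟.lax j).l M.X) (by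
        simp only [Comod.actObj, Category.assoc]
        rw [← (𝒟.lax j).l_comp, Iso.inv_hom_id_assoc, (𝒟.lax j).l_naturality])
      naturality := fun M N f => Subtype.ext ((𝒟.lax j).l_naturality f.1) }
  u' j :=
    { app := fun M => Comod.homMk (M := M) (N := Comod.actObj (𝒟.oplax j).I M)
        ((𝒟.oplax j).l M.X) (by
        simp only [Comod.actObj]
        rw [← reassoc_of% (𝒟.oplax j).l_naturality, ← (𝒟.oplax j).l_comp, Category.assoc,
          Iso.hom_inv_id, Category.comp_id])
      naturality := fun M N f => Subtype.ext ((𝒟.oplax j).l_naturality f.1) }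
  u_left {j m} F M := Subtype.ext ((𝒟.lax m).l_comp F M.X)
  u_right {j m} G M := Subtype.ext ((𝒟.lax j).l_r G M.X)
  u'_left {j m} F M := Subtype.ext ((𝒟.oplax m).l_comp F M.X)
  u'_right {j m} G M := Subtype.ext ((𝒟.oplax j).l_r G M.X)

end

end BilaxTwoCategory

/-! Injective comodules, and the objects generated by the action. -/

/-- The additive idempotent split closure: the direct summands of finite direct sums of objects
satisfying `S`. -/
def addClosure {A : Type*} [Category A] [Preadditive A] (S : ObjectProperty A) :
    ObjectProperty A :=
  fun M => ∃ (n : ℕ) (X : Fin n → A) (a : ∀ t, M ⟶ X t) (b : ∀ t, X t ⟶ M),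
    (∀ t, S (X t)) ∧ ∑ t, a t ≫ b t = 𝟙 M

theorem addClosure_map {A A' : Type*} [Category A] [Preadditive A] [Category A'] [Preadditive A']
    {S : ObjectProperty A} {S' : ObjectProperty A'} (F : A ⥤ A') [F.Additive]
    (h : ∀ X, S X → ∃ Y, S' Y ∧ Nonempty (F.obj X ≅ Y)) {M : A} (hM : addClosure S M) :
    addClosure S' (F.obj M) := by
  obtain ⟨n, X, a, b, hX, e⟩ := hM
  choose Y hY i using fun t => h (X t) (hX t)
  refine ⟨n, Y, fun t => F.map (a t) ≫ (i t).some.hom, fun t => (i t).some.inv ≫ F.map (b t), hY, ?_⟩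
  simp only [Category.assoc, Iso.hom_inv_id_assoc]
  rw [← F.map_id, ← e, F.map_sum]
  simp

namespace BilaxRep

section
variable {k : Type*} [Field k] {B : Type w} {𝒞 : BilaxTwoCategory.{w, v, u} k B}

/-- A bilax 2-representation is finitary if it takes values in finitary categories. -/
def IsFinitary (M : BilaxRep.{w, v, u, v₁, u₁} 𝒞) : Prop :=
  ∀ i, IsFinitaryCategory k (M.Obj i)

/-- The objects of `(𝒞 M)(j)`, the additive idempotent split closure of the objects `M(F) X`. -/
def generated (M : BilaxRep.{w, v, u, v₁, u₁} 𝒞) (j : B) : ObjectProperty (M.Obj j) :=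
  addClosure fun Y => ∃ (m : B) (F : 𝒞.Hom m j) (X : M.Obj m), Y = (M.act F).obj X

theorem act_injective (M : BilaxRep.{w, v, u, v₁, u₁} 𝒞) (S : 𝒞.WeaklyFiax) {i j : B}
    (F : 𝒞.Hom i j) (X : M.Obj i) (hX : Injective X) : Injective ((M.act F).obj X) := by
  obtain ⟨G, ⟨P⟩⟩ := S.exists_left F
  obtain ⟨H, ⟨Q⟩⟩ := S.exists_left G
  have := (M.adjunction Q).isRightAdjoint
  have : (M.act G).PreservesMonomorphisms := inferInstance
  exact Injective.injective_of_adjoint (M.adjunction P) X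

end

end BilaxRep

namespace BilaxTwoCategory

section
variable {k : Type*} [Field k] {B : Type w} {𝒞 : BilaxTwoCategory.{w, v, u} k B} {i : B}

/-- The bilax 2-representation `inj-C` of `𝒞` on the injective objects of the categories of right
comodules over a coalgebra `C` in the injective abelianization of `𝒞`. -/
def injRep (S : 𝒞.WeaklyFiax) (C : 𝒞.abel.Coalgebra i) :
    BilaxRep.{w, v, u, v, max u v} 𝒞 :=
  (comodRep C).restrict.sub (fun _ X => Injective X)
    (fun F X hX => BilaxRep.act_injective _ S F X hX)

/-- The bilax 2-representation `𝒞 C` of `𝒞`: its value at `j` is the additive idempotent split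
closure of the comodules `F ⊚ C`, where `F` is a 1-morphism of `𝒞` from `i` to `j`. -/
def genRep (C : 𝒞.abel.Coalgebra i) : BilaxRep.{w, v, u, v, max u v} 𝒞 :=
  (comodRep C).restrict.sub
    (fun j => addClosure fun Y : Comod C j => ∃ F : 𝒞.Hom i j, Y = Comod.actObj (ι F) C.regular)
    (fun {j m} F X hX => addClosure_map ((comodRep C).act (ι F)) (by
      rintro _ ⟨G, rfl⟩
      exact ⟨Comod.actObj (ι (F ⊚ G)) C.regular, ⟨F ⊚ G, rfl⟩,
        ⟨(((comodRep C).μ (ι F) (ι G)).app C.regular).symm⟩⟩) hX)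

/-- Morita–Takeuchi equivalence of two coalgebras: the bilax 2-representations given by their right
comodules are equivalent. -/
def MoritaTakeuchiEquivalent {𝒟 : BilaxTwoCategory.{w, v, u} k B} {i j : B}
    (C : 𝒟.Coalgebra i) (D : 𝒟.Coalgebra j) : Prop :=
  (comodRep C).Equivalent (comodRep D)

/-- The coalgebra `I ⊚ C ⊚ I'`. -/
def Coalgebra.unitConj (S : 𝒞.WeaklyFiax) (C : 𝒞.abel.Coalgebra i) : 𝒞.abel.Coalgebra i :=
  C.conj (S.unitPair i).ι

end

end BilaxTwoCategory

/-! Each of the three conditions holds for every coalgebra `C`, so each is proved outright and no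
condition is deduced from another.

Two facts support everything. In the injective abelianization, a morphism represented by `g : X ⟶ Y`
is mono exactly when `g` is split mono modulo the ideal generated by the tuple of its source
(`Abel.mono_homMk_iff`). This is an equation, so it survives horizontal composition on either side,
and it makes objects of `𝒞` injective. Moreover the triangle identities split the oplax unitors `F ⟶
F I'` and `F ⟶ I' F` in `𝒞`, so the right unitors and the units `X ⟶ I' I X` are mono in the
abelianization (`WeaklyFiax.mono_oplax_r`, `WeaklyFiax.mono_unitAt`).

Condition 1. Every comodule embeds into some `F C` with `F` in `𝒞` (`Comod.exists_mono_free`), and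
every `F C` is injective (`Comod.injective_free`). Hence the injectives are precisely the summands
of finite sums of such `F C`, and the two representations have the same objects.

Condition 3. Comodules are Hom-finite and idempotent split, and every injective comodule is a
retract of a value of the additive functor `F ↦ F C` on a finitary category; a Krull–Schmidt
argument gives finitarity (`IsFinitaryCategory.of_retracts`). Generation holds because `F C` is a
retract of `F (I' C)`, where `I' C` is injective.

Condition 2. The equivalence is `M ↦ M I'`, a special case of `M ↦ M G` from `C`-comodules to `F C
G`-comodules for an adjoint pair `(F, G)`. It is faithful because `M ⟶ M I'` is mono and natural. It
is full because the monomorphism `N ⟶ N C ⟶ N I' I C` lets a homomorphism `M I' ⟶ N I'` descend to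
`M ⟶ N`. It is essentially surjective because the counit of `D = I C I'` factors through the lax
unit: this makes each `D`-comodule `N` the split equalizer of `N D ⇉ N D D`, a diagram that lifts to
`C`-comodules, and the kernel of the lifted difference maps to `N`. -/

namespace Abel

/-! ### Kernels, monomorphisms and injective objects in the injective abelianization. -/

section
variable {k : Type*} [Field k] {A : Type u} [Category.{v} A] [Preadditive A] [Linear k A]

theorem homMk_eq_iff {X Y : Abel k A} {g g' : X.obj ⟶ Y.obj} (hg : g ∈ homSub X Y)
    (hg' : g' ∈ homSub X Y) : homMk g hg = homMk g' hg' ↔ g - g' ∈ X.ideal Y.obj :=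
  Submodule.Quotient.eq (homIdeal X Y)

theorem homMk_eq_zero_iff {X Y : Abel k A} {g : X.obj ⟶ Y.obj} (hg : g ∈ homSub X Y) :
    homMk g hg = 0 ↔ g ∈ X.ideal Y.obj :=
  Submodule.Quotient.mk_eq_zero (homIdeal X Y)

/-- The kernel of a morphism `X ⟶ Y` represented by `g`. -/
abbrev ker (X : Abel k A) {Z : A} (g : X.obj ⟶ Z) : Abel k A := ⟨X.obj, ⟨Z, g⟩ :: X.maps⟩

/-- Adjoining `g` to the tuple enlarges the ideal by the multiples of `g`, so membership can be
tested modulo the old ideal. -/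
theorem mem_ideal_ker_iff {X : Abel k A} {Z : A} {g : X.obj ⟶ Z} {W : A} {t : X.obj ⟶ W} :
    t ∈ (X.ker g).ideal W ↔ ∃ q : Z ⟶ W, t - g ≫ q ∈ X.ideal W := by
  constructor
  · intro h
    refine Submodule.span_induction
      (p := fun t _ => ∃ q : Z ⟶ W, t - g ≫ q ∈ X.ideal W) ?_ ?_ ?_ ?_ h
    · rintro _ ⟨p, hp, q, rfl⟩
      rcases List.mem_cons.1 hp with rfl | hp
      · exact ⟨q, (sub_self (g ≫ q)).symm ▸ Submodule.zero_mem _⟩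
      · exact ⟨0, by simpa using mem_ideal (X := X) p hp q⟩
    · exact ⟨0, by simp⟩
    · rintro x y _ _ ⟨q, hq⟩ ⟨q', hq'⟩
      refine ⟨q + q', ?_⟩
      have := Submodule.add_mem _ hq hq'
      rwa [show x - g ≫ q + (y - g ≫ q') = x + y - g ≫ (q + q') by
        rw [Preadditive.comp_add]; abel] at this
    · rintro a x _ ⟨q, hq⟩
      refine ⟨a • q, ?_⟩
      have := Submodule.smul_mem _ a hq
      rwa [smul_sub, ← Linear.comp_smul] at this
  · rintro ⟨q, hq⟩
    have h₁ : X.ideal W ≤ (X.ker g).ideal W := Submodule.span_mono (by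
      rintro _ ⟨p, hp, q, rfl⟩
      exact ⟨p, List.mem_cons_of_mem _ hp, q, rfl⟩)
    have h₂ : g ≫ q ∈ (X.ker g).ideal W :=
      mem_ideal (X := X.ker g) ⟨Z, g⟩ List.mem_cons_self q
    exact sub_add_cancel t (g ≫ q) ▸ Submodule.add_mem _ (h₁ hq) h₂

theorem ideal_le_ideal_ker (X : Abel k A) {Z : A} (g : X.obj ⟶ Z) (W : A) :
    X.ideal W ≤ (X.ker g).ideal W :=
  fun t ht => mem_ideal_ker_iff.2 ⟨0, by simpa using ht⟩

theorem comp_mem_ideal_ker (X : Abel k A) {Z : A} (g : X.obj ⟶ Z) {W : A} (q : Z ⟶ W) :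
    g ≫ q ∈ (X.ker g).ideal W :=
  mem_ideal_ker_iff.2 ⟨q, by simp⟩

theorem id_mem_ker (X : Abel k A) {Z : A} (g : X.obj ⟶ Z) : 𝟙 X.obj ∈ homSub (X.ker g) X :=
  fun p hp => ideal_le_ideal_ker X g _ (id_mem X p hp)

/-- The inclusion of the kernel. -/
def kerι (X : Abel k A) {Z : A} (g : X.obj ⟶ Z) : X.ker g ⟶ X :=
  homMk (X := X.ker g) (𝟙 X.obj) (id_mem_ker X g)

theorem kerι_comp {X Y : Abel k A} (g : X.obj ⟶ Y.obj) (hg : g ∈ homSub X Y) :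
    X.kerι g ≫ homMk g hg = 0 := by
  refine (homMk_eq_zero_iff (X := X.ker g) (comp_mem (id_mem_ker X g) hg)).2 ?_
  simpa using comp_mem_ideal_ker X g (𝟙 _)

theorem mem_homSub_ker {W X Y : Abel k A} {g : X.obj ⟶ Y.obj}
    {t : W.obj ⟶ X.obj} (ht : t ∈ homSub W X) (h : t ≫ g ∈ W.ideal Y.obj) :
    t ∈ homSub W (X.ker g) := fun p hp => by
  rcases List.mem_cons.1 hp with rfl | hp
  · exact h
  · exact ht p hp

theorem exists_ker_lift {W X Y : Abel k A} (g : X.obj ⟶ Y.obj) (hg : g ∈ homSub X Y)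
    (t : W ⟶ X) (h : t ≫ homMk g hg = 0) : ∃ s : W ⟶ X.ker g, s ≫ X.kerι g = t := by
  obtain ⟨t, ht, rfl⟩ := homMk_surj t
  rw [homMk_comp, homMk_eq_zero_iff] at h
  exact ⟨homMk (Y := X.ker g) t (mem_homSub_ker ht h), homMk_congr (Category.comp_id t) _ _⟩

instance mono_kerι (X : Abel k A) {Z : A} (g : X.obj ⟶ Z) : Mono (X.kerι g) :=
  Preadditive.mono_of_cancel_zero _ fun {W} t h => by
    obtain ⟨t, ht, rfl⟩ := homMk_surj t
    have h' : (homMk (t ≫ 𝟙 X.obj) (comp_mem ht (id_mem_ker X g)) : W ⟶ X) = 0 := h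
    rw [homMk_eq_zero_iff] at h' ⊢
    simpa using h'

/-- The partial inverse `q` need not respect the defining tuples: multiplying a relation `t ≫ g ∈
ideal` by any `q` stays in the ideal of the source of `t`. -/
theorem mono_homMk_of_mem {X Y : Abel k A} {g : X.obj ⟶ Y.obj} (hg : g ∈ homSub X Y)
    (q : Y.obj ⟶ X.obj) (hq : 𝟙 _ - g ≫ q ∈ X.ideal X.obj) : Mono (homMk g hg) :=
  Preadditive.mono_of_cancel_zero _ fun {W} t h => by
    obtain ⟨t, ht, rfl⟩ := homMk_surj t
    rw [homMk_comp, homMk_eq_zero_iff] at h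
    rw [homMk_eq_zero_iff]
    have := Submodule.add_mem _ (mem_comp_ideal ht hq) (comp_mem_ideal h q)
    simpa [Preadditive.comp_sub] using this

theorem exists_of_kerι_eq_zero {X : Abel k A} {Z : A} {g : X.obj ⟶ Z} (h : X.kerι g = 0) :
    ∃ q : Z ⟶ X.obj, 𝟙 _ - g ≫ q ∈ X.ideal X.obj :=
  mem_ideal_ker_iff.1 ((homMk_eq_zero_iff (X := X.ker g) (id_mem_ker X g)).1 h)

/-- A mono has zero kernel inclusion; as this inclusion is represented by the identity, its
vanishing puts the identity in the ideal enlarged by `g`, which yields `q`. -/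
theorem mono_homMk_iff {X Y : Abel k A} {g : X.obj ⟶ Y.obj} (hg : g ∈ homSub X Y) :
    Mono (homMk g hg) ↔ ∃ q : Y.obj ⟶ X.obj, 𝟙 _ - g ≫ q ∈ X.ideal X.obj := by
  refine ⟨fun _ => ?_, fun ⟨q, hq⟩ => mono_homMk_of_mem hg q hq⟩
  refine exists_of_kerι_eq_zero ?_
  rw [← cancel_mono (homMk g hg), kerι_comp, zero_comp]

/-- Objects of `A` are injective: since the target has an empty tuple, `q ≫ f` is a morphism
whatever `q` is, and it extends `f` because `m ≫ q` is the identity modulo the ideal. -/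
theorem exists_emb_extension {X Y : Abel k A} (m : X ⟶ Y) [hMono : Mono m] {F : A} (f : X ⟶ emb k F) :
    ∃ g : Y ⟶ emb k F, m ≫ g = f := by
  obtain ⟨m, hm, rfl⟩ := homMk_surj m
  obtain ⟨f, hf, rfl⟩ := homMk_surj f
  obtain ⟨q, hq⟩ := (mono_homMk_iff hm).1 inferInstance
  refine ⟨homMk (Y := emb k F) (q ≫ f) (mem_emb _), ?_⟩
  rw [homMk_comp, homMk_eq_iff]
  have := Submodule.neg_mem _ (comp_mem_ideal hq f)
  simpa [Preadditive.sub_comp] using this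

/-- A morphism into the target of a monomorphism `m` factors through `m` if it is killed by all
morphisms to objects of `A` that kill `m`. -/
theorem exists_factor {M N Q : Abel k A} (m : N ⟶ Q) [hMono : Mono m] (h : M ⟶ Q)
    (H : ∀ (Z : A) (t : Q ⟶ emb k Z), m ≫ t = 0 → h ≫ t = 0) : ∃ f : M ⟶ N, f ≫ m = h := by
  obtain ⟨m, hm, rfl⟩ := homMk_surj m
  obtain ⟨h, hh, rfl⟩ := homMk_surj h
  obtain ⟨q, hq⟩ := (mono_homMk_iff hm).1 inferInstance
  -- The hypothesis on representatives. It is applied to `q ≫ p.2`, to see that `h ≫ q` respects the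
  -- tuple of `N`, and to `q ≫ m - 𝟙`, to see that `h ≫ q` is a factorization.
  have key : ∀ (Z : A) (t : Q.obj ⟶ Z), m ≫ t ∈ N.ideal Z → h ≫ t ∈ M.ideal Z := fun Z t ht => by
    have := H Z (homMk (Y := emb k Z) t (mem_emb t)) ((homMk_eq_zero_iff _).2 ht)
    exact (homMk_eq_zero_iff (Y := emb k Z) (mem_emb _)).1 this
  have hf : h ≫ q ∈ homSub M N := fun p hp => by
    rw [Category.assoc]
    refine key _ _ ?_
    have := Submodule.sub_mem _ (proj_mem p hp) (comp_mem_ideal hq p.2)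
    simpa [Preadditive.sub_comp] using this
  refine ⟨homMk (h ≫ q) hf, ?_⟩
  rw [homMk_comp, homMk_eq_iff]
  have := key _ (q ≫ m - 𝟙 _) (by
    have := Submodule.neg_mem _ (comp_mem_ideal hq m)
    simpa [Preadditive.sub_comp, Preadditive.comp_sub] using this)
  simpa [Preadditive.comp_sub] using this

/-- The inclusion of an object of the abelianization into an object of `A`. -/
def incl (X : Abel k A) : X ⟶ emb k X.obj := homMk (Y := emb k X.obj) (𝟙 X.obj) (mem_emb _)

instance mono_incl (X : Abel k A) : Mono X.incl :=
  mono_homMk_of_mem (Y := emb k X.obj) _ (𝟙 X.obj) (by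
    have : 𝟙 X.obj - 𝟙 X.obj ≫ 𝟙 X.obj = 0 := by simp
    exact this ▸ Submodule.zero_mem _)

instance finiteDimensional_hom [∀ X Y : A, FiniteDimensional k (X ⟶ Y)] (X Y : Abel k A) :
    FiniteDimensional k (X ⟶ Y) :=
  inferInstanceAs (FiniteDimensional k (homSub X Y ⧸ homIdeal X Y))

end

end Abel

/-! ### Horizontal composition against monomorphisms and kernels; splitting of the unitors. -/

namespace BilaxTwoCategory

section
variable {k : Type*} [Field k] {B : Type w} {𝒞 : BilaxTwoCategory.{w, v, u} k B}
  {a b c i j : B}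

/-- Whiskering preserves the criterion `Abel.mono_homMk_iff`: apply it to the partial inverse and to
the ideal membership. -/
theorem mono_whiskerRight {X Y : 𝒞.abel.Hom b c} (m : X ⟶ Y) [hm : Mono m]
    (F : 𝒞.abel.Hom a b) : Mono (m ▷ F) := by
  obtain ⟨m, h, rfl⟩ := Abel.homMk_surj m
  obtain ⟨q, hq⟩ := (Abel.mono_homMk_iff h).1 hm
  refine Abel.mono_homMk_of_mem (TwoSemicategory.whiskerRight_mem h F) (q ▷ F.obj)
    (Abel.mem_ideal_of_eq ?_ (TwoSemicategory.whiskerRight_mem_ideal F hq))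
  have := (𝒞.whiskerRightₗ X.obj X.obj F.obj).map_sub (𝟙 _) (m ≫ q)
  refine Eq.trans ?_ this.symm
  exact congrArg₂ _ (𝒞.id_whiskerRight _ _).symm (𝒞.comp_whiskerRight _ _ _).symm

theorem mono_whiskerLeft (G : 𝒞.abel.Hom b c) {X Y : 𝒞.abel.Hom a b} (m : X ⟶ Y)
    [hm : Mono m] : Mono (G ◁ m) := by
  obtain ⟨m, h, rfl⟩ := Abel.homMk_surj m
  obtain ⟨q, hq⟩ := (Abel.mono_homMk_iff h).1 hm
  refine Abel.mono_homMk_of_mem (TwoSemicategory.whiskerLeft_mem G h) (G.obj ◁ q)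
    (Abel.mem_ideal_of_eq ?_ (TwoSemicategory.whiskerLeft_mem_ideal G hq))
  have := (𝒞.whiskerLeftₗ G.obj X.obj X.obj).map_sub (𝟙 _) (m ≫ q)
  refine Eq.trans ?_ this.symm
  exact congrArg₂ _ (𝒞.whiskerLeft_id _ _).symm (𝒞.whiskerLeft_comp _ _ _).symm

/-- Kernels exist in the injective abelianization and are preserved by right composition. -/
theorem exists_kernel {X Y : 𝒞.abel.Hom i j} (f : X ⟶ Y) :
    ∃ (K : 𝒞.abel.Hom i j) (κ : K ⟶ X), Mono κ ∧ κ ≫ f = 0 ∧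
      (∀ {W : 𝒞.abel.Hom i j} (t : W ⟶ X), t ≫ f = 0 → ∃ s : W ⟶ K, s ≫ κ = t) ∧
      ∀ {a : B} (G : 𝒞.abel.Hom a i) {W : 𝒞.abel.Hom a j} (t : W ⟶ X ⊚ G),
        t ≫ f ▷ G = 0 → ∃ s : W ⟶ K ⊚ G, s ≫ κ ▷ G = t := by
  obtain ⟨g, hg, rfl⟩ := Abel.homMk_surj f
  refine ⟨Abel.ker X g, Abel.kerι X g, Abel.mono_kerι X g,
    Abel.kerι_comp g hg, fun t ht => Abel.exists_ker_lift g hg t ht, fun {a} G W t ht => ?_⟩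
  obtain ⟨t, h, rfl⟩ := Abel.homMk_surj t
  have h0 : t ≫ g ▷ G.obj ∈ W.ideal (Y.obj ⊚ G.obj) :=
    (Abel.homMk_eq_zero_iff (Y := 𝒞.abelComp Y G)
      (Abel.comp_mem h (TwoSemicategory.whiskerRight_mem hg G))).1 ht
  have h' := TwoSemicategory.mem_abelComp_iff.1 h
  -- The tuple of `ker g ⊚ G` is that of `X ⊚ G` with `g ▷ G` adjoined, so the same representative
  -- `t` is the lift.
  refine ⟨Abel.homMk (Y := 𝒞.abelComp (Abel.ker X g) G) t
    (TwoSemicategory.mem_abelComp_iff.2 ⟨h'.1, fun p hp => ?_⟩), ?_⟩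
  · rcases List.mem_cons.1 hp with rfl | hp
    · exact h0
    · exact h'.2 p hp
  · refine Abel.homMk_congr ?_ _ _
    refine (congrArg (t ≫ ·) (𝒞.id_whiskerRight X.obj G.obj)).trans (Category.comp_id t)

theorem exists_ι_extension {X Y : 𝒞.abel.Hom i j} (m : X ⟶ Y) [hm : Mono m] {F : 𝒞.Hom i j}
    (f : X ⟶ ι F) : ∃ g : Y ⟶ ι F, m ≫ g = f :=
  Abel.exists_emb_extension (hMono := hm) m f

theorem exists_mono_ι (X : 𝒞.abel.Hom i j) : ∃ (F : 𝒞.Hom i j) (f : X ⟶ ι F), Mono f :=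
  ⟨X.obj, Abel.incl X, Abel.mono_incl X⟩

theorem exists_factor {M N Q : 𝒞.abel.Hom i j} (m : N ⟶ Q) [hm : Mono m] (h : M ⟶ Q)
    (H : ∀ (Z : 𝒞.abel.Hom i j) (t : Q ⟶ Z), m ≫ t = 0 → h ≫ t = 0) :
    ∃ f : M ⟶ N, f ≫ m = h :=
  Abel.exists_factor (hMono := hm) m h fun Z t ht => H (ι Z) t ht

theorem WeaklyFiax.exists_oplax_r_retraction (S : 𝒞.WeaklyFiax) (F : 𝒞.Hom i j) :
    ∃ q, (𝒞.oplax i).r F ≫ q = 𝟙 F :=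
  ⟨_, (S.adj F).left_triangle⟩

theorem WeaklyFiax.exists_oplax_l_retraction (S : 𝒞.WeaklyFiax) (F : 𝒞.Hom i j) :
    ∃ q, (𝒞.oplax j).l F ≫ q = 𝟙 F := by
  obtain ⟨G, ⟨P⟩⟩ := S.exists_left F
  exact ⟨_, P.right_triangle⟩

/-- The right triangle identity whiskered with `X`, companion of `AdjointPair.unitAt_counitAt`. -/
theorem AdjointPair.unitAt_whiskerLeft_counitAt {F : 𝒞.Hom i j} {G : 𝒞.Hom j i}
    (P : 𝒞.AdjointPair F G) (X : 𝒞.Hom a j) :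
    𝒞.unitAt P.α (G ⊚ X) ≫ G ◁ 𝒞.counitAt P.β X = 𝟙 _ := by
  have h := congrArg (fun t => t ▷ X) P.right_triangle
  simp only [𝒞.comp_whiskerRight, 𝒞.id_whiskerRight, TwoSemicategory.whisker_assoc,
    Category.assoc, Iso.inv_hom_id_assoc, ← (𝒞.lax j).l_r] at h
  rw [unitAt, counitAt, ← (𝒞.oplax i).l_comp, Category.assoc, Category.assoc, Category.assoc,
    ← reassoc_of% 𝒞.associator_naturality_left, ← reassoc_of% 𝒞.pentagon, 𝒞.whiskerLeft_comp,
    reassoc_of% TwoSemicategory.whiskerLeft_hom_inv, 𝒞.whiskerLeft_comp]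
  exact h

theorem WeaklyFiax.exists_unitAt_retraction (S : 𝒞.WeaklyFiax) {F : 𝒞.Hom i i}
    (P : 𝒞.AdjointPair F (𝒞.oplax i).I) (X : 𝒞.Hom a i) : ∃ q, 𝒞.unitAt P.α X ≫ q = 𝟙 X := by
  obtain ⟨q, hq⟩ := S.exists_oplax_l_retraction X
  -- The triangle identity only splits the unit at `I' ⊚ X`. Naturality along `X ⟶ I' ⊚ X` moves the
  -- unit there, and `q` returns to `X`.
  refine ⟨(𝒞.oplax i).I ◁ F ◁ (𝒞.oplax i).l X ≫ (𝒞.oplax i).I ◁ 𝒞.counitAt P.β X ≫ q, ?_⟩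
  rw [← reassoc_of% unitAt_naturality P.α, reassoc_of% P.unitAt_whiskerLeft_counitAt, hq]

theorem WeaklyFiax.mono_oplax_r (S : 𝒞.WeaklyFiax) (M : 𝒞.abel.Hom i j) :
    Mono ((𝒞.abel.oplax i).r M) := by
  obtain ⟨q, hq⟩ := S.exists_oplax_r_retraction (Abel.obj M)
  -- A retraction in `𝒞` of the representative is enough, even if it is not a morphism of the
  -- abelianization.
  refine Abel.mono_homMk_of_mem (oplax_r_mem M) q (Abel.mem_ideal_of_eq ?_ (Submodule.zero_mem _))
  exact sub_eq_zero.2 hq.symm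

theorem WeaklyFiax.mono_unitAt (S : 𝒞.WeaklyFiax)
    (P : 𝒞.AdjointPair (𝒞.lax i).I (𝒞.oplax i).I) (X : 𝒞.abel.Hom a i) :
    Mono (𝒞.abel.unitAt P.ι.α X) := by
  obtain ⟨q, hq⟩ := S.exists_unitAt_retraction P (Abel.obj X)
  have hg : 𝒞.unitAt P.α (Abel.obj X) ∈ Abel.homSub X
      (𝒞.abelComp (Abel.emb k (𝒞.oplax i).I) (𝒞.abelComp (Abel.emb k (𝒞.lax i).I) X)) :=
    Abel.comp_mem (oplax_l_mem X) (Abel.comp_mem (TwoSemicategory.whiskerRight_mem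
      (G := Abel.emb k (𝒞.oplax i).I) (G' := 𝒞.abelComp (Abel.emb k (𝒞.oplax i).I)
        (Abel.emb k (𝒞.lax i).I)) (g := P.α) (fun _ hp => absurd hp List.not_mem_nil) X)
      (TwoSemicategory.associator_mem _ _ X))
  refine Abel.mono_homMk_of_mem hg q (Abel.mem_ideal_of_eq ?_ (Submodule.zero_mem _))
  exact sub_eq_zero.2 hq.symm

end

end BilaxTwoCategory

/-! ### Kernels of comodules, free comodules and injectivity. -/

namespace BilaxTwoCategory

namespace Comod

section
variable {k : Type*} [Field k] {B : Type w} {𝒟 : BilaxTwoCategory.{w, v, u} k B} {i j m : B}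
  {C : 𝒟.Coalgebra i}

theorem hom_w {M N : Comod C j} (f : M ⟶ N) : f.1 ≫ N.ρ = M.ρ ≫ f.1 ▷ C.X := f.2

theorem mono_of_mono_val {M N : Comod C j} (f : M ⟶ N) [h : Mono f.1] : Mono f where
  right_cancellation _ _ e := Subtype.ext ((cancel_mono f.1).1 (congrArg Subtype.val e))

/-- The coaction of a comodule as a homomorphism to a free comodule. -/
def coact (M : Comod C j) : M ⟶ actObj M.X C.regular :=
  homMk (N := actObj M.X C.regular) M.ρ (by
    have h := M.coassoc
    rw [← Category.assoc, ← Iso.eq_comp_inv, Category.assoc] at h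
    exact h.symm)

/-- The counit law exhibits the oplax unitor as a composite starting with the coaction. -/
theorem mono_coact_val (M : Comod C j) [Mono ((𝒟.oplax i).r M.X)] : Mono M.coact.1 := by
  have h : M.ρ ≫ M.X ◁ C.ε = (𝒟.oplax i).r M.X := M.counit
  have : Mono (M.ρ ≫ M.X ◁ C.ε) := by rw [h]; infer_instance
  exact mono_of_mono M.ρ (M.X ◁ C.ε)

/-- The homomorphism of free comodules induced by a 2-morphism. -/
def freeMap (C : 𝒟.Coalgebra i) {X Y : 𝒟.Hom i j} (f : X ⟶ Y) :
    actObj X C.regular ⟶ actObj Y C.regular :=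
  ((comodRep C).act₂ f).app C.regular

/-- The retraction of `F ⊚ M ⟶ F ⊚ I' ⊚ M`. -/
def retr {F : 𝒟.Hom j m} {G : 𝒟.Hom m j} (P : 𝒟.AdjointPair F G) (M : Comod C j) :
    actObj F (actObj (𝒟.oplax j).I M) ⟶ actObj F M :=
  homMk (M := actObj F (actObj (𝒟.oplax j).I M)) (N := actObj F M) (P.retr M.X) (by
    have h := (Iso.eq_comp_inv _).2 (P.retr_comp M.X C.X)
    simp only [actObj, Category.assoc] at h ⊢
    rw [← reassoc_of% P.retr_naturality, h, Iso.inv_hom_id_assoc,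
      ← reassoc_of% 𝒟.whiskerLeft_comp F, Category.assoc, Iso.inv_hom_id, Category.comp_id])

theorem l_retr {F : 𝒟.Hom j m} {G : 𝒟.Hom m j} (P : 𝒟.AdjointPair F G) (M : Comod C j) :
    (actFunctor F).map (((comodRep C).u' j).app M) ≫ retr P M = 𝟙 (actObj F M) :=
  Subtype.ext (P.l_retr M.X)

/-- Replaces the cofree adjunction: as `ε` ends in `I'`, a homomorphism to `F C` only yields a
2-morphism to `F I'`. An extension `g` of the latter gives `N ⟶ N C ⟶ F I' C`, and the retraction `F
I' C ⟶ F C` given by the adjunction completes it. -/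
theorem comp_extension {F : 𝒟.Hom i j} {G : 𝒟.Hom j i} (P : 𝒟.AdjointPair F G) {M N : Comod C j}
    (m : M ⟶ N) (f : M ⟶ actObj F C.regular) (g : N.X ⟶ F ⊚ (𝒟.oplax i).I)
    (hg : m.1 ≫ g = f.1 ≫ F ◁ C.ε) :
    m ≫ N.coact ≫ freeMap C g ≫ ((comodRep C).μ F (𝒟.oplax i).I).hom.app C.regular ≫
      retr P C.regular = f := by
  obtain ⟨f, hf⟩ := f
  refine Subtype.ext ?_
  change M.X ⟶ F ⊚ C.X at f
  replace hf : f ≫ F ◁ C.Δ ≫ (𝒟.associator _ _ _).inv = M.ρ ≫ f ▷ C.X := hf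
  change m.1 ≫ N.ρ ≫ g ▷ C.X ≫ (𝒟.associator _ _ _).hom ≫ P.retr C.X = f
  replace hg : m.1 ≫ g = f ≫ F ◁ C.ε := hg
  rw [reassoc_of% hom_w m, ← reassoc_of% 𝒟.comp_whiskerRight, hg,
    𝒟.comp_whiskerRight, Category.assoc, ← reassoc_of% hf,
    reassoc_of% 𝒟.associator_naturality_middle, Iso.inv_hom_id_assoc,
    ← reassoc_of% 𝒟.whiskerLeft_comp, C.counit_left, P.l_retr, Category.comp_id]

end

section
variable {k : Type*} [Field k] {B : Type w} {𝒞 : BilaxTwoCategory.{w, v, u} k B} {i j m : B}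
  {C : 𝒞.abel.Coalgebra i}

theorem exists_kernel {M N : Comod C j} (f : M ⟶ N) :
    ∃ (K : Comod C j) (κ : K ⟶ M), Mono κ.1 ∧ κ ≫ f = 0 ∧
      (∀ {W : 𝒞.abel.Hom i j} (t : W ⟶ M.X), t ≫ f.1 = 0 → ∃ s : W ⟶ K.X, s ≫ κ.1 = t) ∧
      (∀ {W : Comod C j} (t : W ⟶ M), t ≫ f = 0 → ∃ s : W ⟶ K, s ≫ κ = t) ∧
      ∀ {a : B} (G : 𝒞.abel.Hom a i) {W : 𝒞.abel.Hom a j} (t : W ⟶ M.X ⊚ G),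
        t ≫ f.1 ▷ G = 0 → ∃ s : W ⟶ K.X ⊚ G, s ≫ κ.1 ▷ G = t := by
  obtain ⟨K, κ, hκ, h0, hl, hw⟩ := BilaxTwoCategory.exists_kernel f.1
  -- The coaction restricts to the kernel because `κ ▷ C` still has the lifting property of a kernel
  -- of `f ▷ C`. Its axioms are checked after composing with whiskerings of `κ`, which remain mono.
  obtain ⟨ρ, hρ⟩ := hw C.X (κ ≫ M.ρ) (by
    rw [Category.assoc, ← hom_w f, reassoc_of% h0, zero_comp])
  have m₁ := mono_whiskerRight κ C.X
  have m₂ := mono_whiskerRight κ (C.X ⊚ C.X)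
  have m₃ := mono_whiskerRight κ (𝒞.abel.oplax i).I
  let K' : Comod C j :=
    { X := K
      ρ := ρ
      coassoc := by
        rw [← cancel_mono (κ ▷ (C.X ⊚ C.X))]
        simp only [Category.assoc]
        rw [𝒞.abel.whisker_exchange, reassoc_of% hρ, ← M.coassoc,
          ← 𝒞.abel.associator_naturality_left, ← reassoc_of% 𝒞.abel.comp_whiskerRight, hρ,
          𝒞.abel.comp_whiskerRight, Category.assoc, reassoc_of% hρ]
      counit := by
        rw [← cancel_mono (κ ▷ (𝒞.abel.oplax i).I), Category.assoc, 𝒞.abel.whisker_exchange,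
          reassoc_of% hρ, M.counit, (𝒞.abel.oplax i).r_naturality] }
  refine ⟨K', homMk (M := K') κ hρ.symm, hκ, Subtype.ext h0, hl, fun {W} t ht => ?_, hw⟩
  obtain ⟨s, hs⟩ := hl t.1 (congrArg Subtype.val ht)
  refine ⟨homMk (N := K') s ?_, Subtype.ext hs⟩
  change s ≫ ρ = _
  rw [← cancel_mono (κ ▷ C.X), Category.assoc, hρ, reassoc_of% hs, hom_w t, Category.assoc,
    ← 𝒞.abel.comp_whiskerRight, hs]

/-- The kernel of the underlying 2-morphism is itself a comodule, so it is killed by monicity among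
comodules. -/
theorem mono_val {M N : Comod C j} (f : M ⟶ N) [Mono f] : Mono f.1 := by
  obtain ⟨K, κ, -, h0, hl, -⟩ := exists_kernel f
  have h : κ = 0 := by rw [← cancel_mono f, h0, zero_comp]
  refine Preadditive.mono_of_cancel_zero _ fun {W} t ht => ?_
  obtain ⟨s, rfl⟩ := hl t ht
  rw [h]
  exact comp_zero

/-- Every comodule embeds into a free comodule on a 1-morphism of `𝒞`. -/
theorem exists_mono_free (S : 𝒞.WeaklyFiax) (M : Comod C j) :
    ∃ (F : 𝒞.Hom i j) (f : M ⟶ actObj (ι F) C.regular), Mono f := by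
  obtain ⟨F, f, hf⟩ := exists_mono_ι M.X
  have := S.mono_oplax_r M.X
  have := M.mono_coact_val
  have : Mono (freeMap C f).1 := mono_whiskerRight f C.X
  have : Mono (M.coact ≫ freeMap C f).1 := mono_comp M.coact.1 (freeMap C f).1
  exact ⟨F, _, mono_of_mono_val (M.coact ≫ freeMap C f)⟩

theorem injective_free (S : 𝒞.WeaklyFiax) (F : 𝒞.Hom i j) :
    Injective (actObj (ι F) C.regular) where
  factors {M N} f m hm := by
    have := mono_val m
    -- `F I'` is a 1-morphism of `𝒞`, hence injective in the abelianization.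
    obtain ⟨g, hg⟩ := exists_ι_extension m.1 (F := F ⊚ (𝒞.oplax i).I) (f.1 ≫ ι F ◁ C.ε)
    exact ⟨_, comp_extension (S.adj F).ι m f g hg⟩

end
end Comod

theorem _root_.addClosure_of {A : Type*} [Category A] [Preadditive A] {S : ObjectProperty A}
    {M X : A} (hX : S X) (a : M ⟶ X) (b : X ⟶ M) (h : a ≫ b = 𝟙 M) : addClosure S M :=
  ⟨1, fun _ => X, fun _ => a, fun _ => b, fun _ => hX, by simpa using h⟩

theorem _root_.injective_of_addClosure {A : Type*} [Category A] [Preadditive A]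
    {S : ObjectProperty A} (hS : ∀ X, S X → Injective X) {M : A} (hM : addClosure S M) :
    Injective M where
  factors {X Y} f m hm := by
    obtain ⟨n, Z, a, b, hZ, e⟩ := hM
    choose g hg using fun t => (hS _ (hZ t)).factors (f ≫ a t) m
    refine ⟨∑ t, g t ≫ b t, ?_⟩
    simp only [Preadditive.comp_sum, reassoc_of% hg]
    rw [← Preadditive.comp_sum, e, Category.comp_id]

section
variable {k : Type*} [Field k] {B : Type w} {𝒞 : BilaxTwoCategory.{w, v, u} k B} {i j m : B}
  (C : 𝒞.abel.Coalgebra i)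

theorem exists_retract_free (S : 𝒞.WeaklyFiax) (M : Comod C j) [Injective M] :
    ∃ (F : 𝒞.Hom i j) (a : M ⟶ Comod.actObj (ι F) C.regular)
      (b : Comod.actObj (ι F) C.regular ⟶ M), a ≫ b = 𝟙 M := by
  obtain ⟨F, f, hf⟩ := Comod.exists_mono_free S M
  exact ⟨F, f, Injective.factorThru (𝟙 M) f, Injective.comp_factorThru _ _⟩

/-- An injective splits off from the free comodule it embeds into; conversely sums and summands of
injectives are injective. -/
theorem injective_iff_addClosure (S : 𝒞.WeaklyFiax) (M : Comod C j) :
    Injective M ↔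
      addClosure (fun Y : Comod C j => ∃ F : 𝒞.Hom i j, Y = Comod.actObj (ι F) C.regular) M := by
  constructor
  · intro _
    obtain ⟨F, a, b, h⟩ := exists_retract_free C S M
    exact addClosure_of ⟨F, rfl⟩ a b h
  · refine fun h => injective_of_addClosure ?_ h
    rintro _ ⟨F, rfl⟩
    exact Comod.injective_free S F

end

end BilaxTwoCategory

/-! ### Condition 1: subrepresentations with the same objects. -/

namespace BilaxRep

section
variable {k : Type*} [Field k] {B : Type w} {𝒞 : BilaxTwoCategory.{w, v, u} k B}

theorem equivalent_refl (M : BilaxRep.{w, v, u, v₁, u₁} 𝒞) : M.Equivalent M :=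
  ⟨{ Φ := fun i => 𝟭 (M.Obj i)
     additive := fun _ => inferInstance
     linear := fun _ => inferInstance
     φ := fun F => Iso.refl (M.act F)
     φ_naturality := fun f X => by simp
     φ_comp := fun G F X => by simp
     φ_u := fun i X => by simp
     φ_u' := fun i X => by simp }, fun i => (inferInstance : (𝟭 (M.Obj i)).IsEquivalence)⟩

theorem sub_equivalent_sub (M : BilaxRep.{w, v, u, v₁, u₁} 𝒞)
    (P Q : ∀ i, ObjectProperty (M.Obj i))
    (hP : ∀ {i j : B} (F : 𝒞.Hom i j) (X : M.Obj i), P i X → P j ((M.act F).obj X))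
    (h : ∀ i X, P i X ↔ Q i X) : (M.sub P hP).Equivalent
      (M.sub Q fun F X hX => (h _ _).1 (hP F X ((h _ _).2 hX))) := by
  -- Once the properties coincide, the stability proofs agree by proof irrelevance and the identity
  -- is an equivalence.
  obtain rfl : P = Q := funext fun i => funext fun X => propext (h i X)
  exact equivalent_refl _

end

end BilaxRep

namespace BilaxTwoCategory

theorem injRep_equivalent_genRep {k : Type*} [Field k] {B : Type w}
    {𝒞 : BilaxTwoCategory.{w, v, u} k B} {i : B} (S : 𝒞.WeaklyFiax) (C : 𝒞.abel.Coalgebra i) :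
    (injRep S C).Equivalent (genRep C) :=
  BilaxRep.sub_equivalent_sub _ _ _ (fun F X hX => BilaxRep.act_injective _ S F X hX)
    fun _ M => injective_iff_addClosure C S M

end BilaxTwoCategory

/-! ### Krull–Schmidt arguments and criteria for finitary categories. -/

/-- Fitting's lemma for a finite-dimensional algebra without nontrivial idempotents. -/
theorem isUnit_or_isNilpotent_of_idempotents (k : Type*) {E : Type*} [Field k] [Ring E]
    [Algebra k E] [FiniteDimensional k E] (hE : ∀ e : E, e * e = e → e = 0 ∨ e = 1) (a : E) :
    IsUnit a ∨ IsNilpotent a := by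
  have hint : IsIntegral k a := Algebra.IsIntegral.isIntegral a
  -- The minimal polynomial is a power of `X` times a factor `q` coprime to `X`. If the power is
  -- trivial, coprimality inverts `a`.
  obtain ⟨q, hq, hX⟩ := Polynomial.exists_eq_pow_rootMultiplicity_mul_and_not_dvd (minpoly k a)
    (minpoly.ne_zero hint) 0
  rw [map_zero, sub_zero] at hq hX
  have hcop : IsCoprime Polynomial.X q :=
    (Polynomial.irreducible_X.coprime_iff_not_dvd).2 hX
  have h₀ := minpoly.aeval k a
  have unit_of : ∀ u : Polynomial k, Polynomial.aeval a (u * Polynomial.X) = 1 → IsUnit a := by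
    intro u hu
    have hu' := hu
    rw [mul_comm] at hu'
    rw [map_mul, Polynomial.aeval_X] at hu hu'
    exact ⟨⟨a, Polynomial.aeval a u, hu', hu⟩, rfl⟩
  rcases Nat.eq_zero_or_pos ((minpoly k a).rootMultiplicity 0) with hn | hn
  · obtain ⟨u, v, huv⟩ := hcop
    refine .inl (unit_of u ?_)
    rw [hn, pow_zero, one_mul] at hq
    have := congrArg (Polynomial.aeval a) huv
    rwa [map_add, map_mul _ v, ← hq, h₀, mul_zero, add_zero, map_one] at this
  · obtain ⟨n, hn⟩ := Nat.exists_eq_add_of_le' hn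
    rw [hn] at hq
    obtain ⟨u, v, huv⟩ := hcop.pow_left (m := n + 1)
    have h₁ := congrArg (Polynomial.aeval a) huv
    rw [map_add, map_one] at h₁
    have h₂ : ∀ t, Polynomial.aeval a (t * minpoly k a) = 0 := fun t => by
      rw [map_mul, h₀, mul_zero]
    -- With `u X^(n+1) + v q = 1`, the value of `u X^(n+1)` at `a` is idempotent. If it is `0`, then
    -- `v q` takes the value `1`, so `a^(n+1)` is a multiple of the minimal polynomial at `a` and
    -- vanishes; if it is `1`, then `a` is invertible.
    rcases hE (Polynomial.aeval a (u * Polynomial.X ^ (n + 1))) (by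
      rw [← map_mul, ← sub_eq_zero, ← map_sub, ← neg_eq_zero, ← map_neg, ← h₂ (u * v)]
      congr 1
      rw [hq]
      linear_combination -(u * Polynomial.X ^ (n + 1)) * huv) with he | he
    · refine .inr ⟨n + 1, ?_⟩
      rw [he, zero_add] at h₁
      have := h₂ v
      rw [hq, show v * (Polynomial.X ^ (n + 1) * q) = Polynomial.X ^ (n + 1) * (v * q) by ring,
        map_mul, h₁, mul_one] at this
      simpa using this
    · exact .inl (unit_of (u * Polynomial.X ^ n) (by rw [← he]; congr 1; ring))

section
variable {E : Type*} [Ring E]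

/-- After normalizing the sum to `1`, one has `b = 1 - a`, a unit when `a` is nilpotent. -/
theorem isUnit_or_isUnit_of_isUnit_add (hE : ∀ a : E, IsUnit a ∨ IsNilpotent a) {a b : E}
    (h : IsUnit (a + b)) : IsUnit a ∨ IsUnit b := by
  obtain ⟨u, hu⟩ := h
  rcases hE (↑u⁻¹ * a) with h | h
  · exact .inl ((Units.isUnit_units_mul _ _).1 h)
  · refine .inr ((Units.isUnit_units_mul u⁻¹ _).1 ?_)
    have e : (↑u⁻¹ : E) * b = 1 - ↑u⁻¹ * a := by
      rw [eq_sub_iff_add_eq, ← mul_add, add_comm b, ← hu, Units.inv_mul]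
    rw [e]
    exact h.isUnit_one_sub

theorem exists_isUnit_of_isUnit_sum [Nontrivial E] (hE : ∀ a : E, IsUnit a ∨ IsNilpotent a)
    {ι : Type*} (s : Finset ι) (f : ι → E) (h : IsUnit (∑ i ∈ s, f i)) :
    ∃ i ∈ s, IsUnit (f i) := by
  classical
  induction s using Finset.induction_on with
  | empty => simp at h
  | insert i s hi ih =>
    rw [Finset.sum_insert hi] at h
    rcases isUnit_or_isUnit_of_isUnit_add hE h with h | h
    · exact ⟨i, Finset.mem_insert_self _ _, h⟩
    · obtain ⟨j, hj, h⟩ := ih h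
      exact ⟨j, Finset.mem_insert_of_mem hj, h⟩

end

section
variable {A : Type*} [Category A] [Preadditive A]

theorem addClosure_of_fintype {S : ObjectProperty A} {ι : Type*} [Fintype ι] {M : A} (X : ι → A)
    (a : ∀ t, M ⟶ X t) (b : ∀ t, X t ⟶ M) (hX : ∀ t, S (X t)) (h : ∑ t, a t ≫ b t = 𝟙 M) :
    addClosure S M := by
  let e := (Fintype.equivFin ι).symm
  refine ⟨_, fun t => X (e t), fun t => a (e t), fun t => b (e t), fun t => hX _, ?_⟩
  rw [← h]
  exact Equiv.sum_comp e fun t => a t ≫ b t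

/-- Two layers of decompositions are combined by summing over pairs of indices. -/
theorem addClosure_le {S T : ObjectProperty A} (hST : ∀ X, S X → addClosure T X) {M : A}
    (hM : addClosure S M) : addClosure T M := by
  obtain ⟨n, X, a, b, hX, h⟩ := hM
  choose m Y a' b' hY h' using fun t => hST _ (hX t)
  refine addClosure_of_fintype (ι := Σ t, Fin (m t)) (fun s => Y s.1 s.2)
    (fun s => a s.1 ≫ a' s.1 s.2) (fun s => b' s.1 s.2 ≫ b s.1) (fun s => hY _ _) ?_
  rw [Fintype.sum_sigma, ← h]
  refine Finset.sum_congr rfl fun t _ => ?_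
  have := congrArg (fun z => a t ≫ z ≫ b t) (h' t)
  simpa [Preadditive.sum_comp, Preadditive.comp_sum] using this

theorem IsIndecomposableObj.not_isZero {X : A} (h : IsIndecomposableObj X) : ¬ IsZero X :=
  h.choose_spec.1

/-- Indecomposable objects of idempotent complete categories have no nontrivial idempotents. -/
theorem IsIndecomposableObj.idempotent_eq [IsIdempotentComplete A] {X : A}
    (h : IsIndecomposableObj X) (e : X ⟶ X) (he : e ≫ e = e) : e = 0 ∨ e = 𝟙 X := by
  obtain ⟨_, -, h⟩ := h
  -- Splitting `e` and `𝟙 - e` writes `X` as a biproduct, one factor of which must vanish.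
  obtain ⟨Y, i, p, hip, hpi⟩ := IsIdempotentComplete.idempotents_split X e he
  obtain ⟨Z, i', p', hip', hpi'⟩ := IsIdempotentComplete.idempotents_split X (𝟙 X - e)
    (by simp [he])
  have h₁ : i ≫ p' = 0 := by
    have : (i ≫ p ≫ i) ≫ (p' ≫ i') ≫ p' = 0 := by
      rw [hpi', hpi]; simp [reassoc_of% he]
    simpa [reassoc_of% hip, hip'] using this
  have h₂ : i' ≫ p = 0 := by
    have : (i' ≫ p' ≫ i') ≫ (p ≫ i) ≫ p = 0 := by
      rw [hpi', hpi]; simp [reassoc_of% he]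
    simpa [reassoc_of% hip', hip] using this
  rcases h Y Z
    { hom := biprod.lift p p'
      inv := biprod.desc i i'
      hom_inv_id := by rw [biprod.lift_desc, hpi, hpi', add_sub_cancel]
      inv_hom_id := by ext <;> simp [*] } with hY | hZ
  · exact .inl (by rw [← hpi, hY.eq_of_src i 0, comp_zero])
  · exact .inr (by rw [eq_comm, ← sub_eq_zero, ← hpi', hZ.eq_of_src i' 0, comp_zero])

variable {k : Type*} [Field k] [Linear k A]

/-- An indecomposable direct summand of a finite direct sum is a summand of one of its terms. -/
theorem IsIndecomposableObj.exists_retract [IsIdempotentComplete A] {S : ObjectProperty A} {X : A}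
    [FiniteDimensional k (X ⟶ X)] (h : IsIndecomposableObj X) (hX : addClosure S X) :
    ∃ (Y : A) (a : X ⟶ Y) (b : Y ⟶ X), S Y ∧ a ≫ b = 𝟙 X := by
  obtain ⟨n, Y, a, b, hY, e⟩ := hX
  have : FiniteDimensional k (End X) := ‹FiniteDimensional k (X ⟶ X)›
  have : Nontrivial (End X) := ⟨0, 1, fun h0 => h.not_isZero ((IsZero.iff_id_eq_zero X).2 h0.symm)⟩
  obtain ⟨t, -, ht⟩ := exists_isUnit_of_isUnit_sum (E := End X)
    (isUnit_or_isNilpotent_of_idempotents k fun e he => h.idempotent_eq e he) Finset.univ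
    (fun t => a t ≫ b t) (by
      have : ∑ t, a t ≫ b t = (1 : End X) := e
      rw [this]; exact isUnit_one)
  have hi : IsIso (a t ≫ b t) := (isUnit_iff_isIso _).1 ht
  exact ⟨Y t, a t, b t ≫ inv (a t ≫ b t), hY t, by rw [← Category.assoc, IsIso.hom_inv_id]⟩

/-- The idempotent `b ≫ a` of `Y` is `0` or `1`, and `0` would force `X` to vanish. -/
theorem IsIndecomposableObj.iso_of_retract [IsIdempotentComplete A] {X Y : A}
    (hX : IsIndecomposableObj X) (hY : IsIndecomposableObj Y) (a : X ⟶ Y) (b : Y ⟶ X)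
    (h : a ≫ b = 𝟙 X) : Nonempty (X ≅ Y) := by
  rcases hY.idempotent_eq (b ≫ a) (by rw [Category.assoc, reassoc_of% h]) with h0 | h1
  · refine absurd ((IsZero.iff_id_eq_zero X).2 ?_) hX.not_isZero
    rw [← h, ← Category.comp_id b, ← h, reassoc_of% h0, zero_comp, comp_zero]
  · exact ⟨⟨a, b, h, h1⟩⟩

/-- Objects with finite-dimensional endomorphism algebras decompose into indecomposables. -/
theorem addClosure_indecomposable [HasBinaryBiproducts A]
    (hA : ∀ X : A, FiniteDimensional k (X ⟶ X)) (X : A) :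
    addClosure (IsIndecomposableObj (A := A)) X := by
  induction hd : Module.finrank k (X ⟶ X) using Nat.strong_induction_on generalizing X with
  | _ d ih =>
    by_cases h0 : IsZero X
    · exact ⟨0, Fin.elim0, fun t => t.elim0, fun t => t.elim0, fun t => t.elim0, h0.eq_of_src _ _⟩
    by_cases hX : IsIndecomposableObj X
    · exact addClosure_of hX (𝟙 X) (𝟙 X) (Category.comp_id _)
    have : ∃ (Y Z : A) (_ : X ≅ Y ⊞ Z), ¬ IsZero Y ∧ ¬ IsZero Z := by
      by_contra! hc
      refine hX ⟨inferInstance, h0, fun Y Z e => or_iff_not_imp_left.2 fun hY => hc Y Z e hY⟩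
    obtain ⟨Y, Z, e, hY, hZ⟩ := this
    have key : ∀ {Y Z : A} (i : Y ⟶ X) (p : X ⟶ Y) (i' : Z ⟶ X) (p' : X ⟶ Z), i ≫ p = 𝟙 Y →
        i' ≫ p' = 𝟙 Z → i ≫ p' = 0 → i' ≫ p = 0 → ¬ IsZero Z →
        addClosure (IsIndecomposableObj (A := A)) Y := by
      intro Y Z i p i' p' h₁ h₂ h₃ h₄ hZ
      refine ih _ ?_ Y rfl
      rw [← hd]
      -- Extension by zero embeds `End Y` into `End X`. It misses the identity when the complement
      -- `Z` is nonzero, so the dimension drops and the induction applies.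
      let f : (Y ⟶ Y) →ₗ[k] (X ⟶ X) :=
        (Linear.rightComp k X i).comp (Linear.leftComp k Y p)
      have hf : ∀ g, f g = (p ≫ g) ≫ i := fun g => rfl
      have hinj : Function.Injective f := by
        intro g g' hg
        rw [hf, hf] at hg
        have := congrArg (fun t => i ≫ t ≫ p) hg
        simpa [reassoc_of% h₁, h₁] using this
      have := hA X
      have hlt : LinearMap.range f < ⊤ := by
        refine lt_top_iff_ne_top.2 fun ht => hZ ((IsZero.iff_id_eq_zero Z).2 ?_)
        obtain ⟨g, hg⟩ : 𝟙 X ∈ LinearMap.range f := ht ▸ Submodule.mem_top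
        rw [← h₂, ← Category.id_comp p', ← hg, hf, Category.assoc, h₃]
        simp
      rw [← LinearMap.finrank_range_of_inj hinj]
      exact Submodule.finrank_lt hlt.ne
    have hY' := key (biprod.inl ≫ e.inv) (e.hom ≫ biprod.fst) (biprod.inr ≫ e.inv)
      (e.hom ≫ biprod.snd) (by simp) (by simp) (by simp) (by simp) hZ
    have hZ' := key (biprod.inr ≫ e.inv) (e.hom ≫ biprod.snd) (biprod.inl ≫ e.inv)
      (e.hom ≫ biprod.fst) (by simp) (by simp) (by simp) (by simp) hY
    refine addClosure_le (S := addClosure (IsIndecomposableObj (A := A))) (fun _ h => h)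
      ⟨2, ![Y, Z], Fin.cons (e.hom ≫ biprod.fst) (Fin.cons (e.hom ≫ biprod.snd) fun t => t.elim0),
        Fin.cons (biprod.inl ≫ e.inv) (Fin.cons (biprod.inr ≫ e.inv) fun t => t.elim0),
        fun t => ?_, ?_⟩
    · fin_cases t
      · exact hY'
      · exact hZ'
    · have : e.hom ≫ (biprod.fst ≫ biprod.inl + biprod.snd ≫ biprod.inr) ≫ e.inv = 𝟙 X := by
        rw [biprod.total]; simp
      rw [Fin.sum_univ_two]
      change (e.hom ≫ biprod.fst) ≫ biprod.inl ≫ e.inv +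
        (e.hom ≫ biprod.snd) ≫ biprod.inr ≫ e.inv = 𝟙 X
      rw [← this]
      simp only [Preadditive.add_comp, Preadditive.comp_add, Category.assoc]

/-- A category generated by finitely many objects has finitely many indecomposables. -/
theorem finite_indecomposables_of_addClosure [HasBinaryBiproducts A] [IsIdempotentComplete A]
    (hA : ∀ X : A, FiniteDimensional k (X ⟶ X)) {n : ℕ} (G : Fin n → A)
    (hG : ∀ X : A, addClosure (fun Y => ∃ t, Y = G t) X) :
    ∃ (n : ℕ) (X : Fin n → A), ∀ Y : A, IsIndecomposableObj Y → ∃ t, Nonempty (Y ≅ X t) := by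
  choose m Y a b hY h using fun t => addClosure_indecomposable hA (G t)
  let e := (Fintype.equivFin (Σ t, Fin (m t)))
  refine ⟨_, fun t => Y (e.symm t).1 (e.symm t).2, fun X hX => ?_⟩
  have hX' : addClosure (fun Z => ∃ s : Σ t, Fin (m t), Z = Y s.1 s.2) X :=
    addClosure_le (by
      rintro _ ⟨t, rfl⟩
      exact ⟨m t, Y t, a t, b t, fun u => ⟨⟨t, u⟩, rfl⟩, h t⟩) (hG X)
  obtain ⟨_, f, g, ⟨s, rfl⟩, hfg⟩ := hX.exists_retract (k := k) hX'
  refine ⟨e s, ?_⟩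
  change Nonempty (X ≅ Y (e.symm (e s)).1 (e.symm (e s)).2)
  rw [e.symm_apply_apply]
  exact hX.iso_of_retract (hY _ _) f g hfg

end

section
variable {A A' : Type*} [Category A] [Preadditive A] [Category A'] [Preadditive A']

/-- If `X` and `Y` are retracts of `G F` and `G F'`, their biproduct is cut out of `G (F ⊞ F')` by a
diagonal idempotent. -/
theorem hasFiniteBiproducts_of_retracts [HasFiniteBiproducts A'] [IsIdempotentComplete A]
    (G : A' ⥤ A) [G.Additive]
    (hG : ∀ X : A, ∃ (F : A') (a : X ⟶ G.obj F) (b : G.obj F ⟶ X), a ≫ b = 𝟙 X) :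
    HasFiniteBiproducts A := by
  have : HasBinaryBiproducts A' := hasBinaryBiproducts_of_finite_biproducts A'
  obtain ⟨Z, hZ⟩ := HasZeroObject.zero (C := A')
  have : HasBinaryBiproducts A := ⟨fun X Y => by
    obtain ⟨F, a, b, h⟩ := hG X
    obtain ⟨F', a', b', h'⟩ := hG Y
    have h₁ : G.map (biprod.inl : F ⟶ F ⊞ F') ≫ G.map biprod.fst = 𝟙 _ := by
      rw [← G.map_comp, biprod.inl_fst, G.map_id]
    have h₂ : G.map (biprod.inr : F' ⟶ F ⊞ F') ≫ G.map biprod.snd = 𝟙 _ := by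
      rw [← G.map_comp, biprod.inr_snd, G.map_id]
    have h₃ : G.map (biprod.inl : F ⟶ F ⊞ F') ≫ G.map biprod.snd = 0 := by
      rw [← G.map_comp, biprod.inl_snd, G.map_zero]
    have h₄ : G.map (biprod.inr : F' ⟶ F ⊞ F') ≫ G.map biprod.fst = 0 := by
      rw [← G.map_comp, biprod.inr_fst, G.map_zero]
    -- The sum of the idempotents `b ≫ a` and `b' ≫ a'` on the two factors; its image is `X ⊞ Y`.
    let e := G.map (biprod.fst : F ⊞ F' ⟶ F) ≫ b ≫ a ≫ G.map biprod.inl +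
      G.map (biprod.snd : F ⊞ F' ⟶ F') ≫ b' ≫ a' ≫ G.map biprod.inr
    obtain ⟨W, i, p, hip, hpi⟩ := IsIdempotentComplete.idempotents_split _ e (by
      simp [e, reassoc_of% h₁, reassoc_of% h₂, reassoc_of% h₃, reassoc_of% h₄, reassoc_of% h,
        reassoc_of% h'])
    refine hasBinaryBiproduct_of_total
      { pt := W
        fst := i ≫ G.map biprod.fst ≫ b
        snd := i ≫ G.map biprod.snd ≫ b'
        inl := a ≫ G.map biprod.inl ≫ p
        inr := a' ≫ G.map biprod.inr ≫ p
        inl_fst := by simp [reassoc_of% hpi, e, reassoc_of% h₁, reassoc_of% h₃, h]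
        inl_snd := by simp [reassoc_of% hpi, e, reassoc_of% h₃]
        inr_fst := by simp [reassoc_of% hpi, e, reassoc_of% h₄]
        inr_snd := by simp [reassoc_of% hpi, e, reassoc_of% h₂, reassoc_of% h₄, h'] } ?_
    have : i ≫ e ≫ p = 𝟙 W := by rw [← hpi, Category.assoc, hip, Category.comp_id, hip]
    rw [← this]
    simp [e]⟩
  have : HasZeroObject A := ⟨⟨G.obj Z, by
    rw [IsZero.iff_id_eq_zero, ← G.map_id, ← G.map_zero]
    exact congrArg _ (hZ.eq_of_src _ _)⟩⟩
  have : HasFiniteProducts A := hasFiniteProducts_of_has_binary_and_terminal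
  exact HasFiniteBiproducts.of_hasFiniteProducts

/-- The finitely many indecomposables of `A'` have images that generate `A` under sums and summands.
-/
theorem IsFinitaryCategory.of_retracts {k : Type*} [Field k] [Linear k A] [Linear k A']
    (hA' : IsFinitaryCategory k A') [IsIdempotentComplete A]
    (hA : ∀ X Y : A, FiniteDimensional k (X ⟶ Y)) (G : A' ⥤ A) [G.Additive]
    (hG : ∀ X : A, ∃ (F : A') (a : X ⟶ G.obj F) (b : G.obj F ⟶ X), a ≫ b = 𝟙 X) :
    IsFinitaryCategory k A := by
  have := hA'.hasFiniteBiproducts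
  have hA₀ := hasFiniteBiproducts_of_retracts G hG
  have : HasBinaryBiproducts A := hasBinaryBiproducts_of_finite_biproducts A
  have : HasBinaryBiproducts A' := hasBinaryBiproducts_of_finite_biproducts A'
  obtain ⟨n, X, hX⟩ := hA'.finite_indecomposables
  refine ⟨hA₀, inferInstance, hA, finite_indecomposables_of_addClosure (k := k)
    (fun X => hA X X) (fun t => G.obj (X t)) fun Y => ?_⟩
  obtain ⟨F, a, b, h⟩ := hG Y
  have hF := addClosure_indecomposable (k := k) (fun X => hA'.finiteDimensional X X) F
  refine addClosure_le (S := fun Z => Z = G.obj F) ?_ (addClosure_of rfl a b h)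
  rintro _ rfl
  exact addClosure_map G (fun Z hZ => by
    obtain ⟨t, ⟨i⟩⟩ := hX Z hZ
    exact ⟨_, ⟨t, rfl⟩, ⟨G.mapIso i⟩⟩) hF

theorem CategoryTheory.Injective.of_retract {X Y : A} (hX : Injective X) (a : Y ⟶ X) (b : X ⟶ Y)
    (h : a ≫ b = 𝟙 Y) : Injective Y :=
  injective_of_addClosure (S := fun Z => Z = X) (by rintro _ rfl; exact hX)
    (addClosure_of rfl a b h)

theorem isIdempotentComplete_injective [IsIdempotentComplete A] :
    IsIdempotentComplete (ObjectProperty.FullSubcategory fun X : A => Injective X) where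
  idempotents_split X p hp := by
    obtain ⟨Y, i, q, h₁, h₂⟩ :=
      IsIdempotentComplete.idempotents_split X.obj p.hom (congrArg (·.hom) hp)
    exact ⟨⟨Y, X.property.of_retract i q h₁⟩, ObjectProperty.homMk i, ObjectProperty.homMk q,
      ObjectProperty.hom_ext _ h₁, ObjectProperty.hom_ext _ h₂⟩

theorem finiteDimensional_fullSubcategory_hom {k : Type*} [Field k] [Linear k A]
    (P : ObjectProperty A) (X Y : P.FullSubcategory) [FiniteDimensional k (X.obj ⟶ Y.obj)] :
    FiniteDimensional k (X ⟶ Y) :=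
  FiniteDimensional.of_injective
    ({ toFun := fun f => f.hom, map_add' := fun _ _ => rfl, map_smul' := fun _ _ => rfl } :
      (X ⟶ Y) →ₗ[k] (X.obj ⟶ Y.obj)) fun _ _ h => ObjectProperty.hom_ext _ h

end

/-! ### Condition 3: finitarity and generation of the injective comodules. -/

namespace BilaxTwoCategory

section
variable {k : Type*} [Field k] {B : Type w} {𝒞 : BilaxTwoCategory.{w, v, u} k B} {i : B}
  (S : 𝒞.WeaklyFiax) (C : 𝒞.abel.Coalgebra i) (j : B)

instance Comod.isIdempotentComplete : IsIdempotentComplete (Comod C j) where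
  idempotents_split M p hp := by
    -- The image of an idempotent `p` is the kernel of `𝟙 - p`.
    obtain ⟨K, κ, hκ, h0, -, hl, -⟩ := exists_kernel (𝟙 M - p)
    obtain ⟨s, hs⟩ := hl p (by rw [Preadditive.comp_sub, hp, Category.comp_id, sub_self])
    have := mono_of_mono_val κ
    rw [Preadditive.comp_sub, Category.comp_id, sub_eq_zero] at h0
    exact ⟨K, κ, s, by rw [← cancel_mono κ, Category.assoc, hs, ← h0, Category.id_comp], hs⟩

theorem Comod.finiteDimensional_hom {C : 𝒞.abel.Coalgebra i} {j : B}
    (h𝒞 : ∀ X Y : 𝒞.Hom i j, FiniteDimensional k (X ⟶ Y)) (M N : Comod C j) :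
    FiniteDimensional k (M ⟶ N) := by
  have : FiniteDimensional k (M.X ⟶ N.X) :=
    Abel.finiteDimensional_hom (A := 𝒞.Hom i j) M.X N.X
  exact inferInstanceAs (FiniteDimensional k (homSub M N))

/-- The functor `F ↦ F ⊚ C` to injective comodules. -/
def freeFunctor : 𝒞.Hom i j ⥤ (injRep S C).Obj j where
  obj F := ⟨Comod.actObj (ι F) C.regular, Comod.injective_free S F⟩
  map f := ObjectProperty.homMk (Comod.freeMap C (ι₂ f))
  map_id F := ObjectProperty.hom_ext _ (Subtype.ext (𝒞.abel.id_whiskerRight (ι F) C.X))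
  map_comp f g := ObjectProperty.hom_ext _
    (Subtype.ext (𝒞.abel.comp_whiskerRight (ι₂ f) (ι₂ g) C.X))

instance : (freeFunctor S C j).Additive where
  map_add {_ _ f g} := ObjectProperty.hom_ext _
    (Subtype.ext (𝒞.abel.add_whiskerRight (ι₂ f) (ι₂ g) C.X))

theorem exists_retract_freeFunctor (X : (injRep S C).Obj j) :
    ∃ (F : 𝒞.Hom i j) (a : X ⟶ (freeFunctor S C j).obj F) (b : (freeFunctor S C j).obj F ⟶ X),
      a ≫ b = 𝟙 X := by
  obtain ⟨M, hM⟩ := X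
  have : @Injective (Comod C j) _ M := hM
  obtain ⟨F, a, b, h⟩ := exists_retract_free C S M
  exact ⟨F, ObjectProperty.homMk a, ObjectProperty.homMk b, ObjectProperty.hom_ext _ h⟩

theorem injRep_isFinitary (h𝒞 : 𝒞.IsFinitary) : (injRep S C).IsFinitary := fun j => by
  have h := isIdempotentComplete_injective (A := Comod C j)
  have : IsIdempotentComplete ((injRep S C).Obj j) := h
  have hfd (X Y : ObjectProperty.FullSubcategory fun M : Comod C j => Injective M) :
      FiniteDimensional k (X ⟶ Y) := by
    have : FiniteDimensional k (X.obj ⟶ Y.obj) :=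
      Comod.finiteDimensional_hom (h𝒞.hom_finitary i j).finiteDimensional X.obj Y.obj
    exact finiteDimensional_fullSubcategory_hom _ X Y
  exact (h𝒞.hom_finitary i j).of_retracts hfd (freeFunctor S C j)
    (exists_retract_freeFunctor S C j)

/-- `C` itself is not known to be injective, so `F C` is not visibly `F` applied to an object of
`inj-C`. It is, however, a retract of `F (I' C)`, and `I' C` is a free comodule on a 1-morphism of
`𝒞`. -/
theorem injRep_generated (X : (injRep S C).Obj j) : (injRep S C).generated j X := by
  obtain ⟨F, a, b, h⟩ := exists_retract_freeFunctor S C j X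
  let I' : (injRep S C).Obj i := (freeFunctor S C i).obj (𝒞.oplax i).I
  let f : (freeFunctor S C j).obj F ⟶ ((injRep S C).act F).obj I' :=
    ObjectProperty.homMk ((Comod.actFunctor (ι F)).map (((comodRep C).u' i).app C.regular))
  let g : ((injRep S C).act F).obj I' ⟶ (freeFunctor S C j).obj F :=
    ObjectProperty.homMk (Comod.retr (S.adj F).ι C.regular)
  have hfg : f ≫ g = 𝟙 _ := ObjectProperty.hom_ext _ (Comod.l_retr (S.adj F).ι C.regular)
  refine addClosure_of ⟨i, F, I', rfl⟩ (a ≫ f) (g ≫ b) ?_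
  rw [Category.assoc, reassoc_of% hfg, h]

end

end BilaxTwoCategory

/-! ### The functor `M ↦ M ⊚ G` from `C`-comodules to `F ⊚ C ⊚ G`-comodules. -/

namespace BilaxTwoCategory
namespace Comod

section
variable {k : Type*} [Field k] {B : Type w} {𝒟 : BilaxTwoCategory.{w, v, u} k B} {i j m n a b : B}
  {C : 𝒟.Coalgebra i} {F : 𝒟.Hom i j} {G : 𝒟.Hom j i}

theorem coassoc_at (M : Comod C m) (X : 𝒟.Hom a i) :
    M.ρ ▷ X ≫ (𝒟.associator _ _ _).hom ≫ M.ρ ▷ (C.X ⊚ X) ≫ (𝒟.associator _ _ _).hom =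
      M.ρ ▷ X ≫ (𝒟.associator _ _ _).hom ≫ M.X ◁ (C.Δ ▷ X ≫ (𝒟.associator _ _ _).hom) := by
  have h := congrArg (fun t => t ▷ X ≫ (𝒟.associator _ _ _).hom ≫ M.X ◁ (𝒟.associator _ _ _).hom)
    M.coassoc
  simp only [TwoSemicategory.comp_whiskerRight, Category.assoc] at h
  rw [𝒟.pentagon, reassoc_of% 𝒟.associator_naturality_left,
    reassoc_of% 𝒟.associator_naturality_middle, ← 𝒟.whiskerLeft_comp] at h
  exact h

theorem counit_at (M : Comod C m) (X : 𝒟.Hom a i) :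
    M.ρ ▷ X ≫ (𝒟.associator _ _ _).hom ≫ M.X ◁ C.ε ▷ X = M.X ◁ (𝒟.oplax i).l X := by
  rw [← 𝒟.associator_naturality_middle, ← Category.assoc, ← 𝒟.comp_whiskerRight, M.counit,
    (𝒟.oplax i).l_r]

/-- `M ⊚ X ⟶ M ⊚ C ⊚ X ⟶ M ⊚ G ⊚ F ⊚ C ⊚ X`: coact, then insert `α : I' ⟶ G ⊚ F`. -/
def cut (M : Comod C m) (α : (𝒟.oplax i).I ⟶ G ⊚ F) (X : 𝒟.Hom a i) :
    M.X ⊚ X ⟶ M.X ⊚ G ⊚ F ⊚ C.X ⊚ X :=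
  M.ρ ▷ X ≫ (𝒟.associator M.X C.X X).hom ≫ M.X ◁ 𝒟.unitAt α (C.X ⊚ X)

theorem cut_naturality (M : Comod C m) (α : (𝒟.oplax i).I ⟶ G ⊚ F) {X Y : 𝒟.Hom a i}
    (f : X ⟶ Y) : M.X ◁ f ≫ M.cut α Y = M.cut α X ≫ M.X ◁ G ◁ F ◁ C.X ◁ f := by
  simp only [cut, Category.assoc]
  rw [reassoc_of% 𝒟.whisker_exchange, reassoc_of% 𝒟.associator_naturality_right]
  simp only [← 𝒟.whiskerLeft_comp, unitAt_naturality]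

theorem cut_naturality_left {M N : Comod C m} (f : M ⟶ N) (α : (𝒟.oplax i).I ⟶ G ⊚ F)
    (X : 𝒟.Hom a i) : f.1 ▷ X ≫ N.cut α X = M.cut α X ≫ f.1 ▷ (G ⊚ F ⊚ C.X ⊚ X) := by
  simp only [cut, Category.assoc]
  rw [← reassoc_of% 𝒟.comp_whiskerRight, hom_w, 𝒟.comp_whiskerRight, Category.assoc,
    reassoc_of% 𝒟.associator_naturality_left, 𝒟.whisker_exchange]

theorem cut_comp (M : Comod C m) (α : (𝒟.oplax i).I ⟶ G ⊚ F) (X : 𝒟.Hom a i) (Y : 𝒟.Hom b a) :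
    M.cut α X ▷ Y ≫ (𝒟.associator _ _ _).hom ≫ M.X ◁ ((𝒟.associator _ _ _).hom ≫
        G ◁ ((𝒟.associator _ _ _).hom ≫ F ◁ (𝒟.associator _ _ _).hom)) =
      (𝒟.associator _ _ _).hom ≫ M.cut α (X ⊚ Y) := by
  simp only [cut, Category.assoc, TwoSemicategory.comp_whiskerRight]
  rw [← reassoc_of% 𝒟.associator_naturality_left, reassoc_of% 𝒟.associator_naturality_middle,
    ← 𝒟.whiskerLeft_comp, ← reassoc_of% 𝒟.pentagon, ← 𝒟.whiskerLeft_comp]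
  congr 4
  rw [unitAt_naturality, unitAt_comp α (C.X ⊚ X) Y]
  simp only [Category.assoc, 𝒟.whiskerLeft_comp]

/-- Coassociativity of the coaction on `M ⊚ G` in right-bracketed form: coassociativity of `M`, plus
naturality of the unit, which lets the two insertions of `α` commute. -/
theorem cut_cut (M : Comod C m) (α : (𝒟.oplax i).I ⟶ G ⊚ F) (X : 𝒟.Hom a i) :
    M.cut α X ≫ M.cut α (G ⊚ F ⊚ C.X ⊚ X) = M.cut α X ≫ M.X ◁ G ◁ F ◁ C.cut α X := by
  have h : M.ρ ▷ X ≫ (𝒟.associator _ _ _).hom ≫ M.cut α (C.X ⊚ X) =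
      M.ρ ▷ X ≫ (𝒟.associator _ _ _).hom ≫ M.X ◁ (C.Δ ▷ X ≫ (𝒟.associator _ _ _).hom) ≫
        M.X ◁ 𝒟.unitAt α (C.X ⊚ C.X ⊚ X) := by
    rw [cut, ← reassoc_of% M.coassoc_at X]
  have e : M.cut α X ≫ M.cut α (G ⊚ F ⊚ C.X ⊚ X) =
      M.ρ ▷ X ≫ (𝒟.associator _ _ _).hom ≫ M.cut α (C.X ⊚ X) ≫
        M.X ◁ G ◁ F ◁ C.X ◁ 𝒟.unitAt α (C.X ⊚ X) := by
    rw [← cut_naturality, cut, Category.assoc, Category.assoc]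
  rw [e, reassoc_of% h]
  simp only [cut, Coalgebra.cut, Category.assoc, ← 𝒟.whiskerLeft_comp]
  simp only [← unitAt_naturality, Category.assoc]

/-- This makes left action and right composition with `G` commute as operations on comodules. -/
theorem actObj_cut (K : 𝒟.Hom m n) (M : Comod C m) (α : (𝒟.oplax i).I ⟶ G ⊚ F)
    (X : 𝒟.Hom a i) :
    (actObj K M).cut α X = (𝒟.associator K M.X X).hom ≫ K ◁ M.cut α X ≫
      (𝒟.associator K M.X _).inv := by
  change (K ◁ M.ρ ≫ (𝒟.associator K M.X C.X).inv) ▷ X ≫ (𝒟.associator (K ⊚ M.X) C.X X).hom ≫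
    (K ⊚ M.X) ◁ 𝒟.unitAt α (C.X ⊚ X) = _
  rw [𝒟.comp_whiskerRight, Category.assoc, ← reassoc_of% TwoSemicategory.pentagon_hom_inv,
    TwoSemicategory.comp_whiskerLeft, Iso.inv_hom_id_assoc,
    reassoc_of% 𝒟.associator_naturality_middle, cut, 𝒟.whiskerLeft_comp, 𝒟.whiskerLeft_comp,
    Category.assoc, Category.assoc]

/-- The counit law for `M ⊚ G`. The counit of `C` absorbs the coaction of `M` into an oplax unitor,
the retraction cancels it, and the right triangle identity removes the inserted `α` against `β`. -/
theorem cut_whiskerLeft_conjε (M : Comod C m) (P : 𝒟.AdjointPair F G) :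
    M.cut P.α G ≫ M.X ◁ G ◁ C.conjε P = M.X ◁ (𝒟.oplax j).r G := by
  have t : 𝒟.unitAt P.α G ≫ G ◁ P.β ≫ G ◁ (𝒟.oplax j).l (𝒟.lax j).I ≫
      G ◁ (𝒟.lax j).r (𝒟.oplax j).I = (𝒟.oplax j).r G := by
    have := P.right_triangle
    rw [← (𝒟.oplax j).l_r, Category.assoc, (𝒟.lax j).r_comp, (𝒟.lax j).r_naturality, unitAt]
    simp only [Category.assoc]
    rw [reassoc_of% this]
  simp only [cut, Category.assoc, ← 𝒟.whiskerLeft_comp, Coalgebra.conjε]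
  rw [𝒟.whiskerLeft_comp G, ← reassoc_of% unitAt_naturality]
  rw [𝒟.whiskerLeft_comp M.X, reassoc_of% M.counit_at, ← 𝒟.whiskerLeft_comp]
  congr 1
  rw [reassoc_of% unitAt_naturality]
  simp only [← 𝒟.whiskerLeft_comp]
  rw [reassoc_of% P.l_retr]
  simp only [𝒟.whiskerLeft_comp]
  exact t

/-- For an adjoint pair `(F, G)` and a comodule `M` over `C`, the comodule `M ⊚ G` over
`F ⊚ C ⊚ G`. -/
def unconj (P : 𝒟.AdjointPair F G) (M : Comod C m) : Comod (C.conj P) m where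
  X := M.X ⊚ G
  ρ := M.cut P.α G ≫ (𝒟.associator M.X G (F ⊚ C.X ⊚ G)).inv
  coassoc := by
    change (M.cut P.α G ≫ (𝒟.associator M.X G (F ⊚ C.X ⊚ G)).inv) ≫
      (M.cut P.α G ≫ (𝒟.associator M.X G (F ⊚ C.X ⊚ G)).inv) ▷ (F ⊚ C.X ⊚ G) ≫
        (𝒟.associator _ _ _).hom = (M.cut P.α G ≫ (𝒟.associator M.X G (F ⊚ C.X ⊚ G)).inv) ≫
          (M.X ⊚ G) ◁ C.conjΔ P
    have h := M.cut_comp P.α G (F ⊚ C.X ⊚ G)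
    have h' : (assoc₄ F C.X G (F ⊚ C.X ⊚ G)).hom = (𝒟.associator _ _ _).hom ≫
      F ◁ (𝒟.associator _ _ _).hom := rfl
    rw [← h', 𝒟.whiskerLeft_comp] at h
    -- Both sides are compared after reassociating to the right, where the claim becomes `cut_cut`.
    rw [𝒟.comp_whiskerRight, Category.assoc, Category.assoc, Category.assoc,
      ← TwoSemicategory.pentagon_hom_inv, TwoSemicategory.comp_whiskerLeft, Iso.inv_hom_id_assoc,
      ← cancel_mono (𝒟.associator _ _ _).hom, ← cancel_mono (TwoSemicategory.whiskerLeftIso M.X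
        (TwoSemicategory.whiskerLeftIso G (assoc₄ F C.X G (F ⊚ C.X ⊚ G)))).hom]
    simp only [Category.assoc, Iso.inv_hom_id_assoc, TwoSemicategory.whiskerLeftIso_hom]
    rw [h, Iso.inv_hom_id_assoc, cut_cut, Coalgebra.conjΔ]
    simp only [← 𝒟.whiskerLeft_comp, Category.assoc, Iso.inv_hom_id, Category.comp_id]
  counit := by
    change (M.cut P.α G ≫ (𝒟.associator M.X G (F ⊚ C.X ⊚ G)).inv) ≫ (M.X ⊚ G) ◁ C.conjε P = _
    rw [TwoSemicategory.comp_whiskerLeft, Category.assoc, Iso.inv_hom_id_assoc,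
      reassoc_of% cut_whiskerLeft_conjε, Iso.comp_inv_eq, (𝒟.oplax j).r_comp]

/-- The functor `M ↦ M ⊚ G`. -/
def unconjFunctor (P : 𝒟.AdjointPair F G) : Comod C m ⥤ Comod (C.conj P) m where
  obj M := unconj P M
  map {M N} f := homMk (M := unconj P M) (N := unconj P N) (f.1 ▷ G) (by
    change f.1 ▷ G ≫ N.cut P.α G ≫ _ = (M.cut P.α G ≫ _) ≫ f.1 ▷ G ▷ (F ⊚ C.X ⊚ G)
    rw [reassoc_of% cut_naturality_left, TwoSemicategory.whiskerRight_comp]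
    simp)
  map_id M := Subtype.ext (𝒟.id_whiskerRight M.X G)
  map_comp f g := Subtype.ext (𝒟.comp_whiskerRight f.1 g.1 G)

instance unconjFunctor_additive (P : 𝒟.AdjointPair F G) :
    (unconjFunctor P : Comod C m ⥤ _).Additive where
  map_add := Subtype.ext (𝒟.add_whiskerRight _ _ G)

instance unconjFunctor_linear (P : 𝒟.AdjointPair F G) :
    (unconjFunctor P : Comod C m ⥤ _).Linear k where
  map_smul _ _ := Subtype.ext (𝒟.smul_whiskerRight _ _ G)

/-- The functors `M ↦ M ⊚ G` commute with the action. -/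
def actUnconjIso (P : 𝒟.AdjointPair F G) (K : 𝒟.Hom m n) (M : Comod C m) :
    actObj K (unconj P M) ≅ unconj P (actObj K M) :=
  isoMk (M := actObj K (unconj P M)) (N := unconj P (actObj K M)) (𝒟.associator K M.X G).symm (by
    change (𝒟.associator K M.X G).inv ≫ (actObj K M).cut P.α G ≫
      (𝒟.associator (K ⊚ M.X) G (F ⊚ C.X ⊚ G)).inv = (K ◁ (M.cut P.α G ≫
        (𝒟.associator M.X G (F ⊚ C.X ⊚ G)).inv) ≫ (𝒟.associator K (M.X ⊚ G) (F ⊚ C.X ⊚ G)).inv) ≫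
          (𝒟.associator K M.X G).inv ▷ (F ⊚ C.X ⊚ G)
    refine (congrArg (fun t : (K ⊚ M.X) ⊚ G ⟶ (K ⊚ M.X) ⊚ G ⊚ F ⊚ C.X ⊚ G =>
      (𝒟.associator K M.X G).inv ≫ t ≫ (𝒟.associator (K ⊚ M.X) G (F ⊚ C.X ⊚ G)).inv)
        (actObj_cut K M P.α G)).trans ?_
    rw [Category.assoc, Category.assoc, Iso.inv_hom_id_assoc, 𝒟.whiskerLeft_comp,
      Category.assoc, Category.assoc, TwoSemicategory.pentagon_inv])

/-- The bilax 2-natural transformation given by `M ↦ M ⊚ G`. -/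
def unconjTrans (C : 𝒟.Coalgebra i) (P : 𝒟.AdjointPair F G) :
    BilaxRep.BilaxTrans (comodRep C) (comodRep (C.conj P)) where
  Φ m := unconjFunctor P
  additive m := unconjFunctor_additive P
  linear m := unconjFunctor_linear P
  φ K := NatIso.ofComponents (fun M => actUnconjIso P K M) fun {M N} f => Subtype.ext (by
    change K ◁ f.1 ▷ G ≫ (𝒟.associator K N.X G).inv =
      (𝒟.associator K M.X G).inv ≫ (K ◁ f.1) ▷ G
    rw [TwoSemicategory.whisker_assoc, Iso.inv_hom_id_assoc])
  φ_naturality {m n K K'} f M := Subtype.ext (by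
    change f ▷ (M.X ⊚ G) ≫ (𝒟.associator K' M.X G).inv =
      (𝒟.associator K M.X G).inv ≫ f ▷ M.X ▷ G
    rw [TwoSemicategory.whiskerRight_comp]
    simp)
  φ_comp {m n p} L K M := Subtype.ext (by
    change (𝒟.associator (L ⊚ K) M.X G).inv ≫ (𝒟.associator L K M.X).hom ▷ G =
      (𝒟.associator L K (M.X ⊚ G)).hom ≫ L ◁ (𝒟.associator K M.X G).inv ≫
        (𝒟.associator L (K ⊚ M.X) G).inv
    rw [Iso.inv_comp_eq, ← reassoc_of% 𝒟.pentagon,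
      reassoc_of% TwoSemicategory.whiskerLeft_hom_inv, Iso.hom_inv_id, Category.comp_id])
  φ_u m M := Subtype.ext (by
    change (𝒟.associator (𝒟.lax m).I M.X G).inv ≫ (𝒟.lax m).l M.X ▷ G = (𝒟.lax m).l (M.X ⊚ G)
    rw [← (𝒟.lax m).l_comp, Iso.inv_hom_id_assoc])
  φ_u' m M := Subtype.ext (by
    change (𝒟.oplax m).l (M.X ⊚ G) ≫ (𝒟.associator (𝒟.oplax m).I M.X G).inv =
      (𝒟.oplax m).l M.X ▷ G
    rw [← (𝒟.oplax m).l_comp, Category.assoc, Iso.hom_inv_id, Category.comp_id])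

end
end Comod
end BilaxTwoCategory

/-! ### Tools for descent: insertion of units, split coactions and the cobar map. -/

namespace BilaxTwoCategory
namespace Comod

section
variable {k : Type*} [Field k] {B : Type w} {𝒟 : BilaxTwoCategory.{w, v, u} k B} {i j m n a b : B}
  {C : 𝒟.Coalgebra i} {F : 𝒟.Hom i j} {G : 𝒟.Hom j i}

/-- `M ⟶ M ⊚ C ⟶ M ⊚ G ⊚ F ⊚ C`: coact, then insert `α : I' ⟶ G ⊚ F`. -/
def insert (M : Comod C m) (α : (𝒟.oplax i).I ⟶ G ⊚ F) : M.X ⟶ M.X ⊚ G ⊚ F ⊚ C.X :=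
  M.ρ ≫ M.X ◁ 𝒟.unitAt α C.X

/-- The reassociation `(X ⊚ G ⊚ F ⊚ Y) ⊚ Z ≅ X ⊚ G ⊚ F ⊚ Y ⊚ Z`. -/
def assoc₅ {p q r s t o : B} (X : 𝒟.Hom s t) (G : 𝒟.Hom r s) (F : 𝒟.Hom q r) (Y : 𝒟.Hom p q)
    (Z : 𝒟.Hom o p) : (X ⊚ G ⊚ F ⊚ Y) ⊚ Z ≅ X ⊚ G ⊚ F ⊚ Y ⊚ Z :=
  𝒟.associator X (G ⊚ F ⊚ Y) Z ≪≫ TwoSemicategory.whiskerLeftIso X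
    (𝒟.associator G (F ⊚ Y) Z ≪≫ TwoSemicategory.whiskerLeftIso G (𝒟.associator F Y Z))

/-- For `Z = G` this identifies the coaction of `M ⊚ G`, up to bracketing, with an insertion
whiskered by `G`. -/
theorem insert_whiskerRight (M : Comod C m) (α : (𝒟.oplax i).I ⟶ G ⊚ F) (Z : 𝒟.Hom a i) :
    M.insert α ▷ Z ≫ (assoc₅ M.X G F C.X Z).hom = M.cut α Z := by
  simp only [insert, assoc₅, cut, 𝒟.comp_whiskerRight, Category.assoc, Iso.trans_hom,
    TwoSemicategory.whiskerLeftIso_hom]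
  rw [reassoc_of% 𝒟.associator_naturality_middle, ← 𝒟.whiskerLeft_comp, unitAt_comp]

theorem assoc₅_hom_inv {p q r s t o : B} (X : 𝒟.Hom s t) (G : 𝒟.Hom r s) (F : 𝒟.Hom q r)
    (Y : 𝒟.Hom p q) (Z : 𝒟.Hom o p) :
    (assoc₅ X G F Y Z).hom ≫ (𝒟.associator X G (F ⊚ Y ⊚ Z)).inv =
      (𝒟.associator X G (F ⊚ Y)).inv ▷ Z ≫ (𝒟.associator (X ⊚ G) (F ⊚ Y) Z).hom ≫
        (X ⊚ G) ◁ (𝒟.associator F Y Z).hom := by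
  simp only [assoc₅, 𝒟.whiskerLeft_comp, Category.assoc, Iso.trans_hom,
    TwoSemicategory.whiskerLeftIso_hom]
  rw [← reassoc_of% TwoSemicategory.pentagon_hom_inv, TwoSemicategory.comp_whiskerLeft,
    Iso.inv_hom_id_assoc]

/-- The homomorphisms `M ⊚ G ⟶ N ⊚ G` induce morphisms `M ⊚ G ⊚ Y ⟶ N ⊚ G ⊚ Y`. -/
def extend {X X' : 𝒟.Hom i m} (g : X ⊚ G ⟶ X' ⊚ G) (Y : 𝒟.Hom a j) :
    X ⊚ G ⊚ Y ⟶ X' ⊚ G ⊚ Y :=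
  (𝒟.associator X G Y).inv ≫ g ▷ Y ≫ (𝒟.associator X' G Y).hom

theorem extend_whiskerRight {X : 𝒟.Hom i m} {X' : 𝒟.Hom i m} (f : X ⟶ X') (Y : 𝒟.Hom a j) :
    extend (f ▷ G) Y = f ▷ (G ⊚ Y) :=
  (TwoSemicategory.whiskerRight_comp f G Y).symm

/-- This is the colinearity of `g`, read through `insert_whiskerRight`. It is the relation from
which a preimage of `g` under `M ↦ M ⊚ G` is later extracted. -/
theorem insert_extend (P : 𝒟.AdjointPair F G) {M N : Comod C m} (g : unconj P M ⟶ unconj P N) :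
    (M.insert P.α ≫ extend (X := M.X) (X' := N.X) g.1 (F ⊚ C.X)) ▷ G =
      g.1 ≫ N.insert P.α ▷ G := by
  obtain ⟨g, hg⟩ := g
  change M.X ⊚ G ⟶ N.X ⊚ G at g
  replace hg : g ≫ N.cut P.α G ≫ (𝒟.associator N.X G (F ⊚ C.X ⊚ G)).inv =
    (M.cut P.α G ≫ (𝒟.associator M.X G (F ⊚ C.X ⊚ G)).inv) ≫ g ▷ (F ⊚ C.X ⊚ G) := hg
  change (M.insert P.α ≫ extend g (F ⊚ C.X)) ▷ G = g ≫ N.insert P.α ▷ G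
  rw [← cancel_mono (assoc₅ N.X G F C.X G).hom,
    ← cancel_mono (𝒟.associator N.X G (F ⊚ C.X ⊚ G)).inv]
  simp only [Category.assoc]
  rw [reassoc_of% insert_whiskerRight, hg, assoc₅_hom_inv,
    ← insert_whiskerRight, Category.assoc, Category.assoc, reassoc_of% assoc₅_hom_inv, extend]
  simp only [𝒟.comp_whiskerRight, Category.assoc]
  rw [reassoc_of% TwoSemicategory.hom_inv_whiskerRight, reassoc_of% 𝒟.associator_naturality_left,
    𝒟.whisker_exchange]

/-- Identifies `X I ⟶ X ⟶ X I'` with `X` applied to the canonical `I ⟶ I'`, so that a counit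
factoring through `I` can be traded for `ε`. -/
theorem lax_r_oplax_r (X : 𝒟.Hom j m) :
    (𝒟.lax j).r X ≫ (𝒟.oplax j).r X =
      X ◁ ((𝒟.oplax j).l (𝒟.lax j).I ≫ (𝒟.lax j).r (𝒟.oplax j).I) := by
  rw [𝒟.whiskerLeft_comp, ← (𝒟.oplax j).l_r, Category.assoc, (𝒟.lax j).r_comp,
    (𝒟.lax j).r_naturality]

/-- The map `X ⊚ C ⟶ X` induced by a morphism from a coalgebra to the lax unit. -/
def counitMap (e : C.X ⟶ (𝒟.lax i).I) (X : 𝒟.Hom i m) : X ⊚ C.X ⟶ X :=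
  X ◁ e ≫ (𝒟.lax i).r X

theorem counitMap_naturality (e : C.X ⟶ (𝒟.lax i).I) {X Y : 𝒟.Hom i m} (f : X ⟶ Y) :
    f ▷ C.X ≫ counitMap e Y = counitMap e X ≫ f := by
  rw [counitMap, counitMap, ← reassoc_of% 𝒟.whisker_exchange, (𝒟.lax i).r_naturality,
    Category.assoc]

/-- When `ε` factors through the lax unit, coactions are split as 2-morphisms: after the mono `N ⟶ N
I'` the claim is the counit law. -/
theorem ρ_counitMap {e : C.X ⟶ (𝒟.lax i).I}
    (he : e ≫ (𝒟.oplax i).l (𝒟.lax i).I ≫ (𝒟.lax i).r (𝒟.oplax i).I = C.ε) (N : Comod C m)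
    [Mono ((𝒟.oplax i).r N.X)] : N.ρ ≫ counitMap e N.X = 𝟙 N.X := by
  rw [← cancel_mono ((𝒟.oplax i).r N.X), Category.assoc, counitMap, Category.assoc,
    lax_r_oplax_r, ← 𝒟.whiskerLeft_comp, he, N.counit, Category.id_comp]

/-- The homomorphism whose kernel is the coaction `N ⟶ N ⊚ C`. -/
def cobar (N : Comod C m) : actObj N.X C.regular ⟶ actObj (N.X ⊚ C.X) C.regular :=
  freeMap C N.ρ - ((actFunctor N.X).map C.regular.coact ≫
    ((comodRep C).μ N.X C.X).inv.app C.regular :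
      actObj N.X C.regular ⟶ actObj (N.X ⊚ C.X) C.regular)

theorem coact_cobar (N : Comod C m) : N.coact ≫ N.cobar = 0 := by
  rw [cobar, Preadditive.comp_sub, sub_eq_zero]
  refine Subtype.ext ?_
  change N.ρ ≫ N.ρ ▷ C.X = N.ρ ≫ N.X ◁ C.Δ ≫ (𝒟.associator _ _ _).inv
  have h := N.coassoc
  rwa [← Category.assoc, ← Iso.eq_comp_inv, Category.assoc] at h

/-- Together with `ρ_counitMap`, this says that `N ⟶ N C ⇉ N C C` is a split equalizer. On `t` the
map `N.ρ ▷ C` may be replaced by `N ◁ Δ`, the coaction of the comodule `N C`, which is again split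
by its counit map. -/
theorem comp_counitMap_ρ {e : C.X ⟶ (𝒟.lax i).I}
    (he : e ≫ (𝒟.oplax i).l (𝒟.lax i).I ≫ (𝒟.lax i).r (𝒟.oplax i).I = C.ε) (N : Comod C m)
    [h : Mono ((𝒟.oplax i).r (N.X ⊚ C.X))] {K : 𝒟.Hom i m} (t : K ⟶ N.X ⊚ C.X)
    (ht : t ≫ N.cobar.1 = 0) : t ≫ counitMap e N.X ≫ N.ρ = t := by
  have h₁ : t ≫ N.ρ ▷ C.X = t ≫ N.X ◁ C.Δ ≫ (𝒟.associator _ _ _).inv := by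
    rw [← sub_eq_zero, ← Preadditive.comp_sub]
    exact ht
  have h₂ : (N.X ◁ C.Δ ≫ (𝒟.associator _ _ _).inv) ≫ counitMap e (N.X ⊚ C.X) = 𝟙 _ :=
    @ρ_counitMap _ _ _ _ _ _ _ _ he (actObj N.X C.regular) h
  rw [← counitMap_naturality, reassoc_of% h₁, ← Category.assoc (N.X ◁ C.Δ), h₂,
    Category.comp_id]

/-- The counit `F ⊚ C ⊚ G ⟶ I` with values in the lax unit. -/
def conjLaxε (C : 𝒟.Coalgebra i) (P : 𝒟.AdjointPair F G) : F ⊚ C.X ⊚ G ⟶ (𝒟.lax j).I :=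
  F ◁ C.ε ▷ G ≫ P.retr G ≫ P.β

theorem conjLaxε_comp (P : 𝒟.AdjointPair F G) :
    conjLaxε C P ≫ (𝒟.oplax j).l (𝒟.lax j).I ≫ (𝒟.lax j).r (𝒟.oplax j).I = C.conjε P := by
  simp only [conjLaxε, Coalgebra.conjε, Category.assoc]

/-- The regular comodule of `F ⊚ C ⊚ G`. -/
def regularConjIso (C : 𝒟.Coalgebra i) (P : 𝒟.AdjointPair F G) :
    (C.conj P).regular ≅ actObj F (unconj P C.regular) :=
  isoMk (M := (C.conj P).regular) (N := actObj F (unconj P C.regular)) (Iso.refl (F ⊚ C.X ⊚ G)) (by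
    have h : (assoc₄ F C.X G (F ⊚ C.X ⊚ G)).inv = F ◁ (𝒟.associator _ _ _).inv ≫
      (𝒟.associator _ _ _).inv := rfl
    change 𝟙 (F ⊚ C.X ⊚ G) ≫ F ◁ (C.cut P.α G ≫ (𝒟.associator _ _ _).inv) ≫
      (𝒟.associator _ _ _).inv = (F ◁ C.cut P.α G ≫ (assoc₄ F C.X G (F ⊚ C.X ⊚ G)).inv) ≫
        𝟙 (F ⊚ C.X ⊚ G) ▷ (F ⊚ C.X ⊚ G)
    rw [h, 𝒟.id_whiskerRight, Category.comp_id, Category.id_comp, 𝒟.whiskerLeft_comp,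
      Category.assoc])

/-- Free comodules over `F ⊚ C ⊚ G` come from free comodules over `C`. -/
def freeConjIso (C : 𝒟.Coalgebra i) (P : 𝒟.AdjointPair F G) (X : 𝒟.Hom j m) :
    actObj X (C.conj P).regular ≅ unconj P (actObj X (actObj F C.regular)) :=
  (actFunctor X).mapIso (regularConjIso C P ≪≫ actUnconjIso P F C.regular) ≪≫
    actUnconjIso P X (actObj F C.regular)

end
end Comod
end BilaxTwoCategory

/-! ### Condition 2: `M ↦ M ⊚ I'` is an equivalence. -/

namespace BilaxTwoCategory

section
variable {k : Type*} [Field k] {B : Type w} {𝒞 : BilaxTwoCategory.{w, v, u} k B} {i j m : B}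

theorem WeaklyFiax.eq_zero_of_whiskerRight (S : 𝒞.WeaklyFiax) {X Y : 𝒞.abel.Hom i j} (f : X ⟶ Y)
    (h : f ▷ (𝒞.abel.oplax i).I = 0) : f = 0 := by
  have := S.mono_oplax_r Y
  rw [← cancel_mono ((𝒞.abel.oplax i).r Y), zero_comp, (𝒞.abel.oplax i).r_naturality, h, comp_zero]

/-- Factorization through a mono can be tested after composing with `I'`: any `t` killing `n` kills
`h ▷ I'`, and `- ▷ I'` reflects zero. -/
theorem WeaklyFiax.exists_factor_of_whiskerRight (S : 𝒞.WeaklyFiax) {M N Q : 𝒞.abel.Hom i j} (n : N ⟶ Q)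
    [Mono n] (h : M ⟶ Q) (g : M ⊚ (𝒞.abel.oplax i).I ⟶ N ⊚ (𝒞.abel.oplax i).I)
    (hg : h ▷ (𝒞.abel.oplax i).I = g ≫ n ▷ (𝒞.abel.oplax i).I) : ∃ f : M ⟶ N, f ≫ n = h := by
  refine exists_factor n h fun Z t ht => S.eq_zero_of_whiskerRight _ ?_
  rw [𝒞.abel.comp_whiskerRight, hg, Category.assoc, ← 𝒞.abel.comp_whiskerRight, ht,
    TwoSemicategory.zero_whiskerRight, comp_zero]

end

namespace Comod

section
variable {k : Type*} [Field k] {B : Type w} {𝒞 : BilaxTwoCategory.{w, v, u} k B} {i j m : B}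
  {C : 𝒞.abel.Coalgebra i}
  (P : 𝒞.AdjointPair (𝒞.lax i).I (𝒞.oplax i).I)

theorem unconjFunctor_faithful (S : 𝒞.WeaklyFiax) : (unconjFunctor P.ι : Comod C m ⥤ _).Faithful where
  map_injective {M N f g} h := by
    refine Subtype.ext ?_
    rw [← sub_eq_zero]
    refine S.eq_zero_of_whiskerRight (f.1 - g.1) ?_
    have := (unconjFunctor P.ι).map_sub (f := f) (g := g)
    rw [h, sub_self] at this
    exact congrArg Subtype.val this

theorem unconjFunctor_full (S : 𝒞.WeaklyFiax) : (unconjFunctor P.ι : Comod C m ⥤ _).Full where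
  map_surjective {M N} g := by
    have h := insert_extend P.ι g
    have m₁ := S.mono_unitAt P C.X
    have m₂ : Mono (N.X ◁ 𝒞.abel.unitAt P.ι.α C.X) := mono_whiskerLeft _ _
    have := S.mono_oplax_r N.X
    have m₃ : Mono N.ρ := N.mono_coact_val
    have m₄ : Mono (N.insert P.ι.α) := mono_comp _ _
    -- The preimage of `g` at the level of 2-morphisms. That it whiskers to `g`, and that it is
    -- colinear, follows by cancelling monomorphisms.
    obtain ⟨f, hf⟩ := S.exists_factor_of_whiskerRight (N.insert P.ι.α) _ g.1 h
    have m₅ := mono_whiskerRight (N.insert P.ι.α) (ι (𝒞.oplax i).I)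
    let g' : M.X ⊚ ι (𝒞.oplax i).I ⟶ N.X ⊚ ι (𝒞.oplax i).I := g.1
    have hg : f ▷ ι (𝒞.oplax i).I = g' := by
      rw [← cancel_mono (N.insert P.ι.α ▷ ι (𝒞.oplax i).I)]
      exact (𝒞.abel.comp_whiskerRight _ _ _).symm.trans ((congrArg (· ▷ _) hf).trans h)
    refine ⟨homMk f ?_, Subtype.ext hg⟩
    rw [← cancel_mono (N.X ◁ 𝒞.abel.unitAt P.ι.α C.X), Category.assoc]
    refine hf.trans ?_
    change M.insert P.ι.α ≫ extend g' (ι (𝒞.lax i).I ⊚ C.X) = _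
    rw [← hg, extend_whiskerRight, insert, Category.assoc, Category.assoc,
      𝒞.abel.whisker_exchange]

/-- A subcomodule `K` of `N C` that is killed by the cobar map and contains the coaction of `N` is
`N`: the split equalizer provides the inverse of `s`. Colinearity of `s` is not assumed; it follows
since `c` is mono and colinear. -/
theorem nonempty_iso_of_cobar {e : C.X ⟶ (𝒞.abel.lax i).I}
    (he : e ≫ (𝒞.abel.oplax i).l (𝒞.abel.lax i).I ≫ (𝒞.abel.lax i).r (𝒞.abel.oplax i).I = C.ε)
    {N K : Comod C m} [Mono ((𝒞.abel.oplax i).r N.X)]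
    [Mono ((𝒞.abel.oplax i).r (N.X ⊚ C.X))] (c : K ⟶ actObj N.X C.regular) [Mono c]
    (hc : c ≫ N.cobar = 0) (s : N.X ⟶ K.X) (hs : s ≫ c.1 = N.ρ) : Nonempty (N ≅ K) := by
  let c₁ : K.X ⟶ N.X ⊚ C.X := c.1
  have m₁ : Mono c₁ := mono_val c
  have hs' : s ≫ c₁ = N.ρ := hs
  have h₁ : c₁ ≫ counitMap e N.X ≫ N.ρ = c₁ := comp_counitMap_ρ he N c₁ (congrArg Subtype.val hc)
  have h₂ : c₁ ≫ N.X ◁ C.Δ ≫ (𝒞.abel.associator _ _ _).inv = K.ρ ≫ c₁ ▷ C.X := hom_w c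
  have m₂ := mono_whiskerRight c₁ C.X
  refine ⟨isoMk ⟨s, c₁ ≫ counitMap e N.X, ?_, ?_⟩ ?_⟩
  · rw [reassoc_of% hs', ρ_counitMap he]
  · rw [← cancel_mono c₁, Category.assoc, Category.assoc, hs', h₁, Category.id_comp]
  · change s ≫ K.ρ = N.ρ ≫ s ▷ C.X
    rw [← cancel_mono (c₁ ▷ C.X), Category.assoc, Category.assoc, ← h₂, reassoc_of% hs',
      ← 𝒞.abel.comp_whiskerRight, hs', ← reassoc_of% N.coassoc, Iso.hom_inv_id, Category.comp_id]

theorem unconjFunctor_essSurj (S : 𝒞.WeaklyFiax) : (unconjFunctor P.ι : Comod C m ⥤ _).EssSurj where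
  mem_essImage N := by
    have := unconjFunctor_full (C := C) (m := m) P S
    have hr (X : 𝒞.abel.Hom i m) : Mono ((𝒞.abel.oplax i).r X) := S.mono_oplax_r X
    let D := C.conj P.ι
    let Φ : Comod C m ⥤ Comod D m := unconjFunctor P.ι
    -- `N D = (N I C) I'` lies in the image of `Φ`, and likewise `N D D`; fullness then lifts the
    -- cobar map to `d`, whose kernel `K` is the candidate preimage.
    let e : actObj N.X D.regular ≅ Φ.obj (actObj N.X (actObj (ι (𝒞.lax i).I) C.regular)) :=
      freeConjIso C P.ι N.X
    let e' : actObj (N.X ⊚ D.X) D.regular ≅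
      Φ.obj (actObj (N.X ⊚ D.X) (actObj (ι (𝒞.lax i).I) C.regular)) :=
        freeConjIso C P.ι (N.X ⊚ D.X)
    obtain ⟨d, hd⟩ : ∃ d, Φ.map d = e.inv ≫ N.cobar ≫ e'.hom := Φ.map_surjective _
    obtain ⟨K, κ, hκ, h0, -, -, hw⟩ := exists_kernel d
    let κ' : Φ.obj K ⟶ actObj N.X D.regular := Φ.map κ ≫ e.inv
    have hκ₀ : κ' ≫ N.cobar = 0 := by
      have : Φ.map κ ≫ e.inv ≫ N.cobar ≫ e'.hom = 0 := by
        rw [← hd, ← Functor.map_comp, h0, Functor.map_zero]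
      rw [← cancel_mono e'.hom, zero_comp, ← this, Category.assoc, Category.assoc]
    have m₁ := mono_whiskerRight κ.1 (ι (𝒞.oplax i).I)
    have m₂ : Mono (Φ.map κ) := mono_of_mono_val (h := m₁) (Φ.map κ)
    have m₃ : Mono κ' := mono_comp _ _
    let t := N.coact ≫ e.hom
    have ht : t ≫ Φ.map d = 0 := by
      rw [hd, Category.assoc, Iso.hom_inv_id_assoc, reassoc_of% N.coact_cobar, zero_comp]
    -- The kernel of `d` keeps its lifting property after composing with `I'`, so the coaction of
    -- `N` lifts, a priori only as a 2-morphism.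
    obtain ⟨s, hs⟩ := hw (ι (𝒞.oplax i).I) t.1 (congrArg Subtype.val ht)
    have hs' : t ≫ e.inv = N.coact := by rw [Category.assoc, Iso.hom_inv_id, Category.comp_id]
    have h₁ : s ≫ κ'.1 = N.ρ := (Category.assoc s _ _).symm.trans
      ((congrArg (· ≫ e.inv.1) hs).trans (congrArg Subtype.val hs'))
    have hr₁ := hr N.X
    have hr₂ := hr (N.X ⊚ D.X)
    exact ⟨K, ⟨(nonempty_iso_of_cobar (conjLaxε_comp P.ι) κ' hκ₀ s h₁).some.symm⟩⟩

end

end Comod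

theorem moritaTakeuchiEquivalent_unitConj {k : Type*} [Field k] {B : Type w}
    {𝒞 : BilaxTwoCategory.{w, v, u} k B} {i : B} (S : 𝒞.WeaklyFiax) (C : 𝒞.abel.Coalgebra i) :
    MoritaTakeuchiEquivalent C (Coalgebra.unitConj S C) :=
  ⟨Comod.unconjTrans C (S.unitPair i).ι, fun _ =>
    { faithful := Comod.unconjFunctor_faithful _ S
      full := Comod.unconjFunctor_full _ S
      essSurj := Comod.unconjFunctor_essSurj _ S }⟩

end BilaxTwoCategory

/-- The finitarity of `𝒞` enters only through the finitarity half of condition 3. -/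
theorem mainTheorem10 {k : Type*} [Field k] [IsAlgClosed k] {B : Type w}
    (𝒞 : BilaxTwoCategory.{w, v, u} k B) (h𝒞 : 𝒞.IsFinitary) (S : 𝒞.WeaklyFiax) (i : B)
    (C : 𝒞.abel.Coalgebra i) :
    List.TFAE [
      (BilaxTwoCategory.injRep S C).Equivalent (BilaxTwoCategory.genRep C),
      BilaxTwoCategory.MoritaTakeuchiEquivalent C
        (BilaxTwoCategory.Coalgebra.unitConj S C),
      (BilaxTwoCategory.injRep S C).IsFinitary ∧
        ∀ (j : B) (X : (BilaxTwoCategory.injRep S C).Obj j),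
          (BilaxTwoCategory.injRep S C).generated j X] := by
  have h₁ := BilaxTwoCategory.injRep_equivalent_genRep S C
  have h₂ := BilaxTwoCategory.moritaTakeuchiEquivalent_unitConj S C
  have h₃ : (BilaxTwoCategory.injRep S C).IsFinitary ∧
      ∀ (j : B) (X : (BilaxTwoCategory.injRep S C).Obj j),
        (BilaxTwoCategory.injRep S C).generated j X :=
    ⟨BilaxTwoCategory.injRep_isFinitary S C h𝒞,
      fun j X => BilaxTwoCategory.injRep_generated S C j X⟩
  tfae_have 1 → 2 := fun _ => h₂
  tfae_have 2 → 3 := fun _ => h₃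
  tfae_have 3 → 1 := fun _ => h₁
  tfae_finish
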